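/- Throughout, $\mathbb F$ is a field of characteristic $0$ and $\mathbb Z_+=\{0,1,2,\dots\}$. **Algebras of differentiable functions.** Let $I=\{1,\dots,\ell\}$, $\ell\ge 0$. An algebra of differentiable functions in the variables $u_i$ ($i\in I$) is a unital commutative associative $\mathbb F$-algebra $\mathcal V$ with a derivation $\partial$ and pairwise commuting derivations $\frac{\partial}{\partial u_i^{(n)}}$ ($i\in I$, $n\in\mathbb Z_+$) such that for each $f\in\mathcal V$ only finitely many $\frac{\partial f}{\partial u_i^{(n)}}$ are nonzero, and $\big[\frac{\partial}{\partial u_i^{(n)}},\partial\big]=\frac{\partial}{\partial u_i^{(n-1)}}$ (the right-hand side being $0$ for $n=0$). Let $\mathcal V$ be any such algebra. **$\mathfrak g$-complexes.** For a Lie algebra $\mathfrak g$, a $\mathfrak g$-complex is a graded vector space $B=\bigoplus_{k\in\mathbb Z_+}B^k$ with a differential $d$ of degree $1$ and, depending linearly on $X\in\mathfrak g$, contractions $\iota_X$ of degree $-1$ and Lie derivatives $L_X$ of degree $0$, satisfying, for supercommutators, $[d,d]=0$, $[d,\iota_X]=L_X$, $[d,L_X]=0$, $[\iota_X,\iota_Y]=0$,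 $[L_X,\iota_Y]=\iota_{[X,Y]}$, $[L_X,L_Y]=L_{[X,Y]}$. **The variational complex.** A vector field is $X=\sum_{i,n}P_{i,n}\frac{\partial}{\partial u_i^{(n)}}$, given by an arbitrary family of coefficients $P_{i,n}\in\mathcal V$; vector fields form a Lie algebra $\mathfrak g$ with $[X,Y]=\sum_{i,n}\big(X(Q_{i,n})-Y(P_{i,n})\big)\frac{\partial}{\partial u_i^{(n)}}$ for $Y=\sum Q_{i,n}\frac{\partial}{\partial u_i^{(n)}}$. (If $\mathcal V$ contains elements $u_i^{(n)}$ with $\frac{\partial u_i^{(n)}}{\partial u_j^{(m)}}=\delta_{ij}\delta_{mn}$, a vector field is the same as the derivation of $\mathcal V$ which it defines.) Let $\widetilde\Omega^\bullet$ be the free supercommutative $\mathcal V$-algebra on odd generators $\delta u_i^{(n)}$ of degree $1$. Let $\delta$ be its odd derivation with $\delta f=\sum_{i,n}\frac{\partial f}{\partial u_i^{(n)}}\delta u_i^{(n)}$ for $f\in\mathcal V$ and $\delta(\delta u_i^{(n)})=0$; let $\iota_X$ be the odd derivation with $\iota_X f=0$ and $\iota_X(\delta u_i^{(n)})=P_{i,n}$;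 and extend $\partial$ to the even derivation with $\partial(\delta u_i^{(n)})=\delta u_i^{(n+1)}$. Let $\mathfrak g^\partial\subset\mathfrak g$ be the subalgebra of evolutionary vector fields, i.e. of those $X$ for which $\iota_X$ commutes with $\partial$; equivalently, $X=X_P:=\sum_{i,n}(\partial^nP_i)\frac{\partial}{\partial u_i^{(n)}}$ with $P\in\mathcal V^\ell$. The variational complex is $\Omega^\bullet(\mathcal V)=\widetilde\Omega^\bullet/\partial\widetilde\Omega^\bullet$ with the induced differential $\delta$, contractions $\iota_X$ ($X\in\mathfrak g^\partial$) and $L_X=[\delta,\iota_X]$. **The complex of poly $\lambda$-brackets.** Let $R=\bigoplus_{i\in I}\mathbb F[\partial]u_i$ be the free $\mathbb F[\partial]$-module of rank $\ell$, regarded as a Lie conformal algebra with zero $\lambda$-bracket. It acts on $\mathcal V$ by $(p(\partial)u_i)_\lambda f=p(-\lambda)\sum_{n\ge0}\lambda^n\frac{\partial f}{\partial u_i^{(n)}}$, $p\in\mathbb F[\partial]$. Put $C^0=\mathcal V/\partial\mathcal V$, with $\int f\in C^0$ the class of $f\in\mathcal V$. For $k\ge1$ let $C^k=C^k(R,\mathcal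 V)$ be the space of $\mathbb F$-multilinear maps $c:R^k\to\mathbb F[\lambda_1,\dots,\lambda_{k-1}]\otimes\mathcal V$, $(a_1,\dots,a_k)\mapsto\{a_1{}_{\lambda_1}\cdots a_{k-1}{}_{\lambda_{k-1}}a_k\}_c$, such that replacing $a_i$ by $\partial a_i$ multiplies the value by $-\lambda_i$ if $i<k$ and applies $\lambda_1+\cdots+\lambda_{k-1}+\partial$ to it if $i=k$, and such that for every permutation $\sigma$ of $\{1,\dots,k\}$ $$\{a_1{}_{\lambda_1}\cdots a_{k-1}{}_{\lambda_{k-1}}a_k\}_c=\mathrm{sign}(\sigma)\,\{a_{\sigma(1)}{}_{\lambda_{\sigma(1)}}\cdots a_{\sigma(k-1)}{}_{\lambda_{\sigma(k-1)}}a_{\sigma(k)}\}_c\big|_{\lambda_k\mapsto\lambda_k^\dagger},\qquad \lambda_k^\dagger=-\lambda_1-\cdots-\lambda_{k-1}-\partial,$$ where here and below $\partial$ in $\lambda_k^\dagger$ is moved to the left (acts on the coefficients in $\mathcal V$). The differential is given by $\{a\}_{d\int f}=a_{-\partial}f$ ($\partial$ moved to the left) for $f\in\mathcal V$ and, for $c\in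 C^k$, $k\ge1$, by $$\{a_1{}_{\lambda_1}\cdots a_k{}_{\lambda_k}a_{k+1}\}_{dc}=\sum_{i=1}^{k+1}(-1)^{i+1}\,a_i{}_{\lambda_i}\{a_1{}_{\lambda_1}\cdots\check{a}_i\cdots a_{k+1}\}_c\Big|_{\lambda_{k+1}\mapsto\lambda_{k+1}^\dagger},$$ where the variable of the last argument of $c$ is omitted. Let $C_1=(R\otimes\mathcal V)/\partial(R\otimes\mathcal V)$ be the space of $1$-chains, taken with even parity, with the Lie bracket $[a\otimes f,b\otimes g]=b\otimes(a_\partial g)_\to f-a\otimes(b_\partial f)_\to g$, where $(\sum_n\partial^n x_n)_\to f$ stands for $\sum_n x_n\,\partial^nf$. Contractions with $1$-chains are given by $\iota_{a\otimes f}c=\int f\,\{a\}_c$ for $c\in C^1$ and $\{a_2{}_{\lambda_2}\cdots a_k\}_{\iota_{a\otimes f}c}=(\{a_\partial\,a_2{}_{\lambda_2}\cdots a_k\}_c)_\to f$ for $c\in C^k$, $k\ge2$ ($\lambda_1$ is replaced by $\partial$ acting on $f$ only), and $L_X=[d,\iota_X]$. **Theorem 0.1.** The above formulas make $C^\bullet(R,\mathcal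 V)$ a well-defined $C_1$-complex and $\Omega^\bullet(\mathcal V)$ a well-defined $\mathfrak g^\partial$-complex. There is an isomorphism of Lie algebras $C_1\xrightarrow{\sim}\mathfrak g^\partial$ sending the class of $\sum_{i\in I}u_i\otimes P_i$ to $X_P$ for every $P\in\mathcal V^\ell$. If $C_1$ is identified with $\mathfrak g^\partial$ by this isomorphism, the $\mathfrak g^\partial$-complexes $C^\bullet(R,\mathcal V)$ and $\Omega^\bullet(\mathcal V)$ are isomorphic: there are linear isomorphisms $C^k(R,\mathcal V)\cong\Omega^k(\mathcal V)$, $k\ge0$, that commute with the differentials, with all contractions and with all Lie derivatives. -/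

import Mathlib

open scoped TensorProduct Polynomial

set_option linter.unusedSectionVars false

namespace VarCalc

universe u v w

/-! ### Polynomials in formal variables with coefficients in a vector space -/

section LamPoly

variable (F : Type u) [Field F] {σ τ : Type*} {M N : Type*}
  [AddCommGroup M] [Module F M] [AddCommGroup N] [Module F N]

/-- `F[λ_s | s ∈ σ] ⊗ M`: a polynomial is the finitely supported family of its coefficients. -/
abbrev LamPoly (σ : Type*) (M : Type*) [AddCommGroup M] : Type _ := (σ →₀ ℕ) →₀ M

/-- Multiplication by `λ` on `F[λ] ⊗ M`, the latter being viewed as `ℕ →₀ M`. -/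
noncomputable def lam : (ℕ →₀ M) →ₗ[F] (ℕ →₀ M) :=
  Finsupp.lmapDomain M F (fun n => n + 1)

/-- Multiplication by the variable `λ_s`. -/
noncomputable def mulVar (s : σ) : LamPoly σ M →ₗ[F] LamPoly σ M :=
  Finsupp.lmapDomain M F (fun α => α + Finsupp.single s 1)

/-- The substitution `λ_s ↦ λ_{e s}`. -/
noncomputable def rename (e : σ → τ) : LamPoly σ M →ₗ[F] LamPoly τ M :=
  Finsupp.lmapDomain M F (Finsupp.mapDomain e)

/-- The application of a linear map to all coefficients. -/
noncomputable def mapCoeff (g : M →ₗ[F] N) : LamPoly σ M →ₗ[F] LamPoly σ N :=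
  Finsupp.mapRange.linearMap g

/-- The operator `λ_n^† = -λ_0 - ⋯ - λ_{n-1} - ∂` on `F[λ_0, …, λ_{n-1}] ⊗ M`. -/
noncomputable def lamDagger (n : ℕ) (D : M →ₗ[F] M) : Module.End F (LamPoly (Fin n) M) :=
  -(∑ j : Fin n, mulVar F j) - mapCoeff F D

/-- The substitution `λ_n ↦ λ_n^† = -λ_0 - ⋯ - λ_{n-1} - ∂` into a polynomial in
`λ_0, …, λ_n`, where `∂` is moved to the left, i.e. acts on the coefficients in `M`. -/
noncomputable def dagger (n : ℕ) (D : M →ₗ[F] M) :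
    LamPoly (Fin (n + 1)) M →ₗ[F] LamPoly (Fin n) M :=
  Finsupp.lsum F fun α : Fin (n + 1) →₀ ℕ =>
    (lamDagger F n D ^ α (Fin.last n)) ∘ₗ
      Finsupp.lsingle (Finsupp.equivFunOnFinite.symm fun j : Fin n => α j.castSucc)

end LamPoly

/-! ### Lie conformal algebras and their modules -/

/-- A Lie conformal algebra over `F`. The `λ`-bracket `[a_λ b] = ∑ λ^n c_n` is encoded by its
family of coefficients `bracket a b n = c_n` (without factorials). -/
class LieConformalAlgebra (F : Type u) (A : Type v) [Field F] [AddCommGroup A] [Module F A] where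
  deriv : A →ₗ[F] A
  bracket : A →ₗ[F] A →ₗ[F] (ℕ →₀ A)
  /-- `[∂a_λ b] = -λ [a_λ b]` -/
  bracket_deriv_left : ∀ a b, bracket (deriv a) b = -lam F (bracket a b)
  /-- `[a_λ ∂b] = (∂ + λ) [a_λ b]` -/
  bracket_deriv_right : ∀ a b, bracket a (deriv b) =
    Finsupp.mapRange.linearMap deriv (bracket a b) + lam F (bracket a b)
  /-- `[a_λ b] = -[b_{-∂-λ} a]`, with `∂` moved to the left -/
  skew : ∀ a b, bracket a b = -(bracket b a).sum fun n c =>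
    ((-Finsupp.mapRange.linearMap deriv - lam F : Module.End F (ℕ →₀ A)) ^ n) (Finsupp.single 0 c)
  /-- `[a_λ [b_μ c]] - [b_μ [a_λ c]] = [[a_λ b]_{λ+μ} c]`, the coefficient of `λ^m μ^n` -/
  jacobi : ∀ a b c m n, bracket a (bracket b c n) m - bracket b (bracket a c m) n =
    ∑ j ∈ Finset.range (m + 1), (m + n - j).choose n • bracket (bracket a b j) c (m + n - j)

/-- A module over a Lie conformal algebra. The `λ`-action `a_λ x = ∑ λ^n y_n` is encoded by its
coefficients `act a x n = y_n`. -/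
class LieConformalModule (F : Type u) (A : Type v) (M : Type w) [Field F] [AddCommGroup A]
    [Module F A] [LieConformalAlgebra F A] [AddCommGroup M] [Module F M] where
  deriv : M →ₗ[F] M
  act : A →ₗ[F] M →ₗ[F] (ℕ →₀ M)
  act_deriv_left : ∀ a x, act (LieConformalAlgebra.deriv (F := F) a) x = -lam F (act a x)
  act_deriv_right : ∀ a x, act a (deriv x) =
    Finsupp.mapRange.linearMap deriv (act a x) + lam F (act a x)
  jacobi : ∀ a b x m n, act a (act b x n) m - act b (act a x m) n =
    ∑ j ∈ Finset.range (m + 1),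
      (m + n - j).choose n • act (LieConformalAlgebra.bracket (F := F) a b j) x (m + n - j)

/-- The `A`-module `M` carries a commutative associative product such that `∂` and `a_λ` are
derivations of this product. -/
class LieConformalDerModule (F : Type u) (A : Type v) (M : Type w) [Field F] [AddCommGroup A]
    [Module F A] [LieConformalAlgebra F A] [CommRing M] [Algebra F M] extends
    LieConformalModule F A M where
  deriv_mul : ∀ x y, deriv (x * y) = deriv x * y + x * deriv y
  act_mul : ∀ a x y n, act a (x * y) n = act a x n * y + x * act a y n

/-! ### Poly `λ`-brackets -/

section PolyBracket

variable (F : Type u) (A : Type v) (M : Type w) [Field F] [AddCommGroup A] [Module F A]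
  [LieConformalAlgebra F A] [AddCommGroup M] [Module F M] [LieConformalModule F A M]

local notation "∂A" => LieConformalAlgebra.deriv (F := F) (A := A)
local notation "∂M" => LieConformalModule.deriv (F := F) (A := A) (M := M)

/-- The space of `(n+1)`-`λ`-brackets on `A` with coefficients in `M`: the multilinear maps
`c : A^{n+1} → F[λ_0, …, λ_{n-1}] ⊗ M` satisfying sesquilinearity (in the first `n` arguments, and
in the last argument) and skew-symmetry. -/
noncomputable def polyBracketSubmodule (n : ℕ) :
    Submodule F (MultilinearMap F (fun _ : Fin (n + 1) => A) (LamPoly (Fin n) M)) where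
  carrier := {c |
    (∀ (a : Fin (n + 1) → A) (i : Fin n),
      c (Function.update a i.castSucc (∂A (a i.castSucc))) = -mulVar F i (c a)) ∧
    (∀ a : Fin (n + 1) → A,
      c (Function.update a (Fin.last n) (∂A (a (Fin.last n)))) =
        ∑ j : Fin n, mulVar F j (c a) + mapCoeff F ∂M (c a)) ∧
    (∀ (a : Fin (n + 1) → A) (s : Equiv.Perm (Fin (n + 1))),
      c a = (Equiv.Perm.sign s : ℤ) •
        dagger F n ∂M (rename F (fun j : Fin n => s j.castSucc) (c (a ∘ s))))}
  add_mem' := by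
    rintro c c' ⟨h1, h2, h3⟩ ⟨h1', h2', h3'⟩
    refine ⟨fun a i => ?_, fun a => ?_, fun a s => ?_⟩
    · simp only [add_apply, h1, h1', map_add, neg_add]
    · simp only [add_apply, h2, h2', map_add, Finset.sum_add_distrib]
      abel
    · simp only [add_apply, map_add, smul_add]
      rw [← h3, ← h3']
  zero_mem' := by
    refine ⟨fun a i => ?_, fun a => ?_, fun a s => ?_⟩ <;> simp
  smul_mem' := by
    rintro r c ⟨h1, h2, h3⟩
    refine ⟨fun a i => ?_, fun a => ?_, fun a s => ?_⟩
    · simp only [smul_apply, h1, map_smul, smul_neg]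
    · simp only [smul_apply, h2, map_smul, Finset.smul_sum, smul_add]
    · simp only [smul_apply, map_smul]
      rw [smul_comm, ← h3]

/-- The spaces `C^k(A, M)`: `C^0 = M/∂M`, and `C^k` is the space of `k`-`λ`-brackets for
`k ≥ 1`. -/
def PolyBracket : ℕ → Type (max v w)
  | 0 => ULift.{v, w} (M ⧸ LinearMap.range ∂M)
  | n + 1 => polyBracketSubmodule F A M n

noncomputable instance : ∀ k, AddCommGroup (PolyBracket F A M k)
  | 0 => inferInstanceAs (AddCommGroup (ULift.{v, w} (M ⧸ LinearMap.range ∂M)))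
  | n + 1 => inferInstanceAs (AddCommGroup (polyBracketSubmodule F A M n))

noncomputable instance : ∀ k, Module F (PolyBracket F A M k)
  | 0 => inferInstanceAs (Module F (ULift.{v, w} (M ⧸ LinearMap.range ∂M)))
  | n + 1 => inferInstanceAs (Module F (polyBracketSubmodule F A M n))

variable {M}

/-- The class `∫ m ∈ C^0 = M/∂M` of `m ∈ M`. -/
noncomputable def integral (m : M) : PolyBracket F A M 0 :=
  ULift.up (Submodule.Quotient.mk m)

variable {F A}

/-- The value `{a_0 _{λ_0} ⋯ a_{n-1} _{λ_{n-1}} a_n}_c` of a poly `λ`-bracket. -/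
noncomputable def PolyBracket.val {n : ℕ} (c : PolyBracket F A M (n + 1)) (a : Fin (n + 1) → A) :
    LamPoly (Fin n) M :=
  Subtype.val (p := fun c => c ∈ polyBracketSubmodule F A M n) c a

variable (F)

/-- The operator `a_{λ_s}` on `F[λ_t | t ∈ σ] ⊗ M`, where `a_{λ_s}` commutes with all `λ_t`. -/
noncomputable def actVar {σ : Type*} (s : σ) (a : A) : LamPoly σ M →ₗ[F] LamPoly σ M :=
  Finsupp.lsum F fun α : σ →₀ ℕ =>
    Finsupp.lmapDomain M F (fun j : ℕ => α + Finsupp.single s j) ∘ₗ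
      LieConformalModule.act (F := F) a

/-- The right-hand side of the definition of `dc ∈ C^{k+1}` for `c ∈ C^k`, `k = n + 1`, evaluated
at `(a_0, …, a_k)`: the expression
`∑_i (-1)^i a_i _{λ_i} {a_0 ⋯ ǎ_i ⋯ a_k}_c
  + ∑_{i<j} (-1)^{k+i+j+1} {a_0 ⋯ ǎ_i ⋯ ǎ_j ⋯ a_k [a_i _{λ_i} a_j]}_c`
(`0 ≤ i < j ≤ k`; each argument of `c` but the last one carries its own variable), in which
`λ_k` is replaced by `λ_k^†`. In the second sum `j` is written as `j' + 1` with `i ≤ j'`; the two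
sign conventions agree because the indices of both `a_i` and `a_j` are lowered by one. -/
noncomputable def polyDiff {n : ℕ} (c : PolyBracket F A M (n + 1)) (a : Fin (n + 2) → A) :
    LamPoly (Fin (n + 1)) M :=
  dagger F (n + 1) ∂M
    (∑ i : Fin (n + 2), (-1 : ℤ) ^ (i : ℕ) •
        actVar F i (a i) (rename F (fun t : Fin n => i.succAbove t.castSucc)
          (c.val (a ∘ i.succAbove))) +
      ∑ i : Fin (n + 1), ∑ j' : Fin (n + 1), if i ≤ j' then
        (-1 : ℤ) ^ ((n + 1) + (i : ℕ) + (j' + 1 : ℕ) + 1) •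
          (LieConformalAlgebra.bracket (F := F) (a i.castSucc) (a j'.succ)).sum fun l b =>
            (mulVar F i.castSucc ^ l : Module.End F (LamPoly (Fin (n + 2)) M))
              (rename F (fun t : Fin n => i.castSucc.succAbove (j'.succAbove t))
                (c.val (Fin.snoc (α := fun _ => A)
                  (fun t : Fin n => a (i.castSucc.succAbove (j'.succAbove t))) b)))
      else 0)

/-- The linear maps `d : C^k → C^{k+1}` are the differential of the complex of poly
`λ`-brackets: `(d∫m)(a) = a_{-∂} m` (with `∂` moved to the left), and `dc` is given by `polyDiff`
for `c ∈ C^k`, `k ≥ 1`. -/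
def IsPolyBracketDifferential
    (d : ∀ k, PolyBracket F A M k →ₗ[F] PolyBracket F A M (k + 1)) : Prop :=
  (∀ (m : M) (a : Fin 1 → A), (d 0 (integral F A m)).val a =
    Finsupp.single 0 ((LieConformalModule.act (F := F) (a 0) m).sum fun j x =>
      ((-∂M : Module.End F M) ^ j) x)) ∧
  ∀ (n : ℕ) (c : PolyBracket F A M (n + 1)) (a : Fin (n + 2) → A),
    (d (n + 1) c).val a = polyDiff F c a

end PolyBracket

/-! ### The space of `1`-chains and its contraction operators -/

section Chains

variable (F : Type u) (A : Type v) (M : Type w) [Field F] [AddCommGroup A] [Module F A]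
  [LieConformalAlgebra F A] [CommRing M] [Algebra F M] [LieConformalDerModule F A M]

local notation "∂A" => LieConformalAlgebra.deriv (F := F) (A := A)
local notation "∂M" => LieConformalModule.deriv (F := F) (A := A) (M := M)

/-- The action of `∂` on `A ⊗ M`. -/
noncomputable def tensorDeriv : (A ⊗[F] M) →ₗ[F] (A ⊗[F] M) :=
  TensorProduct.map ∂A LinearMap.id + TensorProduct.map LinearMap.id ∂M

/-- The space `C_1 = (A ⊗ M)/∂(A ⊗ M)` of `1`-chains (with even parity). -/
def OneChain : Type (max v w) := (A ⊗[F] M) ⧸ LinearMap.range (tensorDeriv F A M)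

noncomputable instance : AddCommGroup (OneChain F A M) :=
  inferInstanceAs (AddCommGroup ((A ⊗[F] M) ⧸ LinearMap.range (tensorDeriv F A M)))

noncomputable instance : Module F (OneChain F A M) :=
  inferInstanceAs (Module F ((A ⊗[F] M) ⧸ LinearMap.range (tensorDeriv F A M)))

/-- The projection `A ⊗ M → C_1`. -/
noncomputable def OneChain.proj : (A ⊗[F] M) →ₗ[F] OneChain F A M :=
  (LinearMap.range (tensorDeriv F A M)).mkQ

/-- For `p = ∑ λ^n x_n ∈ F[λ] ⊗ M`, the element `p(∂)_→ m = ∑ x_n (∂^n m)` of `M`. -/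
noncomputable def arrow : M →ₗ[F] (ℕ →₀ M) →ₗ[F] M :=
  LinearMap.mk₂ F (fun m p => p.sum fun n x => x * (∂M ^ n) m)
    (fun m m' p => by simp [mul_add, Finsupp.sum_add])
    (fun r m p => by simp [Finsupp.smul_sum])
    (fun m p q => Finsupp.sum_add_index' (by simp) (by simp [add_mul]))
    (fun r m p => by
      rw [Finsupp.sum_smul_index' (by simp), Finsupp.smul_sum]; simp)

variable {M} in
theorem arrow_apply (m : M) (p : ℕ →₀ M) :
    arrow F A M m p = p.sum fun n x => x * (∂M ^ n) m := rfl

/-- For `p = ∑ λ^n b_n ∈ F[λ] ⊗ A`, the element `p(∂_1)_→ ⊗ mm' = ∑ b_n ⊗ (∂^n m) m'` of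
`A ⊗ M`, where `∂_1` acts only on the factor `m`. -/
noncomputable def arrowTensor (p : ℕ →₀ A) : M →ₗ[F] M →ₗ[F] (A ⊗[F] M) :=
  LinearMap.mk₂ F (fun m m' => p.sum fun n b => b ⊗ₜ[F] ((∂M ^ n) m * m'))
    (fun m m' k => by simp [add_mul, TensorProduct.tmul_add, Finsupp.sum_add])
    (fun r m m' => by simp [Finsupp.smul_sum])
    (fun m m' k => by simp [mul_add, TensorProduct.tmul_add, Finsupp.sum_add])
    (fun r m m' => by simp [Finsupp.smul_sum])

variable {A M} in
theorem arrowTensor_apply (p : ℕ →₀ A) (m m' : M) :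
    arrowTensor F A M p m m' = p.sum fun n b => b ⊗ₜ[F] ((∂M ^ n) m * m') := rfl

theorem arrowTensor_add (p q : ℕ →₀ A) :
    arrowTensor F A M (p + q) = arrowTensor F A M p + arrowTensor F A M q := by
  ext m m'
  simp only [arrowTensor_apply, LinearMap.add_apply]
  exact Finsupp.sum_add_index' (by simp) (by simp [TensorProduct.add_tmul])

theorem arrowTensor_smul (r : F) (p : ℕ →₀ A) :
    arrowTensor F A M (r • p) = r • arrowTensor F A M p := by
  ext m m'
  simp only [arrowTensor_apply, LinearMap.smul_apply]
  rw [Finsupp.sum_smul_index' (by simp), Finsupp.smul_sum]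
  rfl

/-- The linear map sending `a ⊗ m` to the endomorphism `n ↦ (a_∂ n)_→ m` of `M`. -/
noncomputable def chainAct : (A ⊗[F] M) →ₗ[F] Module.End F M :=
  TensorProduct.lift <| LinearMap.mk₂ F
    (fun a m => arrow F A M m ∘ₗ LieConformalModule.act (F := F) a)
    (fun a b m => by ext n; simp) (fun r a m => by ext n; simp)
    (fun a m m' => by ext n; simp) (fun r a m => by ext n; simp)

/-- The bilinear map `(a ⊗ m, b ⊗ n) ↦ [a_{∂_1} b]_→ ⊗ mn`. -/
noncomputable def chainMul : (A ⊗[F] M) →ₗ[F] (A ⊗[F] M) →ₗ[F] (A ⊗[F] M) :=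
  TensorProduct.lift <| LinearMap.mk₂ F
    (fun a m => TensorProduct.lift <| LinearMap.mk₂ F
      (fun b n => arrowTensor F A M (LieConformalAlgebra.bracket (F := F) a b) m n)
      (fun b b' n => by simp [arrowTensor_add]) (fun r b n => by simp [arrowTensor_smul])
      (fun b n n' => by simp) (fun r b n => by simp))
    (fun a a' m => by ext b n; simp [arrowTensor_add])
    (fun r a m => by ext b n; simp [arrowTensor_smul])
    (fun a m m' => by ext b n; simp) (fun r a m => by ext b n; simp)

/-- The bilinear map
`[a ⊗ m, b ⊗ n] = [a_{∂_1} b]_→ ⊗ mn + b ⊗ (a_∂ n)_→ m - a ⊗ (b_∂ m)_→ n` on `A ⊗ M`. -/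
noncomputable def preBracket : (A ⊗[F] M) →ₗ[F] (A ⊗[F] M) →ₗ[F] (A ⊗[F] M) :=
  chainMul F A M + LinearMap.lTensorHom A ∘ₗ chainAct F A M -
    (LinearMap.lTensorHom A ∘ₗ chainAct F A M).flip

variable {A M}

theorem chainAct_tmul (a : A) (m n : M) :
    chainAct F A M (a ⊗ₜ m) n = arrow F A M m (LieConformalModule.act (F := F) a n) := rfl

theorem chainMul_tmul (a b : A) (m n : M) :
    chainMul F A M (a ⊗ₜ m) (b ⊗ₜ n) =
      arrowTensor F A M (LieConformalAlgebra.bracket (F := F) a b) m n := rfl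

theorem preBracket_apply (x y : A ⊗[F] M) : preBracket F A M x y =
    chainMul F A M x y + (chainAct F A M x).lTensor A y - (chainAct F A M y).lTensor A x := rfl

theorem preBracket_tmul (a b : A) (m n : M) : preBracket F A M (a ⊗ₜ m) (b ⊗ₜ n) =
    arrowTensor F A M (LieConformalAlgebra.bracket (F := F) a b) m n +
      b ⊗ₜ arrow F A M m (LieConformalModule.act (F := F) a n) -
      a ⊗ₜ arrow F A M n (LieConformalModule.act (F := F) b m) := rfl

theorem tensorDeriv_tmul (a : A) (m : M) :
    tensorDeriv F A M (a ⊗ₜ m) = ∂A a ⊗ₜ m + a ⊗ₜ ∂M m := rfl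

theorem arrow_lam (m : M) (p : ℕ →₀ M) :
    arrow F A M m (lam F p) = arrow F A M (∂M m) p := by
  rw [arrow_apply, arrow_apply, lam, Finsupp.lmapDomain_apply,
    Finsupp.sum_mapDomain_index (by simp) (by simp [add_mul])]
  simp [pow_succ]

theorem deriv_arrow (m : M) (p : ℕ →₀ M) :
    ∂M (arrow F A M m p) =
      arrow F A M m (Finsupp.mapRange.linearMap ∂M p) + arrow F A M m (lam F p) := by
  rw [arrow_lam, arrow_apply, arrow_apply, arrow_apply, Finsupp.mapRange.linearMap_apply,
    Finsupp.sum_mapRange_index (by simp), map_finsuppSum, ← Finsupp.sum_add]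
  refine Finsupp.sum_congr fun n _ => ?_
  rw [LieConformalDerModule.deriv_mul, ← Module.End.mul_apply, ← Module.End.mul_apply,
    ← pow_succ, ← pow_succ']

theorem chainAct_deriv (x : A ⊗[F] M) : chainAct F A M (tensorDeriv F A M x) = 0 := by
  induction x with
  | zero => simp
  | add x y hx hy => rw [map_add, map_add, hx, hy, add_zero]
  | tmul a m =>
    ext n
    rw [tensorDeriv_tmul, map_add, LinearMap.add_apply, chainAct_tmul, chainAct_tmul,
      LieConformalModule.act_deriv_left, map_neg, arrow_lam]
    simp

theorem chainAct_comm (x : A ⊗[F] M) (n : M) :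
    chainAct F A M x (∂M n) = ∂M (chainAct F A M x n) := by
  induction x with
  | zero => simp
  | add x y hx hy => rw [map_add, LinearMap.add_apply, LinearMap.add_apply, map_add, hx, hy]
  | tmul a m =>
    rw [chainAct_tmul, chainAct_tmul, LieConformalModule.act_deriv_right, map_add, deriv_arrow]

theorem lTensor_chainAct_deriv (x y : A ⊗[F] M) :
    (chainAct F A M x).lTensor A (tensorDeriv F A M y) =
      tensorDeriv F A M ((chainAct F A M x).lTensor A y) := by
  induction y with
  | zero => simp
  | add y z hy hz => simp only [map_add, hy, hz]
  | tmul a m =>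
    simp only [tensorDeriv_tmul, map_add, LinearMap.lTensor_tmul, chainAct_comm]

theorem arrowTensor_lam (p : ℕ →₀ A) (m n : M) :
    arrowTensor F A M (lam F p) m n = arrowTensor F A M p (∂M m) n := by
  rw [arrowTensor_apply, arrowTensor_apply, lam, Finsupp.lmapDomain_apply,
    Finsupp.sum_mapDomain_index (by simp) (by simp [TensorProduct.add_tmul])]
  simp [pow_succ]

theorem chainMul_deriv_left (x y : A ⊗[F] M) :
    chainMul F A M (tensorDeriv F A M x) y = 0 := by
  induction x with
  | zero => simp
  | add x x' hx hx' => rw [map_add, map_add, LinearMap.add_apply, hx, hx', add_zero]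
  | tmul a m =>
    induction y with
    | zero => simp
    | add y y' hy hy' => rw [map_add, hy, hy', add_zero]
    | tmul b n =>
      rw [tensorDeriv_tmul, map_add, LinearMap.add_apply, chainMul_tmul, chainMul_tmul,
        LieConformalAlgebra.bracket_deriv_left, ← neg_one_smul F, arrowTensor_smul,
        LinearMap.smul_apply, LinearMap.smul_apply, arrowTensor_lam]
      simp

theorem chainMul_deriv_right (x y : A ⊗[F] M) :
    chainMul F A M x (tensorDeriv F A M y) = tensorDeriv F A M (chainMul F A M x y) := by
  induction x with
  | zero => simp
  | add x x' hx hx' => simp only [map_add, LinearMap.add_apply, hx, hx']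
  | tmul a m =>
    induction y with
    | zero => simp
    | add y y' hy hy' => simp only [map_add, hy, hy']
    | tmul b n =>
      rw [tensorDeriv_tmul, map_add, chainMul_tmul, chainMul_tmul, chainMul_tmul,
        LieConformalAlgebra.bracket_deriv_right, arrowTensor_add, LinearMap.add_apply,
        LinearMap.add_apply, arrowTensor_lam]
      simp only [arrowTensor_apply]
      rw [Finsupp.mapRange.linearMap_apply, Finsupp.sum_mapRange_index (by simp),
        map_finsuppSum, ← Finsupp.sum_add, ← Finsupp.sum_add]
      refine Finsupp.sum_congr fun n _ => ?_
      rw [tensorDeriv_tmul, LieConformalDerModule.deriv_mul, TensorProduct.tmul_add, add_assoc,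
        ← Module.End.mul_apply, ← Module.End.mul_apply, ← pow_succ, ← pow_succ']

variable (A M)

/-- The bracket on `C_1` induced by `preBracket`. -/
noncomputable def OneChain.bracket :
    OneChain F A M →ₗ[F] OneChain F A M →ₗ[F] OneChain F A M :=
  Submodule.liftQ _
    { toFun := fun x => Submodule.mapQ _ _ (preBracket F A M x) (by
        rintro _ ⟨y, rfl⟩
        rw [Submodule.mem_comap, preBracket_apply, chainMul_deriv_right, lTensor_chainAct_deriv,
          chainAct_deriv, LinearMap.lTensor_zero, LinearMap.zero_apply, sub_zero, ← map_add]
        exact LinearMap.mem_range_self _ _)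
      map_add' := fun x x' => by
        refine Submodule.linearMap_qext _ (LinearMap.ext fun y => ?_)
        simp
        rfl
      map_smul' := fun r x => by
        refine Submodule.linearMap_qext _ (LinearMap.ext fun y => ?_)
        simp
        rfl }
    (by
      rintro _ ⟨x, rfl⟩
      rw [LinearMap.mem_ker]
      refine Submodule.linearMap_qext _ (LinearMap.ext fun y => ?_)
      refine (Submodule.Quotient.mk_eq_zero _).2 ?_
      rw [preBracket_apply, chainMul_deriv_left, lTensor_chainAct_deriv, chainAct_deriv,
        LinearMap.lTensor_zero, LinearMap.zero_apply, zero_add, zero_sub, ← map_neg]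
      exact LinearMap.mem_range_self _ _)

theorem OneChain.bracket_proj (x y : A ⊗[F] M) :
    OneChain.bracket F A M (OneChain.proj F A M x) (OneChain.proj F A M y) =
      OneChain.proj F A M (preBracket F A M x y) := rfl

variable {A M}

theorem chainAct_mul (x : A ⊗[F] M) (m n : M) :
    chainAct F A M x (m * n) = chainAct F A M x m * n + m * chainAct F A M x n := by
  induction x with
  | zero => simp
  | add x y hx hy => simp only [map_add, LinearMap.add_apply, hx, hy]; ring
  | tmul a k =>
    have h : LieConformalModule.act (F := F) a (m * n) =
        Finsupp.mapRange.linearMap (LinearMap.mulRight F n) (LieConformalModule.act (F := F) a m) +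
        Finsupp.mapRange.linearMap (LinearMap.mulLeft F m)
          (LieConformalModule.act (F := F) a n) := by
      ext j
      simpa using LieConformalDerModule.act_mul a m n j
    rw [chainAct_tmul, chainAct_tmul, chainAct_tmul, h, map_add]
    simp only [arrow_apply, Finsupp.mapRange.linearMap_apply]
    rw [Finsupp.sum_mapRange_index (by simp), Finsupp.sum_mapRange_index (by simp),
      Finsupp.sum_mul, Finsupp.mul_sum]
    congr 1
    · exact Finsupp.sum_congr fun j _ => by simp only [LinearMap.mulRight_apply]; ring
    · exact Finsupp.sum_congr fun j _ => by simp only [LinearMap.mulLeft_apply]; ring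

theorem chainAct_pow (x : A ⊗[F] M) (j : ℕ) (n : M) :
    chainAct F A M x ((∂M ^ j) n) = (∂M ^ j) (chainAct F A M x n) := by
  induction j generalizing n with
  | zero => rfl
  | succ j ih => rw [pow_succ, Module.End.mul_apply, ih, chainAct_comm, Module.End.mul_apply]

/-- When the `λ`-bracket of `A` is zero, `chainAct` intertwines the bracket on `A ⊗ M` and the
commutator. -/
theorem chainAct_preBracket (hA : ∀ a b : A, LieConformalAlgebra.bracket (F := F) a b = 0)
    (x y : A ⊗[F] M) (k : M) :
    chainAct F A M (preBracket F A M x y) k =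
      chainAct F A M x (chainAct F A M y k) - chainAct F A M y (chainAct F A M x k) := by
  induction x with
  | zero => simp
  | add x x' hx hx' =>
    simp only [map_add, LinearMap.add_apply, hx, hx']; abel
  | tmul a m =>
    induction y with
    | zero => simp
    | add y y' hy hy' => simp only [map_add, LinearMap.add_apply, hy, hy']; abel
    | tmul b n =>
      have key : ∀ (x : A ⊗[F] M) (b : A) (n k : M),
          chainAct F A M x (chainAct F A M (b ⊗ₜ n) k) =
            (LieConformalModule.act (F := F) b k).sum
              (fun j z => chainAct F A M x z * (∂M ^ j) n) +
            chainAct F A M (b ⊗ₜ chainAct F A M x n) k := by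
        intro x b n k
        rw [chainAct_tmul, chainAct_tmul, arrow_apply, arrow_apply, map_finsuppSum,
          ← Finsupp.sum_add]
        exact Finsupp.sum_congr fun j _ => by rw [chainAct_mul, chainAct_pow]
      have comm : (LieConformalModule.act (F := F) b k).sum
            (fun j z => chainAct F A M (a ⊗ₜ m) z * (∂M ^ j) n) =
          (LieConformalModule.act (F := F) a k).sum
            (fun j z => chainAct F A M (b ⊗ₜ n) z * (∂M ^ j) m) := by
        have hc : ∀ i j, LieConformalModule.act (F := F) a
              (LieConformalModule.act (F := F) b k j) i =
            LieConformalModule.act (F := F) b (LieConformalModule.act (F := F) a k i) j := by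
          intro i j
          have := LieConformalModule.jacobi (F := F) a b k i j
          simpa [hA, sub_eq_zero] using this
        have expand : ∀ (S T : Finset ℕ) (a b : A) (m n : M),
            (LieConformalModule.act (F := F) b k).support ⊆ T →
            (∀ j, (LieConformalModule.act (F := F) a
              (LieConformalModule.act (F := F) b k j)).support ⊆ S) →
            (LieConformalModule.act (F := F) b k).sum
              (fun j z => chainAct F A M (a ⊗ₜ m) z * (∂M ^ j) n) =
            ∑ j ∈ T, ∑ i ∈ S, LieConformalModule.act (F := F) a
              (LieConformalModule.act (F := F) b k j) i * (∂M ^ i) m * (∂M ^ j) n := by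
          intro S T a b m n hT hS
          rw [Finsupp.sum_of_support_subset _ hT _ (by simp)]
          refine Finset.sum_congr rfl fun j _ => ?_
          rw [chainAct_tmul, arrow_apply, Finsupp.sum_of_support_subset _ (hS j) _ (by simp),
            Finset.sum_mul]
        set p := LieConformalModule.act (F := F) a k
        set q := LieConformalModule.act (F := F) b k
        have hS : ∀ j, (LieConformalModule.act (F := F) a (q j)).support ⊆ p.support := by
          intro j i hi
          rw [Finsupp.mem_support_iff] at hi ⊢
          intro h0
          exact hi (by rw [hc i j, h0]; simp)
        have hT : ∀ i, (LieConformalModule.act (F := F) b (p i)).support ⊆ q.support := by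
          intro i j hj
          rw [Finsupp.mem_support_iff] at hj ⊢
          intro h0
          exact hj (by rw [← hc i j, h0]; simp)
        rw [expand p.support q.support a b m n subset_rfl hS,
          expand q.support p.support b a n m subset_rfl hT, Finset.sum_comm]
        refine Finset.sum_congr rfl fun i _ => Finset.sum_congr rfl fun j _ => ?_
        rw [hc i j]; ring
      rw [key, key, comm, preBracket_apply, chainMul_tmul, hA, arrowTensor_apply,
        Finsupp.sum_zero_index, zero_add, map_sub, LinearMap.sub_apply, LinearMap.lTensor_tmul,
        LinearMap.lTensor_tmul]
      abel

theorem preBracket_eq (hA : ∀ a b : A, LieConformalAlgebra.bracket (F := F) a b = 0)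
    (x y : A ⊗[F] M) : preBracket F A M x y =
      (chainAct F A M x).lTensor A y - (chainAct F A M y).lTensor A x := by
  have h : chainMul F A M = 0 := by
    ext a m b n
    simp [chainMul_tmul, arrowTensor_apply, hA]
  rw [preBracket_apply, h]
  simp

theorem preBracket_jacobi (hA : ∀ a b : A, LieConformalAlgebra.bracket (F := F) a b = 0)
    (x y z : A ⊗[F] M) : preBracket F A M x (preBracket F A M y z) =
      preBracket F A M (preBracket F A M x y) z + preBracket F A M y (preBracket F A M x z) := by
  have h : ∀ x y z : A ⊗[F] M, (chainAct F A M (preBracket F A M x y)).lTensor A z =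
      (chainAct F A M x).lTensor A ((chainAct F A M y).lTensor A z) -
        (chainAct F A M y).lTensor A ((chainAct F A M x).lTensor A z) := by
    intro x y z
    have : chainAct F A M (preBracket F A M x y) =
        chainAct F A M x ∘ₗ chainAct F A M y - chainAct F A M y ∘ₗ chainAct F A M x :=
      LinearMap.ext fun k => chainAct_preBracket F hA x y k
    rw [this, LinearMap.lTensor_sub, LinearMap.lTensor_comp, LinearMap.lTensor_comp]
    rfl
  rw [preBracket_eq F hA x (preBracket F A M y z), preBracket_eq F hA (preBracket F A M x y) z,
    preBracket_eq F hA y (preBracket F A M x z), h, h, h, preBracket_eq F hA x y,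
    preBracket_eq F hA y z, preBracket_eq F hA x z]
  simp only [map_sub]
  abel

variable (A M)

/-- The Lie algebra `Π C_1`, the `λ`-bracket of `A` being zero. -/
noncomputable abbrev OneChain.lieRing
    (hA : ∀ a b : A, LieConformalAlgebra.bracket (F := F) a b = 0) :
    LieRing (OneChain F A M) where
  bracket x y := OneChain.bracket F A M x y
  add_lie x y z := by
    change OneChain.bracket F A M (x + y) z = _
    rw [map_add]; rfl
  lie_add x y z := map_add (OneChain.bracket F A M x) y z
  lie_self x := by
    obtain ⟨x, rfl⟩ := Submodule.mkQ_surjective _ x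
    change OneChain.proj F A M (preBracket F A M x x) = 0
    rw [preBracket_eq F hA, sub_self, map_zero]
  leibniz_lie x y z := by
    obtain ⟨x, rfl⟩ := Submodule.mkQ_surjective _ x
    obtain ⟨y, rfl⟩ := Submodule.mkQ_surjective _ y
    obtain ⟨z, rfl⟩ := Submodule.mkQ_surjective _ z
    change OneChain.proj F A M (preBracket F A M x (preBracket F A M y z)) =
      OneChain.proj F A M (preBracket F A M (preBracket F A M x y) z) +
        OneChain.proj F A M (preBracket F A M y (preBracket F A M x z))
    rw [preBracket_jacobi F hA, map_add]

variable {A M}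

/-- The linear map `F[λ_0, …, λ_n] ⊗ M → F[λ_1, …, λ_n] ⊗ M` that replaces `λ_0` by `∂` acting on
`m`: `λ_0^l λ_1^{α_1} ⋯ λ_n^{α_n} x ↦ λ_1^{α_1} ⋯ λ_n^{α_n} x (∂^l m)`; the remaining variables are
renumbered. -/
noncomputable def contractFirst {n : ℕ} (m : M) :
    LamPoly (Fin (n + 1)) M →ₗ[F] LamPoly (Fin n) M :=
  Finsupp.lsum F fun α : Fin (n + 1) →₀ ℕ =>
    Finsupp.lsingle α.tail ∘ₗ LinearMap.mulRight F ((∂M ^ (α 0)) m)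

/-- The linear maps `ι : C_1 → Hom(C^{k+1}, C^k)` are the contraction operators associated to
`1`-chains: `ι_{a ⊗ m} c = ∫ m c(a)` for `c ∈ C^1`, and
`{a_1 _{λ_1} ⋯ a_n}_{ι_{a ⊗ m} c} = ({a_∂ a_1 _{λ_1} ⋯ a_n}_c)_→ m` for `c ∈ C^{n+1}`, `n ≥ 1`. -/
def IsPolyBracketContraction (ι : ∀ k, OneChain F A M →ₗ[F]
    PolyBracket F A M (k + 1) →ₗ[F] PolyBracket F A M k) : Prop :=
  (∀ (a : A) (m : M) (c : PolyBracket F A M 1),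
    ι 0 (OneChain.proj F A M (a ⊗ₜ m)) c = integral F A (m * c.val (fun _ => a) 0)) ∧
  ∀ (n : ℕ) (a : A) (m : M) (c : PolyBracket F A M (n + 2)) (b : Fin (n + 1) → A),
    (ι (n + 1) (OneChain.proj F A M (a ⊗ₜ m)) c).val b =
      contractFirst (A := A) F m (c.val (Fin.cons (α := fun _ => A) a b))

end Chains

/-! ### `𝔤`-complexes -/

/-- A `𝔤`-complex with underlying graded space `⨁_k B k`: a differential `d` of degree `1`, and
contractions `ι_X` of degree `-1` and Lie derivatives `L_X` of degree `0`, linear in `X ∈ 𝔤`, that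
satisfy the relations
`[d, d] = 0`, `L_X = [d, ι_X]`, `[d, L_X] = 0`, `[ι_X, ι_Y] = 0`, `[L_X, ι_Y] = ι_{[X, Y]}`,
`[L_X, L_Y] = L_{[X, Y]}`, i.e. that define a grading-preserving homomorphism of Lie superalgebras
`η𝔤 ⊕ 𝔤 ⊕ F∂_η → End B`. -/
structure GComplex (F : Type u) (𝔤 : Type v) (B : ℕ → Type w) [Field F] [LieRing 𝔤]
    [LieAlgebra F 𝔤] [∀ k, AddCommGroup (B k)] [∀ k, Module F (B k)] where
  d : ∀ k, B k →ₗ[F] B (k + 1)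
  contr : ∀ k, 𝔤 →ₗ[F] B (k + 1) →ₗ[F] B k
  lieD : ∀ k, 𝔤 →ₗ[F] B k →ₗ[F] B k
  d_d : ∀ k b, d (k + 1) (d k b) = 0
  lieD_zero : ∀ X b, lieD 0 X b = contr 0 X (d 0 b)
  lieD_succ : ∀ k X b, lieD (k + 1) X b = d k (contr k X b) + contr (k + 1) X (d (k + 1) b)
  d_lieD : ∀ k X b, d k (lieD k X b) = lieD (k + 1) X (d k b)
  contr_contr : ∀ k X Y b, contr k X (contr (k + 1) Y b) + contr k Y (contr (k + 1) X b) = 0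
  lieD_contr : ∀ k X Y b,
    lieD k X (contr k Y b) - contr k Y (lieD (k + 1) X b) = contr k ⁅X, Y⁆ b
  lieD_lieD : ∀ k X Y b, lieD k X (lieD k Y b) - lieD k Y (lieD k X b) = lieD k ⁅X, Y⁆ b

/-- An isomorphism between a `𝔤`-complex and an `𝔥`-complex. -/
structure GComplex.Iso {F : Type*} {𝔤 𝔥 : Type*} {B C : ℕ → Type*} [Field F]
    [LieRing 𝔤] [LieAlgebra F 𝔤] [LieRing 𝔥] [LieAlgebra F 𝔥]
    [∀ k, AddCommGroup (B k)] [∀ k, Module F (B k)]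
    [∀ k, AddCommGroup (C k)] [∀ k, Module F (C k)]
    (S : GComplex F 𝔤 B) (T : GComplex F 𝔥 C) where
  lieEquiv : 𝔤 ≃ₗ⁅F⁆ 𝔥
  equiv : ∀ k, B k ≃ₗ[F] C k
  map_d : ∀ k b, equiv (k + 1) (S.d k b) = T.d k (equiv k b)
  map_contr : ∀ k X b, equiv k (S.contr k X b) = T.contr k (lieEquiv X) (equiv (k + 1) b)
  map_lieD : ∀ k X b, equiv k (S.lieD k X b) = T.lieD k (lieEquiv X) (equiv k b)

/-! ### Algebras of differentiable functions and vector fields -/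

/-- An algebra of differentiable functions in the variables `u_i`, `i ∈ I`: a differential
algebra `(V, ∂)` with commuting derivations `pd i n = ∂/∂u_i^{(n)}`. -/
class DiffFunctionAlgebra (F : Type u) (I : Type v) (V : Type w) [Field F] [CommRing V]
    [Algebra F V] where
  der : Derivation F V V
  pd : I → ℕ → Derivation F V V
  pd_comm : ∀ i m j n f, pd i m (pd j n f) = pd j n (pd i m f)
  pd_finite : ∀ f, {x : I × ℕ | pd x.1 x.2 f ≠ 0}.Finite
  pd_der_zero : ∀ i f, pd i 0 (der f) = der (pd i 0 f)
  pd_der_succ : ∀ i n f, pd i (n + 1) (der f) = der (pd i (n + 1) f) + pd i n f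

section Variational

variable (F : Type u) (I : Type v) (V : Type w) [Field F] [CommRing V] [Algebra F V]
  [DiffFunctionAlgebra F I V]

local notation "∂V" => DiffFunctionAlgebra.der (F := F) (I := I) (V := V)
local notation "∂u" => DiffFunctionAlgebra.pd (F := F) (I := I) (V := V)

/-- The finite family of all partial derivatives of `f`. -/
noncomputable def grad : V →ₗ[F] (I × ℕ →₀ V) where
  toFun f := Finsupp.ofSupportFinite (fun x => ∂u x.1 x.2 f) (DiffFunctionAlgebra.pd_finite f)
  map_add' f g := Finsupp.ext fun x => map_add (∂u x.1 x.2) f g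
  map_smul' r f := Finsupp.ext fun x => (∂u x.1 x.2).map_smul r f

variable {V} in
theorem grad_apply (f : V) (x : I × ℕ) : grad F I V f x = ∂u x.1 x.2 f := rfl

/-- The Lie algebra `𝔤` of vector fields `X = ∑ P_{i,n} ∂/∂u_i^{(n)}`, where a vector field is
given by the family of its coefficients. -/
def VectorField (_F : Type u) (I : Type v) (V : Type w) : Type (max v w) := I → ℕ → V

instance : AddCommGroup (VectorField F I V) := inferInstanceAs (AddCommGroup (I → ℕ → V))
instance : Module F (VectorField F I V) := inferInstanceAs (Module F (I → ℕ → V))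

variable {F I V}

theorem grad_mul (f g : V) : grad F I V (f * g) =
    Finsupp.mapRange.linearMap (LinearMap.mulLeft F f) (grad F I V g) +
      Finsupp.mapRange.linearMap (LinearMap.mulLeft F g) (grad F I V f) := by
  ext x
  simp [grad_apply]

/-- The derivation `f ↦ ∑ P_{i,n} ∂f/∂u_i^{(n)}` of `V` defined by a vector field. -/
noncomputable def VectorField.toDer (P : VectorField F I V) : Derivation F V V :=
  Derivation.mk'
    ((Finsupp.lsum F fun x : I × ℕ => LinearMap.mulLeft F (P x.1 x.2)) ∘ₗ grad F I V)
    (fun f g => by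
      rw [LinearMap.comp_apply, grad_mul, map_add]
      simp only [LinearMap.comp_apply, Finsupp.lsum_apply, Finsupp.mapRange.linearMap_apply,
        smul_eq_mul]
      rw [Finsupp.sum_mapRange_index (by simp), Finsupp.sum_mapRange_index (by simp),
        Finsupp.mul_sum, Finsupp.mul_sum]
      congr 1 <;> refine Finsupp.sum_congr fun x _ => ?_ <;>
        simp only [LinearMap.mulLeft_apply] <;> ring)

theorem VectorField.toDer_apply (P : VectorField F I V) (f : V) :
    P.toDer f = (grad F I V f).sum fun x g => P x.1 x.2 * g := rfl

theorem VectorField.toDer_eq_sum (P : VectorField F I V) (f : V) (S : Finset (I × ℕ))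
    (hS : (grad F I V f).support ⊆ S) : P.toDer f = ∑ x ∈ S, P x.1 x.2 * ∂u x.1 x.2 f := by
  rw [VectorField.toDer_apply, Finsupp.sum_of_support_subset _ hS _ (by simp)]
  rfl

theorem VectorField.toDer_add (P Q : VectorField F I V) (f : V) :
    (P + Q).toDer f = P.toDer f + Q.toDer f := by
  simp only [VectorField.toDer_apply, ← Finsupp.sum_add]
  exact Finsupp.sum_congr fun x _ => add_mul _ _ _

theorem VectorField.toDer_smul (r : F) (P : VectorField F I V) (f : V) :
    (r • P).toDer f = r • P.toDer f := by
  simp only [VectorField.toDer_apply, Finsupp.smul_sum]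
  exact Finsupp.sum_congr fun x _ => smul_mul_assoc _ _ _

/-- The commutator of vector fields. -/
noncomputable instance : Bracket (VectorField F I V) (VectorField F I V) where
  bracket P Q := fun i n => P.toDer (Q i n) - Q.toDer (P i n)

theorem VectorField.lie_apply (P Q : VectorField F I V) (i : I) (n : ℕ) :
    ⁅P, Q⁆ i n = P.toDer (Q i n) - Q.toDer (P i n) := rfl

theorem VectorField.toDer_lie (P Q : VectorField F I V) (f : V) :
    VectorField.toDer ⁅P, Q⁆ f = P.toDer (Q.toDer f) - Q.toDer (P.toDer f) := by
  set S := (grad F I V f).support with hS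
  have hsub : ∀ x : I × ℕ, (grad F I V (∂u x.1 x.2 f)).support ⊆ S := by
    intro x y hy
    rw [hS, Finsupp.mem_support_iff, grad_apply] at *
    intro h0
    exact hy (by rw [DiffFunctionAlgebra.pd_comm, h0, map_zero])
  have key : ∀ P Q : VectorField F I V, P.toDer (Q.toDer f) =
      ∑ x ∈ S, P.toDer (Q x.1 x.2) * ∂u x.1 x.2 f +
        ∑ x ∈ S, ∑ y ∈ S, Q x.1 x.2 * P y.1 y.2 * ∂u y.1 y.2 (∂u x.1 x.2 f) := by
    intro P Q
    rw [Q.toDer_eq_sum f S subset_rfl, map_sum, ← Finset.sum_add_distrib]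
    refine Finset.sum_congr rfl fun x _ => ?_
    rw [Derivation.leibniz, smul_eq_mul, smul_eq_mul, P.toDer_eq_sum _ S (hsub x),
      Finset.mul_sum, add_comm]
    congr 1
    · ring
    · exact Finset.sum_congr rfl fun y _ => by ring
  rw [key P Q, key Q P, VectorField.toDer_eq_sum _ f S subset_rfl,
    Finset.sum_comm (s := S) (t := S) (f := fun x y => Q x.1 x.2 * P y.1 y.2 * _)]
  have : ∀ x y : I × ℕ, Q y.1 y.2 * P x.1 x.2 * ∂u x.1 x.2 (∂u y.1 y.2 f) =
      P x.1 x.2 * Q y.1 y.2 * ∂u y.1 y.2 (∂u x.1 x.2 f) := fun x y => by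
    rw [DiffFunctionAlgebra.pd_comm]; ring
  simp only [this, VectorField.lie_apply, sub_mul, Finset.sum_sub_distrib]
  abel

noncomputable instance : LieRing (VectorField F I V) where
  add_lie P Q R := by
    funext i n
    change (P + Q).toDer (R i n) - R.toDer (P i n + Q i n) =
      (P.toDer (R i n) - R.toDer (P i n)) + (Q.toDer (R i n) - R.toDer (Q i n))
    rw [VectorField.toDer_add, map_add]; abel
  lie_add P Q R := by
    funext i n
    change P.toDer (Q i n + R i n) - (Q + R).toDer (P i n) =
      (P.toDer (Q i n) - Q.toDer (P i n)) + (P.toDer (R i n) - R.toDer (P i n))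
    rw [VectorField.toDer_add, map_add]; abel
  lie_self P := funext fun i => funext fun n => sub_self _
  leibniz_lie P Q R := by
    funext i n
    change P.toDer (Q.toDer (R i n) - R.toDer (Q i n)) - VectorField.toDer ⁅Q, R⁆ (P i n) =
      (VectorField.toDer ⁅P, Q⁆ (R i n) - R.toDer (P.toDer (Q i n) - Q.toDer (P i n))) +
      (Q.toDer (P.toDer (R i n) - R.toDer (P i n)) - VectorField.toDer ⁅P, R⁆ (Q i n))
    simp only [VectorField.toDer_lie, map_sub]
    abel

noncomputable instance : LieAlgebra F (VectorField F I V) where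
  lie_smul r P Q := by
    funext i n
    change P.toDer (r • Q i n) - (r • Q).toDer (P i n) =
      r • (P.toDer (Q i n) - Q.toDer (P i n))
    rw [VectorField.toDer_smul, Derivation.map_smul, smul_sub]

theorem VectorField.toDer_der {P : VectorField F I V} (hP : ∀ i n, P i (n + 1) = ∂V (P i n))
    (f : V) : P.toDer (∂V f) = ∂V (P.toDer f) := by
  classical
  set S := (grad F I V f).support ∪ (grad F I V (∂V f)).support with hS
  obtain ⟨J, N, hJN⟩ : ∃ (J : Finset I) (N : ℕ), S ⊆ J ×ˢ Finset.range N := by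
    refine ⟨S.image Prod.fst, (S.image Prod.snd).sup id + 1, fun x hx => ?_⟩
    rw [Finset.mem_product, Finset.mem_range]
    exact ⟨Finset.mem_image_of_mem _ hx,
      Nat.lt_succ_of_le (Finset.le_sup (f := id) (Finset.mem_image_of_mem Prod.snd hx))⟩
  have h1 : (grad F I V f).support ⊆ J ×ˢ Finset.range N :=
    Finset.subset_union_left.trans hJN
  have h2 : (grad F I V (∂V f)).support ⊆ J ×ˢ Finset.range (N + 1) :=
    (Finset.subset_union_right.trans hJN).trans
      (Finset.product_subset_product_right (Finset.range_mono (Nat.le_succ N)))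
  have h3 : ∀ i ∈ J, ∂u i N f = 0 := by
    intro i _
    by_contra h0
    have : (i, N) ∈ J ×ˢ Finset.range N := h1 (Finsupp.mem_support_iff.2 h0)
    simp at this
  rw [P.toDer_eq_sum _ _ h2, P.toDer_eq_sum _ _ h1, map_sum, Finset.sum_product,
    Finset.sum_product]
  refine Finset.sum_congr rfl fun i hi => ?_
  simp only [Derivation.leibniz, smul_eq_mul, ← hP]
  rw [Finset.sum_range_succ', DiffFunctionAlgebra.pd_der_zero, Finset.sum_add_distrib,
    add_comm (∑ n ∈ Finset.range N, P i n * _)]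
  simp only [DiffFunctionAlgebra.pd_der_succ, mul_add, Finset.sum_add_distrib]
  have h4 := Finset.sum_range_succ' (fun n => P i n * ∂V (∂u i n f)) N
  rw [Finset.sum_range_succ, h3 i hi, map_zero, mul_zero, add_zero] at h4
  rw [h4]
  have h5 : ∑ n ∈ Finset.range N, ∂u i n f * P i (n + 1) =
      ∑ n ∈ Finset.range N, P i (n + 1) * ∂u i n f :=
    Finset.sum_congr rfl fun n _ => mul_comm _ _
  rw [h5]; abel

variable (F I V)

/-- The Lie algebra `𝔤^∂` of evolutionary vector fields, i.e. of those commuting with `∂`. In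
terms of the coefficients: `P_{i,n+1} = ∂ P_{i,n}`. -/
noncomputable def evolutionary : LieSubalgebra F (VectorField F I V) where
  carrier := {P | ∀ i n, P i (n + 1) = ∂V (P i n)}
  add_mem' {P Q} hP hQ i n := by
    change P i (n + 1) + Q i (n + 1) = ∂V (P i n + Q i n)
    rw [hP, hQ, map_add]
  zero_mem' i n := (map_zero ∂V).symm
  smul_mem' r P hP i n := by
    change r • P i (n + 1) = ∂V (r • P i n)
    rw [hP, Derivation.map_smul]
  lie_mem' {P Q} hP hQ i n := by
    rw [VectorField.lie_apply, VectorField.lie_apply, map_sub, hP, hQ,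
      VectorField.toDer_der hP, VectorField.toDer_der hQ]

variable {V}

/-- The evolutionary vector field `X_P = ∑ (∂^n P_i) ∂/∂u_i^{(n)}` with characteristic `P`. -/
noncomputable def evolutionaryField (P : I → V) : evolutionary F I V :=
  ⟨fun i n => ((∂V : V →ₗ[F] V) ^ n) (P i), fun i n => by
    change ((∂V : V →ₗ[F] V) ^ (n + 1)) (P i) = ∂V (((∂V : V →ₗ[F] V) ^ n) (P i))
    rw [pow_succ', Module.End.mul_apply]; rfl⟩

variable {F I}

theorem VectorField.toDer_of_pd (P : VectorField F I V) (i : I) (n : ℕ) (y : V)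
    (hy : ∀ j m, (j, m) ≠ (i, n) → ∂u j m y = 0) (hy' : ∂u i n y = 1) : P.toDer y = P i n := by
  rw [P.toDer_eq_sum y {(i, n)}]
  · simp [hy']
  · intro z hz
    rw [Finsupp.mem_support_iff, grad_apply] at hz
    by_contra hne
    exact hz (hy z.1 z.2 fun h => hne (by rw [Finset.mem_singleton, ← h]))

/-- If `V` contains elements `u_i^{(n)}` with `∂u_i^{(n)}/∂u_j^{(m)} = δ_{ij} δ_{mn}`, a vector
field is determined by the derivation of `V` which it defines. -/
theorem VectorField.toDer_injective (x : I → ℕ → V)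
    (hx : ∀ i n j m, (j, m) ≠ (i, n) → ∂u j m (x i n) = 0) (hx' : ∀ i n, ∂u i n (x i n) = 1) :
    Function.Injective (VectorField.toDer : VectorField F I V → Derivation F V V) := by
  intro P Q hPQ
  funext i n
  rw [← P.toDer_of_pd i n (x i n) (hx i n) (hx' i n),
    ← Q.toDer_of_pd i n (x i n) (hx i n) (hx' i n), hPQ]

/-- In this case, a vector field belongs to `𝔤^∂` if and only if the derivation which it defines
commutes with `∂`. -/
theorem mem_evolutionary_iff (x : I → ℕ → V)
    (hx : ∀ i n j m, (j, m) ≠ (i, n) → ∂u j m (x i n) = 0) (hx' : ∀ i n, ∂u i n (x i n) = 1)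
    (P : VectorField F I V) :
    P ∈ evolutionary F I V ↔ ∀ f, P.toDer (∂V f) = ∂V (P.toDer f) := by
  refine ⟨fun hP f => VectorField.toDer_der hP f, fun hP i n => ?_⟩
  rw [← P.toDer_of_pd i n (x i n) (hx i n) (hx' i n), ← hP,
    P.toDer_of_pd i (n + 1) (∂V (x i n))]
  · rintro j (_ | m) h
    · by_cases h0 : (j, 0) = (i, n)
      · obtain ⟨rfl, rfl⟩ := Prod.mk.inj h0
        rw [DiffFunctionAlgebra.pd_der_zero, hx', Derivation.map_one_eq_zero]
      · rw [DiffFunctionAlgebra.pd_der_zero, hx i n j 0 h0, map_zero]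
    · have h1 : (j, m) ≠ (i, n) := fun h1 => h (by
        obtain ⟨rfl, rfl⟩ := Prod.mk.inj h1; rfl)
      rw [DiffFunctionAlgebra.pd_der_succ, hx i n j m h1, add_zero]
      by_cases h0 : (j, m + 1) = (i, n)
      · obtain ⟨rfl, rfl⟩ := Prod.mk.inj h0
        rw [hx', Derivation.map_one_eq_zero]
      · rw [hx i n j (m + 1) h0, map_zero]
  · rw [DiffFunctionAlgebra.pd_der_succ, hx i n i (n + 1) (by simp), map_zero, zero_add, hx']

/-! ### The variational complex -/

/-- The exterior algebra over `F` of the vector space with basis `δu_i^{(n)}`. -/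
abbrev ExtAlg (F : Type u) (I : Type v) [Field F] : Type _ := ExteriorAlgebra F (I × ℕ →₀ F)

/-- The basic de Rham complex `Ω̃`: the free supercommutative `V`-algebra on the odd generators
`δu_i^{(n)}`. -/
abbrev DeRham (F : Type u) (I : Type v) (V : Type w) [Field F] [CommRing V] [Algebra F V] :
    Type _ := V ⊗[F] ExtAlg F I

/-- The generator `δu_i^{(n)}`. -/
noncomputable def du (x : I × ℕ) : DeRham F I V :=
  1 ⊗ₜ ExteriorAlgebra.ι F (Finsupp.single x 1)

variable (F I V)

/-- The component `Ω̃^k = V ⊗ Λ^k`, spanned by the products `f δu_{i_1}^{(m_1)} ∧ ⋯ ∧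
δu_{i_k}^{(m_k)}`. -/
noncomputable def deRhamDeg (k : ℕ) : Submodule F (DeRham F I V) :=
  LinearMap.range ((⋀[F]^k (I × ℕ →₀ F)).subtype.lTensor V)

/-- `δf = ∑ (∂f/∂u_i^{(n)}) δu_i^{(n)}` for `f ∈ V`. -/
noncomputable def deltaFun : V →ₗ[F] DeRham F I V :=
  (Finsupp.lsum F fun x : I × ℕ =>
    (TensorProduct.mk F V (ExtAlg F I)).flip (ExteriorAlgebra.ι F (Finsupp.single x 1))) ∘ₗ
      grad F I V

/-- The differential `δ(f ω) = δf ∧ ω` for `f ∈ V` and `ω` a product of generators. -/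
noncomputable def delta : DeRham F I V →ₗ[F] DeRham F I V :=
  TensorProduct.lift ((LinearMap.mul F (DeRham F I V) ∘ₗ deltaFun F I V).compl₂
    (Algebra.TensorProduct.includeRight : ExtAlg F I →ₐ[F] DeRham F I V).toLinearMap)

/-- The even derivation of the exterior algebra with `δu_i^{(n)} ↦ δu_i^{(n+1)}`. -/
noncomputable def shiftDer : ExtAlg F I →ₗ[F] ExtAlg F I :=
  CliffordAlgebra.foldr' 0
    (LinearMap.mk₂ F
      (fun m p => ExteriorAlgebra.ι F
          (Finsupp.lmapDomain F F (fun x : I × ℕ => (x.1, x.2 + 1)) m) * p.1 +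
        ExteriorAlgebra.ι F m * p.2)
      (fun m m' p => by simp only [map_add, add_mul]; abel)
      (fun r m p => by simp only [map_smul, smul_mul_assoc, smul_add])
      (fun m p q => by simp only [Prod.fst_add, Prod.snd_add, mul_add]; abel)
      (fun r m p => by simp only [Prod.smul_fst, Prod.smul_snd, mul_smul_comm, smul_add]))
    (fun m x fx => by
      change ExteriorAlgebra.ι F _ * (ExteriorAlgebra.ι F m * x) +
        ExteriorAlgebra.ι F m * (ExteriorAlgebra.ι F _ * x + ExteriorAlgebra.ι F m * fx) = _
      rw [mul_add, ← mul_assoc, ← mul_assoc, ← mul_assoc, ExteriorAlgebra.ι_sq_zero, zero_mul,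
        add_zero, ← add_mul, ExteriorAlgebra.ι_add_mul_swap, zero_mul]
      simp)
    0

/-- The even derivation `∂` of `Ω̃` that extends `∂` on `V` and satisfies
`∂(δu_i^{(n)}) = δu_i^{(n+1)}`. -/
noncomputable def totalDer : DeRham F I V →ₗ[F] DeRham F I V :=
  TensorProduct.map (∂V : V →ₗ[F] V) LinearMap.id +
    TensorProduct.map LinearMap.id (shiftDer F I)

variable {F I V}

/-- The contraction of a product of generators with a vector field: the odd derivation with
`δu_i^{(n)} ↦ P_{i,n}`, on the exterior algebra over `F`. -/
noncomputable def contractExt (P : VectorField F I V) : ExtAlg F I →ₗ[F] DeRham F I V :=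
  CliffordAlgebra.foldr' 0
    (LinearMap.mk₂ F
      (fun m p => Finsupp.linearCombination F (fun x : I × ℕ => P x.1 x.2) m ⊗ₜ p.1 -
        (1 ⊗ₜ ExteriorAlgebra.ι F m) * p.2)
      (fun m m' p => by
        simp only [map_add, add_mul, TensorProduct.add_tmul, TensorProduct.tmul_add]; abel)
      (fun r m p => by
        simp only [map_smul, ← TensorProduct.smul_tmul', TensorProduct.tmul_smul, smul_mul_assoc,
          smul_sub])
      (fun m p q => by
        simp only [Prod.fst_add, Prod.snd_add, mul_add, TensorProduct.tmul_add]; abel)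
      (fun r m p => by
        simp only [Prod.smul_fst, Prod.smul_snd, mul_smul_comm, TensorProduct.tmul_smul,
          smul_sub]))
    (fun m x fx => by
      change _ ⊗ₜ (ExteriorAlgebra.ι F m * x) - (1 ⊗ₜ ExteriorAlgebra.ι F m) *
        (_ ⊗ₜ x - (1 ⊗ₜ ExteriorAlgebra.ι F m) * fx) = _
      rw [mul_sub, ← mul_assoc, Algebra.TensorProduct.tmul_mul_tmul,
        Algebra.TensorProduct.tmul_mul_tmul, ExteriorAlgebra.ι_sq_zero]
      simp)
    0

/-- The contraction `ι_X`: the odd derivation of `Ω̃` with `ι_X f = 0` for `f ∈ V` and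
`ι_X(δu_i^{(n)}) = P_{i,n}`. -/
noncomputable def iota (P : VectorField F I V) : DeRham F I V →ₗ[F] DeRham F I V :=
  TensorProduct.lift <| LinearMap.mk₂ F (fun f ω => f • contractExt P ω)
    (fun f g ω => add_smul f g _) (fun r f ω => smul_assoc r f _)
    (fun f ω ω' => by rw [map_add, smul_add])
    (fun r f ω => by rw [map_smul, smul_comm])

theorem shiftDer_one : shiftDer F I 1 = 0 := by
  rw [shiftDer, ← map_one (algebraMap F (CliffordAlgebra (0 : QuadraticForm F (I × ℕ →₀ F)))),
    CliffordAlgebra.foldr'_algebraMap, smul_zero]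

theorem shiftDer_mul (m : I × ℕ →₀ F) (ω : ExtAlg F I) :
    shiftDer F I (ExteriorAlgebra.ι F m * ω) = ExteriorAlgebra.ι F
        (Finsupp.lmapDomain F F (fun x : I × ℕ => (x.1, x.2 + 1)) m) * ω +
      ExteriorAlgebra.ι F m * shiftDer F I ω :=
  CliffordAlgebra.foldr'_ι_mul _ _ _ _ _ _

theorem contractExt_one (P : VectorField F I V) : contractExt P 1 = 0 := by
  rw [contractExt, ← map_one (algebraMap F (CliffordAlgebra (0 : QuadraticForm F (I × ℕ →₀ F)))),
    CliffordAlgebra.foldr'_algebraMap, smul_zero]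

theorem contractExt_mul (P : VectorField F I V) (m : I × ℕ →₀ F) (ω : ExtAlg F I) :
    contractExt P (ExteriorAlgebra.ι F m * ω) =
      Finsupp.linearCombination F (fun x : I × ℕ => P x.1 x.2) m ⊗ₜ ω -
        (1 ⊗ₜ ExteriorAlgebra.ι F m) * contractExt P ω :=
  CliffordAlgebra.foldr'_ι_mul _ _ _ _ _ _

theorem delta_tmul (f : V) (ω : ExtAlg F I) :
    delta F I V (f ⊗ₜ ω) = (grad F I V f).sum fun x g =>
      g ⊗ₜ (ExteriorAlgebra.ι F (Finsupp.single x 1) * ω) := by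
  change ((grad F I V f).sum fun x g => g ⊗ₜ[F] ExteriorAlgebra.ι F (Finsupp.single x 1)) *
    (1 ⊗ₜ ω) = _
  rw [Finsupp.sum_mul]
  simp

theorem totalDer_tmul (f : V) (ω : ExtAlg F I) :
    totalDer F I V (f ⊗ₜ ω) = ∂V f ⊗ₜ ω + f ⊗ₜ shiftDer F I ω := rfl

theorem iota_tmul (P : VectorField F I V) (f : V) (ω : ExtAlg F I) :
    iota P (f ⊗ₜ ω) = f • contractExt P ω := rfl

theorem totalDer_du (i : I) (n : ℕ) :
    totalDer F I V (du (i, n)) = du (i, n + 1) := by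
  have := shiftDer_mul (F := F) (Finsupp.single (i, n) 1) 1
  rw [mul_one, mul_one, shiftDer_one, mul_zero, add_zero, Finsupp.lmapDomain_apply,
    Finsupp.mapDomain_single] at this
  rw [du, du, totalDer_tmul, this]
  simp

theorem iota_du (P : VectorField F I V) (i : I) (n : ℕ) : iota P (du (i, n)) = P i n ⊗ₜ 1 := by
  have := contractExt_mul P (Finsupp.single (i, n) 1) 1
  rw [mul_one, contractExt_one, mul_zero, sub_zero] at this
  rw [du, iota_tmul, this]
  simp

variable (F I V) in
theorem tmul_mem_deRhamDeg {k : ℕ} (f : V) {ω : ExtAlg F I} (h : ω ∈ ⋀[F]^k (I × ℕ →₀ F)) :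
    f ⊗ₜ ω ∈ deRhamDeg F I V k :=
  ⟨f ⊗ₜ ⟨ω, h⟩, rfl⟩

theorem deRhamDeg_le {k : ℕ} {S : Submodule F (DeRham F I V)}
    (h : ∀ (f : V), ∀ ω ∈ ⋀[F]^k (I × ℕ →₀ F), f ⊗ₜ ω ∈ S) : deRhamDeg F I V k ≤ S := by
  rintro _ ⟨x, rfl⟩
  induction x with
  | zero => simp
  | add x y hx hy => rw [map_add]; exact S.add_mem hx hy
  | tmul f ω => exact h f ω ω.2

theorem delta_mem {k : ℕ} {ω : DeRham F I V} (h : ω ∈ deRhamDeg F I V k) :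
    delta F I V ω ∈ deRhamDeg F I V (k + 1) := by
  refine deRhamDeg_le (S := (deRhamDeg F I V (k + 1)).comap (delta F I V)) ?_ h
  intro f ω hω
  rw [Submodule.mem_comap, delta_tmul]
  refine Submodule.sum_mem _ fun x _ => tmul_mem_deRhamDeg F I V _ ?_
  rw [ExteriorAlgebra.exteriorPower, pow_succ']
  exact Submodule.mul_mem_mul (LinearMap.mem_range_self _ _) hω

theorem shiftDer_mem {k : ℕ} : ∀ ω ∈ ⋀[F]^k (I × ℕ →₀ F),
    shiftDer F I ω ∈ ⋀[F]^k (I × ℕ →₀ F) := by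
  induction k with
  | zero =>
    intro ω hω
    rw [ExteriorAlgebra.exteriorPower, pow_zero] at hω
    obtain ⟨r, rfl⟩ := Submodule.mem_one.1 hω
    rw [Algebra.algebraMap_eq_smul_one, map_smul, shiftDer_one, smul_zero]
    exact Submodule.zero_mem _
  | succ k ih =>
    intro ω hω
    rw [ExteriorAlgebra.exteriorPower, pow_succ'] at hω ⊢
    refine Submodule.mul_induction_on hω ?_ fun x y hx hy => ?_
    · rintro _ ⟨m, rfl⟩ ω hω
      rw [shiftDer_mul]
      exact Submodule.add_mem _ (Submodule.mul_mem_mul (LinearMap.mem_range_self _ _) hω)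
        (Submodule.mul_mem_mul (LinearMap.mem_range_self _ _) (ih ω hω))
    · rw [map_add]; exact Submodule.add_mem _ hx hy

theorem totalDer_mem {k : ℕ} {ω : DeRham F I V} (h : ω ∈ deRhamDeg F I V k) :
    totalDer F I V ω ∈ deRhamDeg F I V k := by
  refine deRhamDeg_le (S := (deRhamDeg F I V k).comap (totalDer F I V)) ?_ h
  intro f ω hω
  rw [Submodule.mem_comap, totalDer_tmul]
  exact Submodule.add_mem _ (tmul_mem_deRhamDeg F I V _ hω)
    (tmul_mem_deRhamDeg F I V _ (shiftDer_mem ω hω))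

theorem smul_mem_deRhamDeg {k : ℕ} (f : V) {ω : DeRham F I V} (h : ω ∈ deRhamDeg F I V k) :
    f • ω ∈ deRhamDeg F I V k := by
  refine deRhamDeg_le (S := (deRhamDeg F I V k).comap
    (LinearMap.lsmul V (DeRham F I V) f |>.restrictScalars F)) ?_ h
  intro g ω hω
  exact tmul_mem_deRhamDeg F I V (f * g) hω

theorem ι_mul_mem_deRhamDeg {k : ℕ} (m : I × ℕ →₀ F) {ω : DeRham F I V}
    (h : ω ∈ deRhamDeg F I V k) :
    (1 ⊗ₜ ExteriorAlgebra.ι F m : DeRham F I V) * ω ∈ deRhamDeg F I V (k + 1) := by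
  refine deRhamDeg_le (S := (deRhamDeg F I V (k + 1)).comap
    (LinearMap.mulLeft F (1 ⊗ₜ ExteriorAlgebra.ι F m : DeRham F I V))) ?_ h
  intro g ω hω
  rw [Submodule.mem_comap, LinearMap.mulLeft_apply, Algebra.TensorProduct.tmul_mul_tmul]
  refine tmul_mem_deRhamDeg F I V _ ?_
  rw [ExteriorAlgebra.exteriorPower, pow_succ']
  exact Submodule.mul_mem_mul (LinearMap.mem_range_self _ _) hω

theorem contractExt_mem (P : VectorField F I V) {k : ℕ} : ∀ ω ∈ ⋀[F]^(k + 1) (I × ℕ →₀ F),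
    contractExt P ω ∈ deRhamDeg F I V k := by
  induction k with
  | zero =>
    intro ω hω
    rw [ExteriorAlgebra.exteriorPower, zero_add, pow_one] at hω
    obtain ⟨m, rfl⟩ := hω
    rw [← mul_one (ExteriorAlgebra.ι F m), contractExt_mul, contractExt_one, mul_zero, sub_zero]
    refine tmul_mem_deRhamDeg F I V _ ?_
    rw [ExteriorAlgebra.exteriorPower, pow_zero]
    exact Submodule.one_le.1 le_rfl
  | succ k ih =>
    intro ω hω
    rw [ExteriorAlgebra.exteriorPower, pow_succ'] at hω
    refine Submodule.mul_induction_on hω ?_ fun x y hx hy => ?_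
    · rintro _ ⟨m, rfl⟩ ω hω
      rw [contractExt_mul]
      exact Submodule.sub_mem _ (tmul_mem_deRhamDeg F I V _ hω)
        (ι_mul_mem_deRhamDeg m (ih ω hω))
    · rw [map_add]; exact Submodule.add_mem _ hx hy

theorem iota_mem (P : VectorField F I V) {k : ℕ} {ω : DeRham F I V}
    (h : ω ∈ deRhamDeg F I V (k + 1)) : iota P ω ∈ deRhamDeg F I V k := by
  refine deRhamDeg_le (S := (deRhamDeg F I V k).comap (iota P)) ?_ h
  intro f ω hω
  rw [Submodule.mem_comap, iota_tmul]
  exact smul_mem_deRhamDeg f (contractExt_mem P ω hω)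

/-- A vector field `X` belongs to `𝔤^∂` if and only if `[ι_X, ∂] = 0` on `Ω̃`. -/
theorem mem_evolutionary_iff_iota (P : VectorField F I V) : P ∈ evolutionary F I V ↔
    ∀ ω, iota P (totalDer F I V ω) = totalDer F I V (iota P ω) := by
  constructor
  · intro hP
    have hlin : ∀ (f : V) (ω : DeRham F I V),
        totalDer F I V (f • ω) = ∂V f • ω + f • totalDer F I V ω := by
      intro f ω
      induction ω using TensorProduct.induction_on with
      | zero => simp
      | add x y hx hy => rw [smul_add, map_add, hx, hy, map_add, smul_add, smul_add]; abel
      | tmul g ω =>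
        rw [TensorProduct.smul_tmul', totalDer_tmul, totalDer_tmul, smul_add,
          TensorProduct.smul_tmul', TensorProduct.smul_tmul', TensorProduct.smul_tmul',
          smul_eq_mul, Derivation.leibniz, TensorProduct.add_tmul]
        simp only [smul_eq_mul, mul_comm g]
        abel
    have hmul : ∀ (m : I × ℕ →₀ F) (ω : DeRham F I V),
        totalDer F I V ((1 ⊗ₜ ExteriorAlgebra.ι F m) * ω) =
          (1 ⊗ₜ ExteriorAlgebra.ι F
            (Finsupp.lmapDomain F F (fun x : I × ℕ => (x.1, x.2 + 1)) m)) * ω +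
          (1 ⊗ₜ ExteriorAlgebra.ι F m) * totalDer F I V ω := by
      intro m ω
      induction ω using TensorProduct.induction_on with
      | zero => simp
      | add x y hx hy => rw [mul_add, map_add, hx, hy, map_add, mul_add, mul_add]; abel
      | tmul g ω =>
        rw [Algebra.TensorProduct.tmul_mul_tmul, totalDer_tmul, totalDer_tmul, mul_add,
          shiftDer_mul, Algebra.TensorProduct.tmul_mul_tmul, Algebra.TensorProduct.tmul_mul_tmul,
          Algebra.TensorProduct.tmul_mul_tmul, TensorProduct.tmul_add]
        simp only [one_mul]
        abel
    have hP' : ∀ m : I × ℕ →₀ F, Finsupp.linearCombination F (fun x : I × ℕ => P x.1 x.2)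
          (Finsupp.lmapDomain F F (fun x : I × ℕ => (x.1, x.2 + 1)) m) =
        ∂V (Finsupp.linearCombination F (fun x : I × ℕ => P x.1 x.2) m) := by
      intro m
      induction m using Finsupp.induction_linear with
      | zero => simp
      | add p q hp hq => simp only [map_add, hp, hq]
      | single x r =>
        rw [Finsupp.lmapDomain_apply, Finsupp.mapDomain_single, Finsupp.linearCombination_single,
          Finsupp.linearCombination_single, Derivation.map_smul]
        rw [hP x.1 x.2]
    have hext : ∀ ω : ExtAlg F I, contractExt P (shiftDer F I ω) =
        totalDer F I V (contractExt P ω) := by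
      intro ω
      induction ω using CliffordAlgebra.left_induction with
      | algebraMap r =>
        rw [Algebra.algebraMap_eq_smul_one, map_smul, map_smul, map_smul, map_smul]
        have h1 : shiftDer F I 1 = 0 := shiftDer_one
        have h2 : contractExt P 1 = 0 := contractExt_one P
        erw [h1, h2]
        simp
      | add x y hx hy => simp only [map_add, hx, hy]
      | ι_mul x m hx =>
        change contractExt P (shiftDer F I (ExteriorAlgebra.ι F m * x)) =
          totalDer F I V (contractExt P (ExteriorAlgebra.ι F m * x))
        rw [shiftDer_mul, map_add, contractExt_mul, contractExt_mul, contractExt_mul, hx, map_sub,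
          hmul, totalDer_tmul, hP']
        abel
    intro ω
    induction ω using TensorProduct.induction_on with
    | zero => simp
    | add x y hx hy => simp only [map_add, hx, hy]
    | tmul f ω => rw [totalDer_tmul, map_add, iota_tmul, iota_tmul, iota_tmul, hlin, hext]
  · intro h i n
    have h1 := h (du (i, n))
    rw [totalDer_du, iota_du, iota_du, totalDer_tmul, shiftDer_one, TensorProduct.tmul_zero,
      add_zero] at h1
    have h2 := congrArg (Algebra.TensorProduct.lift (Algebra.ofId V V)
      ((Algebra.ofId F V).comp (ExteriorAlgebra.algebraMapInv (R := F) (M := I × ℕ →₀ F)))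
      (fun _ _ => Commute.all _ _)) h1
    simpa using h2

variable (F I V)

/-- The differential `δ : Ω̃^k → Ω̃^{k+1}`. -/
noncomputable def deltaDeg (k : ℕ) : deRhamDeg F I V k →ₗ[F] deRhamDeg F I V (k + 1) :=
  (delta F I V).restrict fun _ h => delta_mem h

/-- The operator `∂ : Ω̃^k → Ω̃^k`. -/
noncomputable def totalDerDeg (k : ℕ) : deRhamDeg F I V k →ₗ[F] deRhamDeg F I V k :=
  (totalDer F I V).restrict fun _ h => totalDer_mem h

variable {F I V} in
/-- The contraction `ι_X : Ω̃^{k+1} → Ω̃^k`. -/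
noncomputable def iotaDeg (P : VectorField F I V) (k : ℕ) :
    deRhamDeg F I V (k + 1) →ₗ[F] deRhamDeg F I V k :=
  (iota P).restrict fun _ h => iota_mem P h

/-- The component `Ω^k = Ω̃^k/∂Ω̃^k` of the variational complex. -/
abbrev VarForm (k : ℕ) : Type _ :=
  deRhamDeg F I V k ⧸ LinearMap.range (totalDerDeg F I V k)

variable {F I V}

/-- `T` is the `𝔤^∂`-complex structure on `Ω = Ω̃/∂Ω̃` that is induced by the differential `δ` and
the contractions `ι_X` on `Ω̃`; the Lie derivatives are then given by Cartan's formula. -/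
def IsVariationalComplex (T : GComplex F (evolutionary F I V) (VarForm F I V)) : Prop :=
  (∀ (k : ℕ) (ω : deRhamDeg F I V k),
    T.d k (Submodule.Quotient.mk ω) = Submodule.Quotient.mk (deltaDeg F I V k ω)) ∧
  ∀ (k : ℕ) (X : evolutionary F I V) (ω : deRhamDeg F I V (k + 1)),
    T.contr k X (Submodule.Quotient.mk ω) =
      Submodule.Quotient.mk (iotaDeg (X : VectorField F I V) k ω)

end Variational

/-! ### The Lie conformal algebra `R` and its action on an algebra of differentiable functions -/

section FreeModule

variable (F : Type u) (I : Type v) [Field F]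

/-- The free `F[∂]`-module `R = ⨁_i F[∂] u_i`; the variable of `F[X]` stands for `∂`. -/
abbrev FreeDiffModule : Type (max v u) := I →₀ F[X]

variable {I}

/-- The generator `u_i` of `R`. -/
noncomputable def gen (i : I) : FreeDiffModule F I := Finsupp.single i 1

variable (I)

/-- `R` with the zero `λ`-bracket. -/
noncomputable instance : LieConformalAlgebra F (FreeDiffModule F I) where
  deriv := (LinearMap.lsmul F[X] (FreeDiffModule F I) Polynomial.X).restrictScalars F
  bracket := 0
  bracket_deriv_left a b := by simp
  bracket_deriv_right a b := by simp
  skew a b := by simp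
  jacobi a b c m n := by simp

theorem deriv_free (a : FreeDiffModule F I) :
    LieConformalAlgebra.deriv (F := F) a = (Polynomial.X : F[X]) • a := rfl

theorem bracket_free (a b : FreeDiffModule F I) :
    LieConformalAlgebra.bracket (F := F) a b = 0 := rfl

variable (V : Type w) [CommRing V] [Algebra F V] [DiffFunctionAlgebra F I V]

local notation "∂V" => DiffFunctionAlgebra.der (F := F) (I := I) (V := V)
local notation "∂u" => DiffFunctionAlgebra.pd (F := F) (I := I) (V := V)

variable {I}

/-- The `λ`-action of a generator: `u_i _λ f = ∑ λ^n ∂f/∂u_i^{(n)}`. -/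
noncomputable def genAct (i : I) : V →ₗ[F] (ℕ →₀ V) where
  toFun f := Finsupp.ofSupportFinite (fun n => ∂u i n f)
    ((DiffFunctionAlgebra.pd_finite (F := F) f).preimage (f := fun n => (i, n)) (by simp))
  map_add' f g := Finsupp.ext fun n => map_add (∂u i n) f g
  map_smul' r f := Finsupp.ext fun n => (∂u i n).map_smul r f

variable (I)

/-- The `λ`-action of `R` on `V`: `(p(∂) u_i)_λ f = p(-λ) (u_i _λ f)`. -/
noncomputable def freeAct : FreeDiffModule F I →ₗ[F] V →ₗ[F] (ℕ →₀ V) :=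
  Finsupp.lsum F fun i => LinearMap.lcomp F (ℕ →₀ V) (genAct F V i) ∘ₗ
    (Polynomial.aeval (-lam F : Module.End F (ℕ →₀ V))).toLinearMap

variable {I V}

theorem genAct_apply (i : I) (f : V) (n : ℕ) : genAct F V i f n = ∂u i n f := rfl

theorem freeAct_single (i : I) (p : F[X]) (f : V) :
    freeAct F I V (Finsupp.single i p) f =
      Polynomial.aeval (-lam F : Module.End F (ℕ →₀ V)) p (genAct F V i f) := by
  simp [freeAct]

theorem lam_apply_zero (p : ℕ →₀ V) : lam F p 0 = 0 := by
  rw [lam, Finsupp.lmapDomain_apply, Finsupp.mapDomain_of_notMem_range]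
  simp

theorem lam_apply_succ (p : ℕ →₀ V) (n : ℕ) : lam F p (n + 1) = p n := by
  rw [lam, Finsupp.lmapDomain_apply]
  exact Finsupp.mapDomain_apply (add_left_injective 1) p n

theorem lam_mapRange (g : V →ₗ[F] V) (p : ℕ →₀ V) :
    Finsupp.mapRange.linearMap g (lam F p) = lam F (Finsupp.mapRange.linearMap g p) := by
  ext n
  cases n with
  | zero => simp [lam_apply_zero]
  | succ n => simp [lam_apply_succ]

/-- Induction principle for the elements of `R`. -/
theorem free_induction {Q : FreeDiffModule F I → Prop} (a : FreeDiffModule F I)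
    (zero : Q 0) (add : ∀ a b, Q a → Q b → Q (a + b)) (smul : ∀ (r : F) a, Q a → Q (r • a))
    (deriv : ∀ a, Q a → Q ((Polynomial.X : F[X]) • a)) (base : ∀ i, Q (gen F i)) : Q a := by
  induction a using Finsupp.induction_linear with
  | zero => exact zero
  | add a b ha hb => exact add a b ha hb
  | single i p =>
    induction p using Polynomial.induction_on' with
    | add p q hp hq => rw [Finsupp.single_add]; exact add _ _ hp hq
    | monomial n r =>
      have h : ∀ n : ℕ, Q (Finsupp.single i (Polynomial.X ^ n)) := by
        intro n
        induction n with
        | zero => simpa [gen] using base i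
        | succ n ih =>
          have := deriv _ ih
          rwa [Finsupp.smul_single, smul_eq_mul, ← pow_succ'] at this
      have := smul r _ (h n)
      rwa [Finsupp.smul_single, Polynomial.smul_X_eq_monomial] at this

theorem freeAct_gen (i : I) (f : V) : freeAct F I V (gen F i) f = genAct F V i f := by
  simp [gen, freeAct_single]

theorem freeAct_X_smul (a : FreeDiffModule F I) (f : V) :
    freeAct F I V ((Polynomial.X : F[X]) • a) f = -lam F (freeAct F I V a f) := by
  induction a using Finsupp.induction_linear with
  | zero => simp
  | add a b ha hb =>
    simp only [smul_add, map_add, LinearMap.add_apply, ha, hb, neg_add]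
  | single i p =>
    rw [Finsupp.smul_single, freeAct_single, freeAct_single, smul_eq_mul, map_mul,
      Polynomial.aeval_X]
    rfl

/-- The `R`-module `V`. -/
noncomputable instance : LieConformalDerModule F (FreeDiffModule F I) V where
  deriv := ∂V
  act := freeAct F I V
  act_deriv_left a x := freeAct_X_smul F a x
  act_deriv_right a x := by
    induction a using free_induction with
    | zero => simp
    | add a b ha hb => simp only [map_add, LinearMap.add_apply, ha, hb]; abel
    | smul r a ha => simp only [map_smul, LinearMap.smul_apply, ha, smul_add]
    | deriv a ha =>
      rw [freeAct_X_smul, freeAct_X_smul, ha, map_add, map_neg, map_neg, lam_mapRange]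
      abel
    | base i =>
      rw [freeAct_gen, freeAct_gen]
      ext n
      cases n with
      | zero =>
        simpa [lam_apply_zero, genAct_apply] using DiffFunctionAlgebra.pd_der_zero i x
      | succ n =>
        simpa [lam_apply_succ, genAct_apply] using DiffFunctionAlgebra.pd_der_succ i n x
  jacobi a b x m n := by
    rw [Finset.sum_eq_zero (fun j _ => by rw [bracket_free]; simp), sub_eq_zero]
    induction a using free_induction generalizing m with
    | zero => simp
    | add a a' ha ha' => simp only [map_add, LinearMap.add_apply, Finsupp.add_apply, ha, ha']
    | smul r a ha => simp only [map_smul, LinearMap.smul_apply, Finsupp.smul_apply, ha]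
    | deriv a ha =>
      rw [freeAct_X_smul, freeAct_X_smul]
      cases m with
      | zero => simp [lam_apply_zero]
      | succ m => simp [lam_apply_succ, ha]
    | base i =>
      rw [freeAct_gen, freeAct_gen, genAct_apply, genAct_apply]
      induction b using free_induction generalizing n with
      | zero => simp
      | add b b' hb hb' => simp only [map_add, LinearMap.add_apply, Finsupp.add_apply, hb, hb']
      | smul r b hb =>
        simp only [map_smul, LinearMap.smul_apply, Finsupp.smul_apply, hb, Derivation.map_smul]
      | deriv b hb =>
        rw [freeAct_X_smul, freeAct_X_smul]
        cases n with
        | zero => simp [lam_apply_zero]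
        | succ n => simp [lam_apply_succ, hb]
      | base j =>
        rw [freeAct_gen, freeAct_gen, genAct_apply, genAct_apply]
        exact DiffFunctionAlgebra.pd_comm i m j n x
  deriv_mul x y := by
    change ∂V (x * y) = ∂V x * y + x * ∂V y
    rw [Derivation.leibniz, smul_eq_mul, smul_eq_mul]; ring
  act_mul a x y n := by
    induction a using free_induction generalizing n with
    | zero => simp
    | add a b ha hb =>
      simp only [map_add, LinearMap.add_apply, Finsupp.add_apply, ha, hb]; ring
    | smul r a ha =>
      simp only [map_smul, LinearMap.smul_apply, Finsupp.smul_apply, ha, smul_add,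
        smul_mul_assoc, mul_smul_comm]
    | deriv a ha =>
      rw [freeAct_X_smul, freeAct_X_smul, freeAct_X_smul]
      cases n with
      | zero => simp [lam_apply_zero]
      | succ n => simp [lam_apply_succ, ha]; ring
    | base i =>
      rw [freeAct_gen, freeAct_gen, freeAct_gen, genAct_apply, genAct_apply, genAct_apply,
        Derivation.leibniz, smul_eq_mul, smul_eq_mul]
      ring

/-- `u_i _λ f = ∑ λ^n ∂f/∂u_i^{(n)}`. -/
theorem act_gen (i : I) (f : V) (n : ℕ) :
    LieConformalModule.act (F := F) (gen F i) f n = ∂u i n f := by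
  change freeAct F I V (gen F i) f n = _
  rw [freeAct_gen, genAct_apply]

noncomputable instance : LieRing (OneChain F (FreeDiffModule F I) V) :=
  OneChain.lieRing F (FreeDiffModule F I) V fun _ _ => rfl

noncomputable instance : LieAlgebra F (OneChain F (FreeDiffModule F I) V) where
  lie_smul r x y := map_smul (OneChain.bracket F (FreeDiffModule F I) V x) r y

variable (I V)

/-- `S` is the `C_1`-complex structure on `C^•(R, V)`; the Lie derivatives are given by Cartan's
formula. -/
def IsPolyBracketComplex (S : GComplex F (OneChain F (FreeDiffModule F I) V)
    (PolyBracket F (FreeDiffModule F I) V)) : Prop :=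
  IsPolyBracketDifferential F S.d ∧ IsPolyBracketContraction F S.contr

end FreeModule

end VarCalc

open VarCalc

namespace VarCalc

universe u v w

/-! ### Operators on polynomials with coefficients in a vector space -/

section LamPolyOperators

variable (F : Type u) [Field F] {σ τ υ : Type*} {M N : Type*}
  [AddCommGroup M] [Module F M] [AddCommGroup N] [Module F N]

/-! The two complexes are compared through symbols. Pair $p(\partial)u_i\in R$ with the generator
$\delta u_j^{(n)}$ by $\delta_{ij}\,p(-\lambda)\lambda^n$. A form of degree $k$ then takes at
$(a_0,\dots,a_{k-1})\in R^k$ a value in $\mathbb F[\lambda_0,\dots,\lambda_{k-1}]\otimes\mathcal V$: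
the wedge of $m_0,\dots,m_{k-1}$ goes to the determinant of the matrix $\langle
a_j,m_r\rangle(\lambda_j)$. Here every argument has its own variable, so skew-symmetry is an honest
one and no quotient is involved.

Laplace expansion along the first row (`symbExt_ι_mul`) turns the operators on forms into operators
on symbols: the total derivative becomes $\partial+\sum_s\lambda_s$ (`symbForm_totalDer`), $\delta$
becomes $\sum_j(-1)^j a_j{}_{\lambda_j}$ (`symbForm_delta`), and the contraction with the field of
$a\otimes f$ inserts $a$ in front and lets $\lambda_0$ act as $\partial$ on $f$ (`symbForm_iota`).
Since $I$ is finite and the characteristic is $0$, forms of degree $k$ are the same as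
skew-symmetric families of polynomials indexed by $k$-tuples of generators: `ofSymb`, with its
factor $1/k!$, inverts the symbol map (`symbForm_ofSymb`, `ofSymb_symbForm`).

For $k=n+1\ge1$, the substitution $\lambda_n\mapsto\lambda_n^\dagger$ kills the image of
$\partial+\sum_s\lambda_s$ and identifies the quotient by it with the polynomials in one variable
less (`dagger_totalLam`, `dagger_rename_castSucc`, `exists_rename_dagger_add_totalLam`). Composed
with the symbol, it sends forms to poly $\lambda$-brackets. This map is onto because a bracket can
be antisymmetrised in $n+1$ variables. Its kernel is exactly $\partial\widetilde\Omega$: if all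
symbols at generators are of the form $(\partial+\sum_s\lambda_s)g$, then $g$ inherits skew-symmetry
because $\partial+\sum_s\lambda_s$ is injective (`totalLam_injective`), so $g$ is itself the symbol
of a form. In degree $0$ both sides are $\mathcal V/\partial\mathcal V$.

The Cartan relations are proved on $\widetilde\Omega$ and descend to $\Omega$. The structure on
$C^\bullet(R,\mathcal V)$ is defined by transport along the isomorphism, which makes the relations
automatic; what remains is that the transported operators are given by the prescribed formulas
(`isPolyBracketComplex`). On the Lie algebra side, $a\otimes f$ goes to the field with coefficients
$\langle a,\delta u_i^{(n)}\rangle(\partial)f$, and the inverse is $X\mapsto\sum_i u_i\otimes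
P_{i,0}$. -/

theorem mulVar_single (s : σ) (α : σ →₀ ℕ) (m : M) :
    mulVar F s (Finsupp.single α m) = Finsupp.single (α + Finsupp.single s 1) m := by
  rw [mulVar, Finsupp.lmapDomain_apply, Finsupp.mapDomain_single]

theorem mulVar_pow_single (s : σ) (k : ℕ) (α : σ →₀ ℕ) (m : M) :
    (mulVar F s ^ k : Module.End F (LamPoly σ M)) (Finsupp.single α m) =
      Finsupp.single (α + Finsupp.single s k) m := by
  induction k with
  | zero => simp
  | succ k ih =>
    rw [pow_succ', Module.End.mul_apply, ih, mulVar_single, add_assoc, ← Finsupp.single_add]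

theorem rename_single (e : σ → τ) (α : σ →₀ ℕ) (m : M) :
    rename F e (Finsupp.single α m) = Finsupp.single (Finsupp.mapDomain e α) m := by
  rw [rename, Finsupp.lmapDomain_apply, Finsupp.mapDomain_single]

theorem mapCoeff_single (g : M →ₗ[F] N) (α : σ →₀ ℕ) (m : M) :
    mapCoeff F g (Finsupp.single α m) = Finsupp.single α (g m) := by
  rw [mapCoeff, Finsupp.mapRange.linearMap_apply, Finsupp.mapRange_single]

theorem mapCoeff_apply (g : M →ₗ[F] N) (p : LamPoly σ M) (α : σ →₀ ℕ) :
    mapCoeff F g p α = g (p α) := rfl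

theorem mulVar_apply_add (s : σ) (p : LamPoly σ M) (α : σ →₀ ℕ) :
    mulVar F s p (α + Finsupp.single s 1) = p α := by
  rw [mulVar, Finsupp.lmapDomain_apply]
  exact Finsupp.mapDomain_apply (add_left_injective _) p α

theorem mulVar_apply_of_eq_zero (s : σ) (p : LamPoly σ M) (α : σ →₀ ℕ) (h : α s = 0) :
    mulVar F s p α = 0 := by
  rw [mulVar, Finsupp.lmapDomain_apply, Finsupp.mapDomain_of_notMem_range]
  rintro ⟨β, rfl⟩
  simp at h

theorem mulVar_comm (s t : σ) (p : LamPoly σ M) :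
    mulVar F s (mulVar F t p) = mulVar F t (mulVar F s p) := by
  induction p using Finsupp.induction_linear with
  | zero => simp
  | add p q hp hq => simp only [map_add, hp, hq]
  | single α m => simp only [mulVar_single, add_right_comm]

theorem mapCoeff_mulVar (g : M →ₗ[F] N) (s : σ) (p : LamPoly σ M) :
    mapCoeff F g (mulVar F s p) = mulVar F s (mapCoeff F g p) := by
  induction p using Finsupp.induction_linear with
  | zero => simp
  | add p q hp hq => simp only [map_add, hp, hq]
  | single α m => simp only [mulVar_single, mapCoeff_single]

theorem rename_mulVar (e : σ → τ) (s : σ) (p : LamPoly σ M) :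
    rename F e (mulVar F s p) = mulVar F (e s) (rename F e p) := by
  induction p using Finsupp.induction_linear with
  | zero => simp
  | add p q hp hq => simp only [map_add, hp, hq]
  | single α m =>
    simp only [mulVar_single, rename_single, Finsupp.mapDomain_add, Finsupp.mapDomain_single]

theorem rename_mapCoeff (e : σ → τ) (g : M →ₗ[F] N) (p : LamPoly σ M) :
    rename F e (mapCoeff F g p) = mapCoeff F g (rename F e p) := by
  induction p using Finsupp.induction_linear with
  | zero => simp
  | add p q hp hq => simp only [map_add, hp, hq]
  | single α m => simp only [mapCoeff_single, rename_single]

theorem rename_rename (e : σ → τ) (e' : τ → υ) (p : LamPoly σ M) :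
    rename F e' (rename F e p) = rename F (e' ∘ e) p := by
  rw [rename, rename, rename, Finsupp.lmapDomain_apply, Finsupp.lmapDomain_apply,
    Finsupp.lmapDomain_apply, ← Finsupp.mapDomain_comp]
  congr 1
  funext α
  exact Finsupp.mapDomain_comp.symm

/-- The action of `∂ + ∑_s λ_s`. -/
noncomputable def totalLam [Fintype σ] (D : M →ₗ[F] M) : LamPoly σ M →ₗ[F] LamPoly σ M :=
  ∑ s, mulVar F s + mapCoeff F D

theorem totalLam_apply [Fintype σ] (D : M →ₗ[F] M) (p : LamPoly σ M) :
    totalLam F D p = ∑ s, mulVar F s p + mapCoeff F D p := by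
  simp [totalLam, LinearMap.sum_apply]

/-- The operator is symmetric in the variables, so a bijective renaming preserves it. This is what
lets permutations of arguments act modulo its image. -/
theorem rename_totalLam [Fintype σ] [Fintype τ] (e : σ ≃ τ) (D : M →ₗ[F] M) (p : LamPoly σ M) :
    rename F e (totalLam F D p) = totalLam F D (rename F e p) := by
  simp only [totalLam_apply, map_add, map_sum, rename_mulVar, rename_mapCoeff]
  rw [e.sum_comp (fun t => mulVar F t (rename F e p))]

/-- Look at the top degree in one variable $\lambda_s$: multiplication by $\lambda_s$ raises it,
while $D$ and the other variables do not. At least one variable is needed, since without variables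
the operator is $D$ itself. -/
theorem totalLam_injective [Fintype σ] [Nonempty σ] (D : M →ₗ[F] M) :
    Function.Injective (totalLam F D : LamPoly σ M →ₗ[F] LamPoly σ M) := by
  classical
  rw [injective_iff_map_eq_zero]
  intro q hq
  obtain ⟨s⟩ := ‹Nonempty σ›
  obtain ⟨N, hN⟩ : ∃ N, ∀ α : σ →₀ ℕ, N < α s → q α = 0 := by
    refine ⟨q.support.sup (fun β => β s), fun α hα => ?_⟩
    by_contra h
    exact absurd (Finset.le_sup (f := fun β : σ →₀ ℕ => β s) (Finsupp.mem_support_iff.2 h))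
      (not_le.2 hα)
  -- Descending induction on the exponent of $\lambda_s$, starting above the bound $N$; the counter
  -- $k$ measures the descent.
  have key : ∀ k (α : σ →₀ ℕ), N < α s + k → q α = 0 := by
    intro k
    induction k with
    | zero => exact hN
    | succ k ih =>
      intro α hα
      -- The coefficient of $\lambda^{\alpha+e_s}$ in $(D+\sum_t\lambda_t)q$ is $q_\alpha$ plus
      -- terms whose index has $\lambda_s$-exponent $\alpha_s+1$. The latter vanish by the induction
      -- hypothesis.
      have h := DFunLike.congr_fun hq (α + Finsupp.single s 1)
      rw [totalLam_apply, Finsupp.add_apply, Finsupp.finsetSum_apply, mapCoeff_apply,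
        ← Finset.add_sum_erase _ _ (Finset.mem_univ s), mulVar_apply_add,
        Finset.sum_eq_zero, ih (α + Finsupp.single s 1) (by simp; omega)] at h
      · simpa using h
      · intro t ht
        rw [Finset.mem_erase] at ht
        by_cases h0 : α t = 0
        · exact mulVar_apply_of_eq_zero F t q _ (by simp [h0, ht.1])
        · obtain ⟨β, rfl⟩ : ∃ β, α = β + Finsupp.single t 1 :=
            ⟨α - Finsupp.single t 1, (tsub_add_cancel_of_le
              (Finsupp.single_le_iff.2 (Nat.one_le_iff_ne_zero.2 h0))).symm⟩
          rw [add_right_comm, mulVar_apply_add]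
          refine ih _ ?_
          simp only [Finsupp.add_apply, Finsupp.single_eq_same, Finsupp.single_eq_of_ne ht.1.symm]
            at hα ⊢
          omega
  ext α
  exact key (N + 1) α (by omega)

theorem dagger_single (n : ℕ) (D : M →ₗ[F] M) (α : Fin (n + 1) →₀ ℕ) (m : M) :
    dagger F n D (Finsupp.single α m) = (lamDagger F n D ^ α (Fin.last n))
      (Finsupp.single (Finsupp.equivFunOnFinite.symm fun j : Fin n => α j.castSucc) m) := by
  rw [dagger, Finsupp.lsum_single]
  rfl

theorem lamDagger_apply (n : ℕ) (D : M →ₗ[F] M) (p : LamPoly (Fin n) M) :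
    lamDagger F n D p = -totalLam F D p := by
  simp only [lamDagger, totalLam_apply, LinearMap.sub_apply, LinearMap.neg_apply,
    LinearMap.sum_apply]
  abel

theorem lamDagger_mulVar (n : ℕ) (D : M →ₗ[F] M) (j : Fin n) (p : LamPoly (Fin n) M) :
    lamDagger F n D (mulVar F j p) = mulVar F j (lamDagger F n D p) := by
  simp only [lamDagger_apply, totalLam_apply, map_neg, map_add, map_sum, mapCoeff_mulVar,
    mulVar_comm F _ j]

theorem lamDagger_pow_comm {T : Module.End F (LamPoly (Fin n) M)} {D : M →ₗ[F] M}
    (h : ∀ p, lamDagger F n D (T p) = T (lamDagger F n D p)) (k : ℕ) (p : LamPoly (Fin n) M) :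
    (lamDagger F n D ^ k) (T p) = T ((lamDagger F n D ^ k) p) := by
  have : Commute (lamDagger F n D) T := LinearMap.ext h
  exact LinearMap.congr_fun (this.pow_left k) p

theorem dagger_mulVar_castSucc (n : ℕ) (D : M →ₗ[F] M) (j : Fin n) (p : LamPoly (Fin (n + 1)) M) :
    dagger F n D (mulVar F j.castSucc p) = mulVar F j (dagger F n D p) := by
  induction p using Finsupp.induction_linear with
  | zero => simp
  | add p q hp hq => simp only [map_add, hp, hq]
  | single α m =>
    rw [mulVar_single, dagger_single, dagger_single,
      ← lamDagger_pow_comm F (lamDagger_mulVar F n D j), mulVar_single]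
    congr 2
    · simp
    · ext t
      simp [Finsupp.single_apply]

theorem dagger_mulVar_last (n : ℕ) (D : M →ₗ[F] M) (p : LamPoly (Fin (n + 1)) M) :
    dagger F n D (mulVar F (Fin.last n) p) = lamDagger F n D (dagger F n D p) := by
  induction p using Finsupp.induction_linear with
  | zero => simp
  | add p q hp hq => simp only [map_add, hp, hq]
  | single α m =>
    rw [mulVar_single, dagger_single, dagger_single, ← Module.End.mul_apply, ← pow_succ']
    congr 2
    · simp
    · ext t
      simp

theorem dagger_mapCoeff (n : ℕ) (D : M →ₗ[F] M) (p : LamPoly (Fin (n + 1)) M) :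
    dagger F n D (mapCoeff F D p) = mapCoeff F D (dagger F n D p) := by
  induction p using Finsupp.induction_linear with
  | zero => simp
  | add p q hp hq => simp only [map_add, hp, hq]
  | single α m =>
    have h : ∀ p : LamPoly (Fin n) M, lamDagger F n D (mapCoeff F D p) =
        mapCoeff F D (lamDagger F n D p) := fun p => by
      simp only [lamDagger_apply, totalLam_apply, map_neg, map_add, map_sum, mapCoeff_mulVar]
    rw [mapCoeff_single, dagger_single, dagger_single, ← lamDagger_pow_comm F h, mapCoeff_single]

/-- By construction $\lambda_0+\dots+\lambda_{n-1}+\lambda_n^\dagger+\partial=0$. -/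
theorem dagger_totalLam (n : ℕ) (D : M →ₗ[F] M) (p : LamPoly (Fin (n + 1)) M) :
    dagger F n D (totalLam F D p) = 0 := by
  rw [totalLam_apply, Fin.sum_univ_castSucc]
  simp only [map_add, map_sum, dagger_mulVar_castSucc, dagger_mulVar_last, dagger_mapCoeff,
    lamDagger_apply, totalLam_apply]
  abel

/-- Nothing is substituted into a polynomial that does not contain $\lambda_n$, so the inclusion of
such polynomials is a section of the substitution. -/
theorem dagger_rename_castSucc (n : ℕ) (D : M →ₗ[F] M) (p : LamPoly (Fin n) M) :
    dagger F n D (rename F Fin.castSucc p) = p := by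
  induction p using Finsupp.induction_linear with
  | zero => simp
  | add p q hp hq => simp only [map_add, hp, hq]
  | single α m =>
    rw [rename_single, dagger_single, Finsupp.mapDomain_of_notMem_range, pow_zero]
    · ext t
      simp [Finsupp.mapDomain_apply (Fin.castSucc_injective n)]
    · rintro ⟨t, ht⟩
      exact (Fin.castSucc_lt_last t).ne ht

/-- Modulo the image of `∂ + ∑ λ_s`, a polynomial does not depend on the last variable. -/
theorem exists_rename_dagger_add_totalLam (n : ℕ) (D : M →ₗ[F] M) (p : LamPoly (Fin (n + 1)) M) :
    ∃ q, p = rename F Fin.castSucc (dagger F n D p) + totalLam F D q := by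
  -- It is enough to decompose monomials with an unspecified remainder $r$ free of $\lambda_n$:
  -- applying `dagger` to the decomposition afterwards identifies $r$.
  suffices h : ∀ (k : ℕ) (α : Fin (n + 1) →₀ ℕ) (m : M), α (Fin.last n) = k →
      ∃ q r, Finsupp.single α m = rename F Fin.castSucc r + totalLam F D q by
    have h' : ∃ q r, p = rename F Fin.castSucc r + totalLam F D q := by
      induction p using Finsupp.induction_linear with
      | zero => exact ⟨0, 0, by simp⟩
      | add p p' hp hp' =>
        obtain ⟨q, r, h⟩ := hp
        obtain ⟨q', r', h'⟩ := hp'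
        exact ⟨q + q', r + r', by rw [h, h', map_add, map_add]; abel⟩
      | single α m => exact h _ α m rfl
    obtain ⟨q, r, hq⟩ := h'
    refine ⟨q, ?_⟩
    conv_rhs => rw [hq, map_add, dagger_rename_castSucc, dagger_totalLam, add_zero]
    exact hq
  intro k
  induction k with
  | zero =>
    intro α m hα
    refine ⟨0, Finsupp.single (Finsupp.equivFunOnFinite.symm fun j => α j.castSucc) m, ?_⟩
    rw [map_zero, add_zero, rename_single]
    congr 1
    ext t
    refine Fin.lastCases ?_ (fun t => ?_) t
    · rw [hα, Finsupp.mapDomain_of_notMem_range]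
      rintro ⟨t, ht⟩
      exact (Fin.castSucc_lt_last t).ne ht
    · rw [Finsupp.mapDomain_apply (Fin.castSucc_injective n)]
      simp
  | succ k ih =>
    intro α m hα
    obtain ⟨β, rfl⟩ : ∃ β, α = β + Finsupp.single (Fin.last n) 1 :=
      ⟨α - Finsupp.single (Fin.last n) 1, (tsub_add_cancel_of_le
        (Finsupp.single_le_iff.2 (by omega))).symm⟩
    have hβ : β (Fin.last n) = k := by simpa using hα
    obtain ⟨q₀, r₀, h₀⟩ := ih β (D m) hβ
    -- Modulo the image, $\lambda_n\lambda^\beta m$ equals $-\sum_{t<n}\lambda_t\lambda^\beta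
    -- m-\lambda^\beta D(m)$. Every term on the right has exponent $k$ in $\lambda_n$, so the
    -- induction hypothesis applies to each.
    choose q r hqr using fun t : Fin n => ih (β + Finsupp.single t.castSucc 1) m
      (by simp [hβ, (Fin.castSucc_lt_last t).ne'])
    refine ⟨Finsupp.single β m - ∑ t, q t - q₀, -∑ t, r t - r₀, ?_⟩
    have h1 : totalLam F D (Finsupp.single β m) =
        ∑ t : Fin n, Finsupp.single (β + Finsupp.single t.castSucc 1) m +
          Finsupp.single (β + Finsupp.single (Fin.last n) 1) m + Finsupp.single β (D m) := by
      rw [totalLam_apply, Fin.sum_univ_castSucc]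
      simp only [mulVar_single, mapCoeff_single]
    rw [h₀, Finset.sum_congr rfl fun t _ => hqr t, Finset.sum_add_distrib] at h1
    simp only [map_sub, map_sum, map_neg] at h1 ⊢
    rw [h1]
    abel

theorem aeval_intertwine {T : M →ₗ[F] N} {A : Module.End F M} {B : Module.End F N}
    (h : ∀ p, T (A p) = B (T p)) (f : F[X]) (p : M) :
    T (Polynomial.aeval A f p) = Polynomial.aeval B f (T p) := by
  induction f using Polynomial.induction_on' with
  | add f g hf hg => simp only [map_add, LinearMap.add_apply, hf, hg]
  | monomial k r =>
    have hk : T ((A ^ k) p) = (B ^ k) (T p) := by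
      induction k generalizing p with
      | zero => simp
      | succ k ih => rw [pow_succ, pow_succ, Module.End.mul_apply, Module.End.mul_apply, ih, h]
    simp only [Polynomial.aeval_monomial, Module.End.mul_apply, Module.algebraMap_end_apply,
      map_smul, hk]

end LamPolyOperators

/-! ### Symbols of basic forms -/

section Symbols

variable {F : Type u} {I : Type v} [Field F]

/-- The pairing of `R` with the space spanned by the generators `δu_i^{(n)}`, with values in
`F[λ]`: the pair of `p(∂) u_i` and `δu_i^{(n)}` is sent to `p(-λ) λ^n`. -/
noncomputable def symb (a : FreeDiffModule F I) : (I × ℕ →₀ F) →ₗ[F] F[X] :=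
  Finsupp.linearCombination F fun x => (a x.1).comp (-Polynomial.X) * Polynomial.X ^ x.2

theorem symb_single (a : FreeDiffModule F I) (x : I × ℕ) (r : F) :
    symb a (Finsupp.single x r) = r • ((a x.1).comp (-Polynomial.X) * Polynomial.X ^ x.2) :=
  Finsupp.linearCombination_single _ _ _

theorem symb_gen [DecidableEq I] (i : I) (x : I × ℕ) (r : F) :
    symb (gen F i) (Finsupp.single x r) = if i = x.1 then r • Polynomial.X ^ x.2 else 0 := by
  rw [symb_single, gen, Finsupp.single_apply]
  split_ifs <;> simp

theorem symb_add (a b : FreeDiffModule F I) (m : I × ℕ →₀ F) :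
    symb (a + b) m = symb a m + symb b m := by
  induction m using Finsupp.induction_linear with
  | zero => simp
  | add p q hp hq => simp only [map_add, hp, hq]; abel
  | single x r => simp [symb_single, add_mul]

theorem symb_smul (r : F) (a : FreeDiffModule F I) (m : I × ℕ →₀ F) :
    symb (r • a) m = r • symb a m := by
  induction m using Finsupp.induction_linear with
  | zero => simp
  | add p q hp hq => simp only [map_add, hp, hq, smul_add]
  | single x s => simp [symb_single, smul_comm r s]

theorem symb_zero : symb (0 : FreeDiffModule F I) = 0 := by
  ext x
  simp [symb_single]

theorem symb_X_smul (a : FreeDiffModule F I) (m : I × ℕ →₀ F) :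
    symb ((Polynomial.X : F[X]) • a) m = -Polynomial.X * symb a m := by
  induction m using Finsupp.induction_linear with
  | zero => simp
  | add p q hp hq => simp only [map_add, hp, hq, mul_add]
  | single x s => simp [symb_single, mul_assoc]

/-- The symbol counterpart of $\partial\,\delta u_i^{(n)}=\delta u_i^{(n+1)}$: raising the order of
a generator costs one factor $\lambda$. -/
theorem symb_shift (a : FreeDiffModule F I) (m : I × ℕ →₀ F) :
    symb a (Finsupp.lmapDomain F F (fun x : I × ℕ => (x.1, x.2 + 1)) m) =
      Polynomial.X * symb a m := by
  induction m using Finsupp.induction_linear with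
  | zero => simp
  | add p q hp hq => simp only [map_add, hp, hq, mul_add]
  | single x s =>
    rw [Finsupp.lmapDomain_apply, Finsupp.mapDomain_single, symb_single, symb_single, pow_succ]
    simp only [mul_smul_comm]
    congr 1
    ring

variable (k : ℕ)

/-- The matrix with entries `⟨a_j, m_r⟩(λ_j)`. -/
noncomputable def symbMatrix {k : ℕ} (a : Fin k → FreeDiffModule F I) (m : Fin k → (I × ℕ →₀ F)) :
    Matrix (Fin k) (Fin k) (MvPolynomial (Fin k) F) :=
  Matrix.of fun r j => Polynomial.aeval (MvPolynomial.X j) (symb (a j) (m r))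

/-- The alternating map sending `m_0, …, m_{k-1}` to the determinant of `symbMatrix`. -/
noncomputable def symbDet (a : Fin k → FreeDiffModule F I) :
    (I × ℕ →₀ F) [⋀^Fin k]→ₗ[F] MvPolynomial (Fin k) F :=
  { (Matrix.detRowAlternating.toMultilinearMap.restrictScalars F).compLinearMap
      (fun _ => LinearMap.pi fun j =>
        (Polynomial.aeval (MvPolynomial.X j)).toLinearMap ∘ₗ symb (a j)) with
    map_eq_zero_of_eq' := fun m r s h hrs => by
      refine Matrix.det_zero_of_row_eq hrs ?_
      change (LinearMap.pi fun j => _) (m r) = (LinearMap.pi fun j => _) (m s)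
      rw [h] }

theorem symbDet_apply (a : Fin k → FreeDiffModule F I) (m : Fin k → (I × ℕ →₀ F)) :
    symbDet k a m = (symbMatrix a m).det := rfl

/-- The value of the constant coefficient forms of degree `k` at elements `a_0, …, a_{k-1}` of
`R`. -/
noncomputable def symbExt (a : Fin k → FreeDiffModule F I) :
    ExtAlg F I →ₗ[F] MvPolynomial (Fin k) F :=
  -- Only the component of degree $k$ is given a nonzero alternating map. The symbol is thus defined
  -- on the whole exterior algebra, which permits induction by left multiplication with generators.
  ExteriorAlgebra.liftAlternating
    (Pi.single (M := fun i => (I × ℕ →₀ F) [⋀^Fin i]→ₗ[F] MvPolynomial (Fin k) F) k (symbDet k a))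

theorem symbExt_ιMulti (a : Fin k → FreeDiffModule F I) (m : Fin k → (I × ℕ →₀ F)) :
    symbExt k a (ExteriorAlgebra.ιMulti F k m) = (symbMatrix a m).det := by
  rw [symbExt, ExteriorAlgebra.liftAlternating_apply_ιMulti, Pi.single_eq_same, symbDet_apply]

theorem symbExt_ιMulti_of_ne {i : ℕ} (h : i ≠ k) (a : Fin k → FreeDiffModule F I)
    (m : Fin i → (I × ℕ →₀ F)) :
    symbExt k a (ExteriorAlgebra.ιMulti F i m) = 0 := by
  rw [symbExt, ExteriorAlgebra.liftAlternating_apply_ιMulti, Pi.single_eq_of_ne h]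
  rfl

theorem symbExt_zero_one (a : Fin 0 → FreeDiffModule F I) : symbExt 0 a 1 = 1 := by
  have := symbExt_ιMulti 0 a ![]
  simpa [ExteriorAlgebra.ιMulti_apply] using this

theorem symbExt_succ_one (a : Fin (k + 1) → FreeDiffModule F I) : symbExt (k + 1) a 1 = 0 := by
  have := symbExt_ιMulti_of_ne (k + 1) (Nat.succ_ne_zero k).symm a ![]
  simpa [ExteriorAlgebra.ιMulti_apply] using this

theorem symbExt_zero_ι_mul (a : Fin 0 → FreeDiffModule F I) (m : I × ℕ →₀ F) (ω : ExtAlg F I) :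
    symbExt 0 a (ExteriorAlgebra.ι F m * ω) = 0 := by
  suffices h : symbExt 0 a ∘ₗ LinearMap.mulLeft F (ExteriorAlgebra.ι F m) = 0 from
    LinearMap.congr_fun h ω
  refine ExteriorAlgebra.lhom_ext fun i => AlternatingMap.ext fun v => ?_
  have h := symbExt_ιMulti_of_ne 0 (Nat.succ_ne_zero i) a (Matrix.vecCons m v)
  rw [ExteriorAlgebra.ιMulti_succ_apply] at h
  simpa using h

/-- Laplace expansion of the determinant along its first row, which is the row of $m$. Deleting
column $j$ removes both $a_j$ and $\lambda_j$, hence the renaming of the remaining variables by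
`j.succAbove`. All later inductions over forms rest on this recursion. -/
theorem symbExt_ι_mul (a : Fin (k + 1) → FreeDiffModule F I) (m : I × ℕ →₀ F) (ω : ExtAlg F I) :
    symbExt (k + 1) a (ExteriorAlgebra.ι F m * ω) =
      ∑ j : Fin (k + 1), (-1) ^ (j : ℕ) *
        Polynomial.aeval (MvPolynomial.X j) (symb (a j) m) *
          MvPolynomial.rename j.succAbove (symbExt k (a ∘ j.succAbove) ω) := by
  suffices h : symbExt (k + 1) a ∘ₗ LinearMap.mulLeft F (ExteriorAlgebra.ι F m) =
      ∑ j : Fin (k + 1), LinearMap.mulLeft F ((-1) ^ (j : ℕ) *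
        Polynomial.aeval (MvPolynomial.X j) (symb (a j) m)) ∘ₗ
          (MvPolynomial.rename j.succAbove).toLinearMap ∘ₗ symbExt k (a ∘ j.succAbove) by
    simpa [LinearMap.sum_apply, mul_assoc] using LinearMap.congr_fun h ω
  refine ExteriorAlgebra.lhom_ext fun i => AlternatingMap.ext fun v => ?_
  have h1 : ExteriorAlgebra.ι F m * ExteriorAlgebra.ιMulti F i v =
      ExteriorAlgebra.ιMulti F (i + 1) (Matrix.vecCons m v) := by
    rw [ExteriorAlgebra.ιMulti_succ_apply]
    simp
  simp only [LinearMap.compAlternatingMap_apply, LinearMap.comp_apply, LinearMap.sum_apply,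
    LinearMap.mulLeft_apply, AlgHom.toLinearMap_apply, h1]
  by_cases hi : i = k
  · subst hi
    rw [symbExt_ιMulti, Matrix.det_succ_row_zero]
    refine Finset.sum_congr rfl fun j _ => ?_
    rw [symbExt_ιMulti, AlgHom.map_det]
    congr 2
    refine Matrix.ext fun r t => ?_
    simp only [symbMatrix, Matrix.submatrix_apply, Matrix.of_apply, Matrix.cons_val_succ,
      AlgHom.mapMatrix_apply, Matrix.map_apply, Function.comp_apply,
      ← Polynomial.aeval_algHom_apply, MvPolynomial.rename_X]
  -- In a wrong degree both sides are $0$.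
  · rw [symbExt_ιMulti_of_ne _ (by omega)]
    simp [symbExt_ιMulti_of_ne _ hi]

theorem symbMatrix_update [DecidableEq (Fin k)] (a : Fin k → FreeDiffModule F I) (j : Fin k)
    (b : FreeDiffModule F I) (m : Fin k → (I × ℕ →₀ F)) :
    symbMatrix (Function.update a j b) m = (symbMatrix a m).updateCol j
      fun r => Polynomial.aeval (MvPolynomial.X j) (symb b (m r)) := by
  ext r t
  by_cases h : t = j
  · subst h; simp [symbMatrix]
  · simp [symbMatrix, h]

theorem symbExt_ext {N : Type*} [AddCommGroup N] [Module F N] {f g : ExtAlg F I →ₗ[F] N}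
    (h : ∀ i (m : Fin i → (I × ℕ →₀ F)),
      f (ExteriorAlgebra.ιMulti F i m) = g (ExteriorAlgebra.ιMulti F i m)) (ω : ExtAlg F I) :
    f ω = g ω :=
  LinearMap.congr_fun (ExteriorAlgebra.lhom_ext fun i => AlternatingMap.ext fun v => h i v) ω

theorem symbExt_update_add (a : Fin k → FreeDiffModule F I) (j : Fin k)
    (b b' : FreeDiffModule F I) (ω : ExtAlg F I) :
    symbExt k (Function.update a j (b + b')) ω =
      symbExt k (Function.update a j b) ω + symbExt k (Function.update a j b') ω := by
  rw [← LinearMap.add_apply]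
  refine symbExt_ext (fun i m => ?_) ω
  rw [LinearMap.add_apply]
  by_cases hi : i = k
  · subst hi
    simp only [symbExt_ιMulti, symbMatrix_update]
    rw [← Matrix.det_updateCol_add]
    congr 2
    ext r
    simp [symb_add]
  · simp [symbExt_ιMulti_of_ne _ hi]

/-- The argument $a_j$ enters only through column $j$, so a factor of its symbol comes out of the
determinant. The factor may be a scalar or $-\lambda_j$, which gives both linearity and
sesquilinearity. -/
theorem symbExt_update_mul (a : Fin k → FreeDiffModule F I) (j : Fin k)
    {b b' : FreeDiffModule F I} {p : MvPolynomial (Fin k) F}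
    (h : ∀ m, Polynomial.aeval (MvPolynomial.X j) (symb b' m) =
      p * Polynomial.aeval (MvPolynomial.X j) (symb b m)) (ω : ExtAlg F I) :
    symbExt k (Function.update a j b') ω = p * symbExt k (Function.update a j b) ω := by
  change _ = (LinearMap.mulLeft F p ∘ₗ symbExt k (Function.update a j b)) ω
  refine symbExt_ext (fun i m => ?_) ω
  rw [LinearMap.comp_apply, LinearMap.mulLeft_apply]
  by_cases hi : i = k
  · subst hi
    simp only [symbExt_ιMulti, symbMatrix_update]
    rw [← Matrix.det_updateCol_smul]
    congr 2
    ext1 r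
    exact h _
  · simp [symbExt_ιMulti_of_ne _ hi]

theorem symbExt_update_smul (a : Fin k → FreeDiffModule F I) (j : Fin k) (r : F)
    (b : FreeDiffModule F I) (ω : ExtAlg F I) :
    symbExt k (Function.update a j (r • b)) ω = r • symbExt k (Function.update a j b) ω := by
  rw [symbExt_update_mul k a j (p := MvPolynomial.C r), MvPolynomial.C_mul']
  intro m
  rw [symb_smul, map_smul, MvPolynomial.C_mul']

theorem symbExt_update_X_smul (a : Fin k → FreeDiffModule F I) (j : Fin k) (ω : ExtAlg F I) :
    symbExt k (Function.update a j ((Polynomial.X : F[X]) • a j)) ω =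
      -(MvPolynomial.X j * symbExt k a ω) := by
  rw [symbExt_update_mul k a j (p := -MvPolynomial.X j) (b := a j), Function.update_eq_self,
    neg_mul]
  intro m
  rw [symb_X_smul]
  simp

/-- Permuting the arguments permutes the columns but leaves variable $j$ attached to position $j$;
the renaming by $s$ makes the variables follow their arguments. Only the sign of the column
permutation remains. -/
theorem symbExt_perm (a : Fin k → FreeDiffModule F I) (s : Equiv.Perm (Fin k)) (ω : ExtAlg F I) :
    MvPolynomial.rename s (symbExt k (a ∘ s) ω) = (Equiv.Perm.sign s : ℤ) • symbExt k a ω := by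
  change ((MvPolynomial.rename s).toLinearMap ∘ₗ symbExt k (a ∘ s)) ω =
    ((Equiv.Perm.sign s : ℤ) • symbExt k a) ω
  refine symbExt_ext (fun i m => ?_) ω
  rw [LinearMap.comp_apply, LinearMap.smul_apply, AlgHom.toLinearMap_apply]
  by_cases hi : i = k
  · subst hi
    have h : (MvPolynomial.rename s).mapMatrix (symbMatrix (a ∘ s) m) =
        (symbMatrix a m).submatrix id s := by
      refine Matrix.ext fun r t => ?_
      simp only [symbMatrix, Matrix.submatrix_apply, Matrix.of_apply, AlgHom.mapMatrix_apply,
        Matrix.map_apply, Function.comp_apply, id, ← Polynomial.aeval_algHom_apply,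
        MvPolynomial.rename_X]
    rw [symbExt_ιMulti, symbExt_ιMulti, AlgHom.map_det, h, Matrix.det_permute', zsmul_eq_mul]
  · simp [symbExt_ιMulti_of_ne _ hi]

/-- Shifting a generator multiplies its entry in column $j$ by $\lambda_j$. In each term of the
Laplace expansion the first factor contributes $\lambda_j$ and, by induction, the complementary
minor contributes the sum of the other variables. -/
theorem symbExt_shiftDer (a : Fin k → FreeDiffModule F I) (ω : ExtAlg F I) :
    symbExt k a (shiftDer F I ω) = (∑ j, MvPolynomial.X j) * symbExt k a ω := by
  induction ω using CliffordAlgebra.left_induction generalizing k with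
  | algebraMap r =>
    change symbExt k a (shiftDer F I (algebraMap F (ExtAlg F I) r)) =
      _ * symbExt k a (algebraMap F (ExtAlg F I) r)
    rw [Algebra.algebraMap_eq_smul_one, map_smul, shiftDer_one, smul_zero, map_zero, map_smul]
    cases k with
    | zero => simp
    | succ k => simp [symbExt_succ_one]
  | add x y hx hy => simp only [map_add, hx, hy, mul_add]
  | ι_mul ω m ih =>
    change symbExt k a (shiftDer F I (ExteriorAlgebra.ι F m * ω)) =
      _ * symbExt k a (ExteriorAlgebra.ι F m * ω)
    rw [shiftDer_mul, map_add]
    cases k with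
    | zero => simp only [symbExt_zero_ι_mul]; simp
    | succ k =>
      simp only [symbExt_ι_mul, ← Finset.sum_add_distrib, Finset.mul_sum, ih, symb_shift]
      refine Finset.sum_congr rfl fun j _ => ?_
      rw [Fin.sum_univ_succAbove _ j]
      simp only [map_mul, map_sum, MvPolynomial.rename_X, Polynomial.aeval_X]
      ring

end Symbols

/-! ### Contractions of polynomials -/

section ContractFirst

variable (F : Type u) {A : Type v} {M : Type w} [Field F] [AddCommGroup A] [Module F A]
  [LieConformalAlgebra F A] [CommRing M] [Algebra F M] [LieConformalDerModule F A M] {n : ℕ}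

local notation "∂M" => LieConformalModule.deriv (F := F) (A := A) (M := M)

theorem contractFirst_single (m x : M) (α : Fin (n + 1) →₀ ℕ) :
    contractFirst (A := A) F m (Finsupp.single α x) =
      Finsupp.single α.tail (x * (∂M ^ α 0) m) := by
  rw [contractFirst, Finsupp.lsum_single]
  rfl

theorem contractFirst_mulVar_succ (m : M) (j : Fin n) (p : LamPoly (Fin (n + 1)) M) :
    contractFirst (A := A) F m (mulVar F j.succ p) =
      mulVar F j (contractFirst (A := A) F m p) := by
  induction p using Finsupp.induction_linear with
  | zero => simp
  | add p q hp hq => simp only [map_add, hp, hq]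
  | single α x =>
    rw [mulVar_single, contractFirst_single, contractFirst_single, mulVar_single]
    congr 1
    · ext t
      simp [Finsupp.tail_apply, Finsupp.single_apply]
    · simp

theorem contractFirst_mulVar_zero (m : M) (p : LamPoly (Fin (n + 1)) M) :
    contractFirst (A := A) F m (mulVar F 0 p) = contractFirst (A := A) F (∂M m) p := by
  induction p using Finsupp.induction_linear with
  | zero => simp
  | add p q hp hq => simp only [map_add, hp, hq]
  | single α x =>
    rw [mulVar_single, contractFirst_single, contractFirst_single]
    congr 1
    · ext t
      simp [Finsupp.tail_apply]
    · simp [pow_succ]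

/-- The Leibniz rule $\partial(x\,\partial^l m)=(\partial x)\,\partial^l m+x\,\partial^{l+1}m$,
whose last term is the effect of one more factor $\lambda_0$. -/
theorem contractFirst_mapCoeff (m : M) (p : LamPoly (Fin (n + 1)) M) :
    contractFirst (A := A) F m (mapCoeff F ∂M p) + contractFirst (A := A) F m (mulVar F 0 p) =
      mapCoeff F ∂M (contractFirst (A := A) F m p) := by
  induction p using Finsupp.induction_linear with
  | zero => simp
  | add p q hp hq => simp only [map_add, ← hp, ← hq]; abel
  | single α x =>
    rw [contractFirst_mulVar_zero, mapCoeff_single, contractFirst_single, contractFirst_single,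
      contractFirst_single, mapCoeff_single, LieConformalDerModule.deriv_mul, ← Finsupp.single_add,
      ← Module.End.mul_apply, ← Module.End.mul_apply, ← pow_succ, ← pow_succ']

/-- The summands $\lambda_0$ and $\partial$ together become $\partial$ on the products. Contraction
is therefore well defined modulo the images of these operators. -/
theorem contractFirst_totalLam (m : M) (p : LamPoly (Fin (n + 1)) M) :
    contractFirst (A := A) F m (totalLam F ∂M p) =
      totalLam F ∂M (contractFirst (A := A) F m p) := by
  rw [totalLam_apply, totalLam_apply, Fin.sum_univ_succ, ← contractFirst_mapCoeff]
  simp only [map_add, map_sum, contractFirst_mulVar_succ]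
  abel

theorem contractFirst_rename {n' : ℕ} (m : M) (e : Fin (n + 1) → Fin (n' + 1)) (e' : Fin n → Fin n')
    (he : Function.Injective e) (h0 : e 0 = 0) (h : ∀ t, e t.succ = (e' t).succ)
    (p : LamPoly (Fin (n + 1)) M) :
    contractFirst (A := A) F m (rename F e p) = rename F e' (contractFirst (A := A) F m p) := by
  have he' : Function.Injective e' := fun s t hst =>
    Fin.succ_injective _ (he (by rw [h, h, hst]))
  induction p using Finsupp.induction_linear with
  | zero => simp
  | add p q hp hq => simp only [map_add, hp, hq]
  | single α x =>
    rw [rename_single, contractFirst_single, contractFirst_single, rename_single]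
    congr 1
    · ext t
      rw [Finsupp.tail_apply]
      by_cases ht : t ∈ Set.range e'
      · obtain ⟨t, rfl⟩ := ht
        rw [Finsupp.mapDomain_apply he', ← h, Finsupp.mapDomain_apply he, Finsupp.tail_apply]
      · rw [Finsupp.mapDomain_of_notMem_range _ _ ht, Finsupp.mapDomain_of_notMem_range]
        rintro ⟨s, hs⟩
        refine Fin.cases (fun hs => ?_) (fun s hs => ?_) s hs
        · rw [h0] at hs
          exact (Fin.succ_ne_zero t) hs.symm
        · rw [h] at hs
          exact ht ⟨s, Fin.succ_injective _ hs⟩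
    · conv_lhs => rw [← h0]
      rw [Finsupp.mapDomain_apply he]

/-- Without $\lambda_0$ no derivative falls on $m$, and only the product with $m$ is left. -/
theorem contractFirst_rename_succ (m : M) (p : LamPoly (Fin n) M) :
    contractFirst (A := A) F m (rename F Fin.succ p) = mapCoeff F (LinearMap.mulRight F m) p := by
  induction p using Finsupp.induction_linear with
  | zero => simp
  | add p q hp hq => simp only [map_add, hp, hq]
  | single α x =>
    rw [rename_single, contractFirst_single, mapCoeff_single,
      Finsupp.mapDomain_of_notMem_range _ _ (show (0 : Fin (n + 1)) ∉ Set.range Fin.succ by simp)]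
    congr 1
    ext t
    rw [Finsupp.tail_apply, Finsupp.mapDomain_apply (Fin.succ_injective n)]

theorem contractFirst_mapCoeff_mulLeft (m g : M) (p : LamPoly (Fin (n + 1)) M) :
    contractFirst (A := A) F m (mapCoeff F (LinearMap.mulLeft F g) p) =
      mapCoeff F (LinearMap.mulLeft F g) (contractFirst (A := A) F m p) := by
  induction p using Finsupp.induction_linear with
  | zero => simp
  | add p q hp hq => simp only [map_add, hp, hq]
  | single α x =>
    simp only [mapCoeff_single, contractFirst_single, LinearMap.mulLeft_apply, mul_assoc]

theorem contractFirst_add (m m' : M) (p : LamPoly (Fin (n + 1)) M) :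
    contractFirst (A := A) F (m + m') p =
      contractFirst (A := A) F m p + contractFirst (A := A) F m' p := by
  induction p using Finsupp.induction_linear with
  | zero => simp
  | add p q hp hq => simp only [map_add, hp, hq]; abel
  | single α x => simp only [contractFirst_single, map_add, mul_add, Finsupp.single_add]

theorem contractFirst_smul (r : F) (m : M) (p : LamPoly (Fin (n + 1)) M) :
    contractFirst (A := A) F (r • m) p = r • contractFirst (A := A) F m p := by
  induction p using Finsupp.induction_linear with
  | zero => simp
  | add p q hp hq => simp only [map_add, hp, hq, smul_add]
  | single α x =>
    simp only [contractFirst_single, map_smul, mul_smul_comm, Finsupp.smul_single]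

theorem contractFirst_aeval (m : M) (f : F[X]) (p : LamPoly (Fin (n + 1)) M) :
    contractFirst (A := A) F m (Polynomial.aeval (mulVar F 0 : Module.End F _) f p) =
      contractFirst (A := A) F (Polynomial.aeval ∂M f m) p := by
  induction f using Polynomial.induction_on' with
  | add f g hf hg => simp only [map_add, LinearMap.add_apply, hf, hg, contractFirst_add]
  | monomial k r =>
    have hk : contractFirst (A := A) F m ((mulVar F 0 ^ k : Module.End F _) p) =
        contractFirst (A := A) F ((∂M ^ k) m) p := by
      induction k generalizing m with
      | zero => simp
      | succ k ih =>
        rw [pow_succ', Module.End.mul_apply, contractFirst_mulVar_zero, ih, pow_succ,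
          Module.End.mul_apply]
    simp only [Polynomial.aeval_monomial, Module.End.mul_apply, Module.algebraMap_end_apply,
      map_smul, hk, contractFirst_smul]

end ContractFirst

/-! ### Polynomials with coefficients in `V` -/

section PolyTensor

variable (F : Type u) [Field F] {σ τ : Type*} {M N : Type*}
  [AddCommGroup M] [Module F M] [AddCommGroup N] [Module F N]

/-- The canonical bilinear map from `M × F[λ_s | s ∈ σ]` to `F[λ_s | s ∈ σ] ⊗ M`. -/
noncomputable def polyTensor : M →ₗ[F] MvPolynomial σ F →ₗ[F] LamPoly σ M :=
  LinearMap.mk₂ F (fun f p => Finsupp.mapRange.linearMap (LinearMap.toSpanSingleton F M f)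
      (AddMonoidAlgebra.coeffLinearEquiv F p))
    (fun f g p => Finsupp.ext fun α => by simp)
    (fun r f p => Finsupp.ext fun α => by simp [smul_comm r])
    (fun f p q => by simp only [map_add])
    (fun r f p => by simp only [map_smul])

theorem polyTensor_monomial (f : M) (α : σ →₀ ℕ) (r : F) :
    polyTensor F f (MvPolynomial.monomial α r) = Finsupp.single α (r • f) := by
  change Finsupp.mapRange.linearMap (LinearMap.toSpanSingleton F M f) (Finsupp.single α r) = _
  rw [Finsupp.mapRange.linearMap_apply, Finsupp.mapRange_single, LinearMap.toSpanSingleton_apply]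

theorem polyTensor_X_mul (f : M) (s : σ) (p : MvPolynomial σ F) :
    polyTensor F f (MvPolynomial.X s * p) = mulVar F s (polyTensor F f p) := by
  induction p using MvPolynomial.induction_on' with
  | monomial α r =>
    rw [MvPolynomial.X, MvPolynomial.monomial_mul, one_mul, polyTensor_monomial,
      polyTensor_monomial, mulVar_single, add_comm]
  | add p q hp hq => simp only [mul_add, map_add, hp, hq]

theorem polyTensor_aeval_mul (f : M) (s : σ) (g : F[X]) (p : MvPolynomial σ F) :
    polyTensor F f (Polynomial.aeval (MvPolynomial.X s) g * p) =
      Polynomial.aeval (mulVar F s : Module.End F _) g (polyTensor F f p) := by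
  induction g using Polynomial.induction_on' with
  | add f g hf hg => simp only [map_add, LinearMap.add_apply, add_mul, hf, hg]
  | monomial k r =>
    have hk : polyTensor F f (MvPolynomial.X s ^ k * p) =
        (mulVar F s ^ k : Module.End F _) (polyTensor F f p) := by
      induction k with
      | zero => simp
      | succ k ih => rw [pow_succ', pow_succ', Module.End.mul_apply, mul_assoc, polyTensor_X_mul,
          ih]
    rw [Polynomial.aeval_monomial, Polynomial.aeval_monomial, mul_assoc,
      Module.End.mul_apply, Module.algebraMap_end_apply, ← hk, ← map_smul, Algebra.smul_def]

theorem polyTensor_rename (f : M) (e : σ → τ) (p : MvPolynomial σ F) :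
    polyTensor F f (MvPolynomial.rename e p) = rename F e (polyTensor F f p) := by
  induction p using MvPolynomial.induction_on' with
  | monomial α r =>
    rw [MvPolynomial.rename_monomial, polyTensor_monomial, polyTensor_monomial, rename_single]
  | add p q hp hq => simp only [map_add, hp, hq]

theorem mapCoeff_polyTensor (g : M →ₗ[F] N) (f : M) (p : MvPolynomial σ F) :
    mapCoeff F g (polyTensor F f p) = polyTensor F (g f) p := by
  induction p using MvPolynomial.induction_on' with
  | monomial α r =>
    rw [polyTensor_monomial, polyTensor_monomial, mapCoeff_single, map_smul]
  | add p q hp hq => simp only [map_add, hp, hq]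

end PolyTensor

/-! ### Symbols of differential forms -/

section SymbForm

variable {F : Type u} {I : Type v} {V : Type w} [Field F] [CommRing V] [Algebra F V]
  [DiffFunctionAlgebra F I V]

local notation "∂V" => DiffFunctionAlgebra.der (F := F) (I := I) (V := V)
local notation "∂u" => DiffFunctionAlgebra.pd (F := F) (I := I) (V := V)

theorem deRham_induction {Q : DeRham F I V → Prop} (ω : DeRham F I V) (zero : Q 0)
    (add : ∀ x y, Q x → Q y → Q (x + y)) (tmul : ∀ (f : V) (ω : ExtAlg F I), Q (f ⊗ₜ ω)) : Q ω :=
  TensorProduct.induction_on ω zero tmul add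

/-- The value `ω(a_0, …, a_{k-1}) ∈ F[λ_0, …, λ_{k-1}] ⊗ V` of a form at elements of `R`; the forms
whose degree is not `k` are sent to `0`. -/
noncomputable def symbForm (k : ℕ) (a : Fin k → FreeDiffModule F I) :
    DeRham F I V →ₗ[F] LamPoly (Fin k) V :=
  TensorProduct.lift ((polyTensor F).compl₂ (symbExt k a))

variable (k : ℕ)

theorem symbForm_tmul (a : Fin k → FreeDiffModule F I) (f : V) (ω : ExtAlg F I) :
    symbForm k a (f ⊗ₜ ω) = polyTensor F f (symbExt k a ω) := rfl

theorem symbForm_update_add (a : Fin k → FreeDiffModule F I) (j : Fin k)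
    (b b' : FreeDiffModule F I) (ω : DeRham F I V) :
    symbForm k (Function.update a j (b + b')) ω =
      symbForm k (Function.update a j b) ω + symbForm k (Function.update a j b') ω := by
  induction ω using deRham_induction with
  | zero => simp
  | add x y hx hy => simp only [map_add, hx, hy]; abel
  | tmul f ω => simp only [symbForm_tmul, symbExt_update_add, map_add]

theorem symbForm_update_smul (a : Fin k → FreeDiffModule F I) (j : Fin k) (r : F)
    (b : FreeDiffModule F I) (ω : DeRham F I V) :
    symbForm k (Function.update a j (r • b)) ω = r • symbForm k (Function.update a j b) ω := by
  induction ω using deRham_induction with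
  | zero => simp
  | add x y hx hy => simp only [map_add, hx, hy, smul_add]
  | tmul f ω => simp only [symbForm_tmul, symbExt_update_smul, map_smul]

theorem symbForm_update_X_smul (a : Fin k → FreeDiffModule F I) (j : Fin k) (ω : DeRham F I V) :
    symbForm k (Function.update a j ((Polynomial.X : F[X]) • a j)) ω =
      -mulVar F j (symbForm k a ω) := by
  induction ω using deRham_induction with
  | zero => simp
  | add x y hx hy => simp only [map_add, hx, hy, neg_add]
  | tmul f ω => simp only [symbForm_tmul, symbExt_update_X_smul, map_neg, polyTensor_X_mul]

theorem symbForm_perm (a : Fin k → FreeDiffModule F I) (s : Equiv.Perm (Fin k))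
    (ω : DeRham F I V) :
    rename F s (symbForm k (a ∘ s) ω) = (Equiv.Perm.sign s : ℤ) • symbForm k a ω := by
  induction ω using deRham_induction with
  | zero => simp
  | add x y hx hy => simp only [map_add, hx, hy, smul_add]
  | tmul f ω =>
    rw [symbForm_tmul, symbForm_tmul, ← polyTensor_rename, symbExt_perm, map_zsmul]

/-- The derivation of $\mathcal V$ acts on the coefficients, and the shift of the generators
contributes $\sum_s\lambda_s$ by `symbExt_shiftDer`. Thus $\partial\widetilde\Omega$ consists of
forms whose symbols lie in the image of $\partial+\sum_s\lambda_s$. -/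
theorem symbForm_totalDer (a : Fin k → FreeDiffModule F I) (ω : DeRham F I V) :
    symbForm k a (totalDer F I V ω) = totalLam F (∂V : V →ₗ[F] V) (symbForm k a ω) := by
  induction ω using deRham_induction with
  | zero => simp
  | add x y hx hy => simp only [map_add, hx, hy]
  | tmul f ω =>
    rw [totalDer_tmul, map_add, symbForm_tmul, symbForm_tmul, symbForm_tmul, symbExt_shiftDer,
      totalLam_apply, Finset.sum_mul, map_sum, mapCoeff_polyTensor, add_comm]
    simp only [polyTensor_X_mul]
    rfl

theorem mapCoeff_mulLeft_symbForm (a : Fin k → FreeDiffModule F I) (f : V) (ω : DeRham F I V) :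
    mapCoeff F (LinearMap.mulLeft F f) (symbForm k a ω) = symbForm k a (f • ω) := by
  induction ω using deRham_induction with
  | zero => simp
  | add x y hx hy => simp only [map_add, hx, hy, smul_add]
  | tmul g ω =>
    rw [TensorProduct.smul_tmul', symbForm_tmul, symbForm_tmul, mapCoeff_polyTensor]
    rfl

theorem symbForm_ι_mul (a : Fin (k + 1) → FreeDiffModule F I) (m : I × ℕ →₀ F)
    (ω : DeRham F I V) :
    symbForm (k + 1) a ((1 ⊗ₜ ExteriorAlgebra.ι F m) * ω) =
      ∑ j : Fin (k + 1), (-1 : ℤ) ^ (j : ℕ) •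
        Polynomial.aeval (mulVar F j : Module.End F (LamPoly (Fin (k + 1)) V)) (symb (a j) m)
          (rename F j.succAbove (symbForm k (a ∘ j.succAbove) ω)) := by
  induction ω using deRham_induction with
  | zero => simp
  | add x y hx hy => simp only [mul_add, map_add, hx, hy, smul_add, Finset.sum_add_distrib]
  | tmul f ω =>
    rw [Algebra.TensorProduct.tmul_mul_tmul, one_mul, symbForm_tmul, symbExt_ι_mul, map_sum]
    refine Finset.sum_congr rfl fun j _ => ?_
    rw [symbForm_tmul, ← polyTensor_rename, ← polyTensor_aeval_mul, ← map_zsmul, mul_assoc,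
      zsmul_eq_mul]
    simp

theorem symbForm_zero_ι_mul (a : Fin 0 → FreeDiffModule F I) (m : I × ℕ →₀ F)
    (ω : DeRham F I V) : symbForm 0 a ((1 ⊗ₜ ExteriorAlgebra.ι F m) * ω) = 0 := by
  induction ω using deRham_induction with
  | zero => simp
  | add x y hx hy => rw [mul_add, map_add, hx, hy, add_zero]
  | tmul f ω =>
    rw [Algebra.TensorProduct.tmul_mul_tmul, symbForm_tmul, symbExt_zero_ι_mul, map_zero]

theorem genAct_eq_sum [DecidableEq I] (i : I) (f : V) :
    genAct F V i f = (grad F I V f).sum fun x g => if i = x.1 then Finsupp.single x.2 g else 0 := by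
  ext n
  rw [genAct_apply, Finsupp.sum_apply, ← grad_apply F I f (i, n)]
  rw [Finsupp.sum, Finset.sum_eq_single (i, n)]
  · simp
  · rintro ⟨j, m⟩ _ h
    by_cases hj : i = j
    · subst hj
      have : m ≠ n := fun h' => h (by rw [h'])
      simp [this]
    · simp [hj]
  · intro h
    simp [Finsupp.notMem_support_iff.1 h]

/-- The $\lambda$-action is the pairing with the differential: $a_\lambda f=\langle a,\delta
f\rangle(\lambda)$. This holds for generators by definition, and both sides acquire the factor
$-\lambda$ when $a$ is replaced by $\partial a$. -/
theorem actVar_polyTensor {σ : Type*} (s : σ) (a : FreeDiffModule F I) (f : V)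
    (p : MvPolynomial σ F) :
    actVar F s a (polyTensor F f p) = (grad F I V f).sum fun x g =>
      Polynomial.aeval (mulVar F s : Module.End F (LamPoly σ V)) (symb a (Finsupp.single x 1))
        (polyTensor F g p) := by
  classical
  have key : ∀ α : σ →₀ ℕ, ∀ f : V,
      Finsupp.lmapDomain V F (fun j : ℕ => α + Finsupp.single s j) (freeAct F I V a f) =
      (grad F I V f).sum fun x g =>
        Polynomial.aeval (mulVar F s : Module.End F (LamPoly σ V)) (symb a (Finsupp.single x 1))
        (Finsupp.single α g) := by
    intro α f
    have hlam : ∀ q : ℕ →₀ V,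
        Finsupp.lmapDomain V F (fun j : ℕ => α + Finsupp.single s j) (lam F q) =
        mulVar F s (Finsupp.lmapDomain V F (fun j : ℕ => α + Finsupp.single s j) q) := by
      intro q
      induction q using Finsupp.induction_linear with
      | zero => simp
      | add p q hp hq => simp only [map_add, hp, hq]
      | single n x =>
        simp only [lam, Finsupp.lmapDomain_apply, Finsupp.mapDomain_single, mulVar_single,
          Finsupp.single_add, add_assoc]
    induction a using free_induction with
    | zero => simp [symb_zero]
    | add a b ha hb =>
      simp only [map_add, LinearMap.add_apply, symb_add, ha, hb, Finsupp.sum_add]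
    | smul r a ha =>
      simp only [map_smul, LinearMap.smul_apply, symb_smul, ha, Finsupp.smul_sum]
    | deriv a ha =>
      rw [freeAct_X_smul, map_neg, hlam, ha]
      simp only [symb_X_smul, map_mul, map_neg, Polynomial.aeval_X, Module.End.mul_apply,
        LinearMap.neg_apply, Finsupp.sum, map_sum, Finset.sum_neg_distrib]
    | base i =>
      rw [freeAct_gen, genAct_eq_sum, map_finsuppSum]
      refine Finsupp.sum_congr fun x _ => ?_
      rw [symb_gen]
      split_ifs
      · simp [Finsupp.mapDomain_single, mulVar_pow_single]
      · simp
  induction p using MvPolynomial.induction_on' with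
  | monomial α r =>
    simp only [polyTensor_monomial]
    rw [actVar, Finsupp.lsum_single, LinearMap.comp_apply]
    refine (key α (r • f)).trans ?_
    rw [map_smul, Finsupp.sum_smul_index' (by simp)]
  | add p q hp hq => simp only [map_add, hp, hq, Finsupp.sum_add]

/-- Since $\delta(f\omega)=\delta f\wedge\omega$, expand along the row of $\delta f$: pairing that
row with $a_j$ yields $a_j{}_{\lambda_j}f$. This is the differential of poly $\lambda$-brackets
before the last variable is eliminated. -/
theorem symbForm_delta (a : Fin (k + 1) → FreeDiffModule F I) (ω : DeRham F I V) :
    symbForm (k + 1) a (delta F I V ω) = ∑ j : Fin (k + 1), (-1 : ℤ) ^ (j : ℕ) •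
      actVar F j (a j) (rename F j.succAbove (symbForm k (a ∘ j.succAbove) ω)) := by
  induction ω using deRham_induction with
  | zero => simp
  | add x y hx hy => simp only [map_add, hx, hy, smul_add, Finset.sum_add_distrib]
  | tmul f ω =>
    rw [delta_tmul, map_finsuppSum]
    simp only [symbForm_tmul, ← polyTensor_rename, actVar_polyTensor]
    simp only [Finsupp.sum, Finset.smul_sum]
    rw [Finset.sum_comm]
    refine Finset.sum_congr rfl fun x _ => ?_
    rw [symbExt_ι_mul, map_sum]
    refine Finset.sum_congr rfl fun j _ => ?_
    rw [← polyTensor_aeval_mul, ← map_zsmul, mul_assoc, zsmul_eq_mul]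
    simp

/-- The hypothesis says that $P$ is the field of $a\otimes f$, i.e. its value on a generator is the
pairing with $a$ in which $\lambda$ acts as $\partial$ on $f$. Inserting $a$ as a new column $0$ and
replacing $\lambda_0$ in this way is then the same odd derivation, by expansion along the first row.
-/
theorem symbForm_iota {P : VectorField F I V} {a : FreeDiffModule F I} {f : V}
    (hP : ∀ x : I × ℕ, P x.1 x.2 =
      Polynomial.aeval ((∂V : V →ₗ[F] V) : Module.End F V) (symb a (Finsupp.single x 1)) f)
    (b : Fin k → FreeDiffModule F I) (ω : DeRham F I V) :
    symbForm k b (iota P ω) = contractFirst (A := FreeDiffModule F I) F f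
      (symbForm (k + 1) (Fin.cons (α := fun _ => FreeDiffModule F I) a b) ω) := by
  have hP' : ∀ m : I × ℕ →₀ F, Finsupp.linearCombination F (fun x : I × ℕ => P x.1 x.2) m =
      Polynomial.aeval ((∂V : V →ₗ[F] V) : Module.End F V) (symb a m) f := by
    intro m
    induction m using Finsupp.induction_linear with
    | zero => simp
    | add p q hp hq => simp only [map_add, hp, hq, LinearMap.add_apply]
    | single x r =>
      rw [Finsupp.linearCombination_single, hP, ← mul_one r, ← smul_eq_mul r,
        ← Finsupp.smul_single, map_smul, map_smul]
      simp
  -- Coefficients in $\mathcal V$ pass through both sides, so forms with constant coefficients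
  -- suffice.
  suffices h : ∀ ω : ExtAlg F I, symbForm k b (contractExt P ω) =
      contractFirst (A := FreeDiffModule F I) F f (symbForm (k + 1)
        (Fin.cons (α := fun _ => FreeDiffModule F I) a b) (1 ⊗ₜ ω)) by
    induction ω using deRham_induction with
    | zero => simp
    | add x y hx hy => simp only [map_add, hx, hy]
    | tmul g ω =>
      have : (g ⊗ₜ ω : DeRham F I V) = g • (1 ⊗ₜ ω) := by
        rw [TensorProduct.smul_tmul', smul_eq_mul, mul_one]
      rw [iota_tmul, this, ← mapCoeff_mulLeft_symbForm, ← mapCoeff_mulLeft_symbForm,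
        contractFirst_mapCoeff_mulLeft, h]
  intro ω
  induction ω using CliffordAlgebra.left_induction generalizing k with
  | algebraMap r =>
    change symbForm k b (contractExt P (algebraMap F (ExtAlg F I) r)) =
      contractFirst F f (symbForm _ _ (1 ⊗ₜ (algebraMap F (ExtAlg F I) r)))
    rw [Algebra.algebraMap_eq_smul_one, map_smul, contractExt_one, smul_zero, map_zero,
      symbForm_tmul, map_smul, symbExt_succ_one]
    simp
  | add x y hx hy => simp only [map_add, TensorProduct.tmul_add, hx, hy]
  | ι_mul ω m ih =>
    change symbForm k b (contractExt P (ExteriorAlgebra.ι F m * ω)) =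
      contractFirst F f (symbForm _ _ (1 ⊗ₜ (ExteriorAlgebra.ι F m * ω)))
    have h1 : (1 ⊗ₜ (ExteriorAlgebra.ι F m * ω) : DeRham F I V) =
        (1 ⊗ₜ ExteriorAlgebra.ι F m) * (1 ⊗ₜ ω) := by
      rw [Algebra.TensorProduct.tmul_mul_tmul, one_mul]
    have h2 : Polynomial.aeval ((∂V : V →ₗ[F] V) : Module.End F V) (symb a m) f ⊗ₜ ω =
        (Polynomial.aeval ((∂V : V →ₗ[F] V) : Module.End F V) (symb a m) f) •
          (1 ⊗ₜ ω : DeRham F I V) := by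
      rw [TensorProduct.smul_tmul', smul_eq_mul, mul_one]
    rw [contractExt_mul, hP', h1, symbForm_ι_mul, Fin.sum_univ_succ, map_add, map_sub, h2,
      ← mapCoeff_mulLeft_symbForm, sub_eq_add_neg]
    congr 1
    -- The column of $a$: its entry $\langle a,m\rangle(\lambda_0)$ becomes $P(m)=\langle
    -- a,m\rangle(\partial)f$, while the minor does not involve $\lambda_0$.
    · rw [Fin.val_zero, pow_zero, one_smul, contractFirst_aeval]
      have : (Fin.cons (α := fun _ => FreeDiffModule F I) a b) ∘ (0 : Fin (k + 1)).succAbove = b := by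
        funext t
        simp
      rw [this, Fin.cons_zero, show (0 : Fin (k + 1)).succAbove = Fin.succ by funext t; simp,
        contractFirst_rename_succ]
      congr 2
      ext g
      simp only [LinearMap.mulLeft_apply, LinearMap.mulRight_apply]
      exact mul_comm _ _
    -- The other columns reproduce $-m\wedge\iota_P\omega$: the minors still contain the column of
    -- $a$, so induction applies, and the minus sign is the shift of the column number by one.
    · cases k with
      | zero => rw [symbForm_zero_ι_mul]; simp
      | succ k =>
        rw [symbForm_ι_mul, map_sum, ← Finset.sum_neg_distrib]
        refine Finset.sum_congr rfl fun j _ => ?_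
        have h3 : (Fin.cons (α := fun _ => FreeDiffModule F I) a b) ∘ j.succ.succAbove =
            Fin.cons (α := fun _ => FreeDiffModule F I) a (b ∘ j.succAbove) := by
          funext t
          refine Fin.cases ?_ (fun t => ?_) t <;> simp
        rw [map_zsmul, Fin.cons_succ, aeval_intertwine F (B := mulVar F j)
            (contractFirst_mulVar_succ F f j),
          contractFirst_rename F f _ j.succAbove Fin.succAbove_right_injective (by simp) (by simp),
          h3, ih, Fin.val_succ, pow_succ, mul_neg_one, neg_smul]

end SymbForm

/-! ### Differential forms with given symbols -/

section OfSymb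

variable {F : Type u} {I : Type v} {V : Type w} [Field F] [CommRing V] [Algebra F V]
  [DiffFunctionAlgebra F I V] (k : ℕ)

/-- The product `δu_{i_0}^{(n_0)} ∧ ⋯ ∧ δu_{i_{k-1}}^{(n_{k-1})}`. -/
noncomputable def wedge (F : Type u) [Field F] {k : ℕ} (x : Fin k → I × ℕ) : ExtAlg F I :=
  ExteriorAlgebra.ιMulti F k fun j => Finsupp.single (x j) 1

theorem wedge_mem (x : Fin k → I × ℕ) : wedge F x ∈ ⋀[F]^k (I × ℕ →₀ F) := by
  rw [← ExteriorAlgebra.ιMulti_span_fixedDegree]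
  exact Submodule.subset_span ⟨_, rfl⟩

theorem wedge_perm (x : Fin k → I × ℕ) (s : Equiv.Perm (Fin k)) :
    wedge F (x ∘ s) = (Equiv.Perm.sign s : ℤ) • wedge F x :=
  AlternatingMap.map_perm _ (fun j => Finsupp.single (x j) 1) s

/-- At generators every matrix entry is a power of $\lambda_j$ or $0$, so each permutation in the
Leibniz formula contributes a signed monomial or nothing. -/
theorem symbExt_gen_wedge [DecidableEq I] (i : Fin k → I) (x : Fin k → I × ℕ) :
    symbExt k (fun j => gen F (i j)) (wedge F x) = ∑ s : Equiv.Perm (Fin k),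
      (Equiv.Perm.sign s : ℤ) • if i = fun j => (x (s j)).1 then
        MvPolynomial.monomial (Finsupp.equivFunOnFinite.symm fun j => (x (s j)).2) 1 else 0 := by
  rw [wedge, symbExt_ιMulti, Matrix.det_apply]
  refine Finset.sum_congr rfl fun s _ => ?_
  rw [Units.smul_def]
  congr 1
  simp only [symbMatrix, Matrix.of_apply, symb_gen, funext_iff]
  split_ifs with h
  · rw [MvPolynomial.monomial_eq, Finsupp.prod_fintype _ _ (by simp), map_one, one_mul]
    refine Finset.prod_congr rfl fun j _ => ?_
    rw [if_pos (h j)]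
    simp
  · push Not at h
    obtain ⟨j, hj⟩ := h
    refine Finset.prod_eq_zero (Finset.mem_univ j) ?_
    rw [if_neg hj, map_zero]

/-- The linear map `λ^α f ↦ f δu_{i_0}^{(α_0)} ∧ ⋯ ∧ δu_{i_{k-1}}^{(α_{k-1})}`. -/
noncomputable def formOfPoly {k : ℕ} (i : Fin k → I) : LamPoly (Fin k) V →ₗ[F] DeRham F I V :=
  Finsupp.lsum F fun α =>
    (TensorProduct.mk F V (ExtAlg F I)).flip (wedge F fun j => (i j, α j))

theorem formOfPoly_single (i : Fin k → I) (α : Fin k →₀ ℕ) (f : V) :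
    formOfPoly (F := F) i (Finsupp.single α f) = f ⊗ₜ wedge F fun j => (i j, α j) := by
  rw [formOfPoly, Finsupp.lsum_single]
  rfl

/-- Turning a polynomial into a form and taking the symbol again antisymmetrises it: permutation $s$
moves the polynomial from the index tuple $i'\circ s$ to $i'$. -/
theorem symbForm_formOfPoly [DecidableEq I] (i i' : Fin k → I) (p : LamPoly (Fin k) V) :
    symbForm k (fun j => gen F (i' j)) (formOfPoly i p) = ∑ s : Equiv.Perm (Fin k),
      (Equiv.Perm.sign s : ℤ) • if i = i' ∘ s then rename F s p else 0 := by
  induction p using Finsupp.induction_linear with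
  | zero => simp
  | add p q hp hq =>
    simp only [map_add, hp, hq, ← Finset.sum_add_distrib, ← smul_add]
    refine Finset.sum_congr rfl fun s _ => ?_
    split_ifs <;> simp
  | single α f =>
    rw [formOfPoly_single, symbForm_tmul, symbExt_gen_wedge, map_sum,
      -- The Leibniz formula pulls the exponents back along $s$, whereas renaming pushes them
      -- forward; inverting $s$ reconciles the two and keeps the sign.
      ← Equiv.sum_comp (Equiv.inv (Equiv.Perm (Fin k)))]
    refine Finset.sum_congr rfl fun s _ => ?_
    have h : (i' = fun j => i (s⁻¹ j)) ↔ i = i' ∘ s := by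
      constructor
      · rintro rfl
        funext j
        simp
      · rintro rfl
        funext j
        simp
    rw [map_zsmul, Equiv.inv_apply, Equiv.Perm.sign_inv, apply_ite (polyTensor F f), map_zero]
    simp only [h]
    congr 2
    rw [polyTensor_monomial, one_smul, rename_single]
    congr 1
    ext j
    obtain ⟨j, rfl⟩ := s.surjective j
    rw [Finsupp.mapDomain_apply s.injective]
    simp

variable [Fintype I]

/-- The form of degree `k` with given skew-symmetric values at the generators of `R`. -/
noncomputable def ofSymb : ((Fin k → I) → LamPoly (Fin k) V) →ₗ[F] DeRham F I V :=
  ((k.factorial : F)⁻¹) • ∑ i : Fin k → I, formOfPoly i ∘ₗ LinearMap.proj i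

theorem ofSymb_apply (g : (Fin k → I) → LamPoly (Fin k) V) :
    ofSymb k g = ((k.factorial : F)⁻¹) • ∑ i : Fin k → I, formOfPoly (F := F) i (g i) := by
  simp [ofSymb, LinearMap.sum_apply]

theorem ofSymb_mem (g : (Fin k → I) → LamPoly (Fin k) V) :
    ofSymb k g ∈ deRhamDeg F I V k := by
  rw [ofSymb_apply]
  refine Submodule.smul_mem _ _ (Submodule.sum_mem _ fun i _ => ?_)
  induction g i using Finsupp.induction_linear with
  | zero => simp
  | add p q hp hq => rw [map_add]; exact Submodule.add_mem _ hp hq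
  | single α f =>
    rw [formOfPoly_single]
    exact tmul_mem_deRhamDeg F I V f (wedge_mem k _)

variable [CharZero F]

/-- For each permutation $s$ only the tuple $i\circ s$ contributes, and by skew-symmetry the
contribution is $g_i$. The $k!$ equal terms cancel the factor $1/k!$; this is where characteristic
$0$ enters. -/
theorem symbForm_ofSymb (g : (Fin k → I) → LamPoly (Fin k) V)
    (hg : ∀ (s : Equiv.Perm (Fin k)) (i : Fin k → I),
      rename F s (g (i ∘ s)) = (Equiv.Perm.sign s : ℤ) • g i) (i : Fin k → I) :
    symbForm k (fun j => gen F (i j)) (ofSymb k g) = g i := by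
  classical
  rw [ofSymb_apply, map_smul, map_sum]
  simp only [symbForm_formOfPoly]
  rw [Finset.sum_comm]
  simp only [← Finset.smul_sum, Finset.sum_ite_eq', Finset.mem_univ, if_true,
    hg, smul_smul]
  have : ∀ s : Equiv.Perm (Fin k), ((Equiv.Perm.sign s : ℤ) * (Equiv.Perm.sign s : ℤ)) = 1 :=
    fun s => by rw [← Units.val_mul, Int.units_mul_self, Units.val_one]
  simp only [this, one_smul, Finset.sum_const, Finset.card_univ, Fintype.card_perm,
    Fintype.card_fin]
  rw [← Nat.cast_smul_eq_nsmul F, smul_smul,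
    inv_mul_cancel₀ (Nat.cast_ne_zero.2 (Nat.factorial_ne_zero k)), one_smul]

/-- Each permutation $s$ contributes for exactly one index tuple. There it gives the wedge reordered
by $s$, whose sign cancels the sign in the determinant, so again $k!$ equal terms appear. -/
theorem ofSymb_symbForm_wedge (f : V) (x : Fin k → I × ℕ) :
    ofSymb k (fun i => symbForm k (fun j => gen F (i j)) (f ⊗ₜ wedge F x)) = f ⊗ₜ wedge F x := by
  classical
  have h : ∀ i : Fin k → I, formOfPoly (F := F) i
      (symbForm k (fun j => gen F (i j)) (f ⊗ₜ wedge F x)) =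
      ∑ s : Equiv.Perm (Fin k), if i = fun j => (x (s j)).1 then f ⊗ₜ wedge F x else 0 := by
    intro i
    rw [symbForm_tmul, symbExt_gen_wedge, map_sum, map_sum]
    refine Finset.sum_congr rfl fun s _ => ?_
    split_ifs with hi
    · rw [map_zsmul, map_zsmul, polyTensor_monomial, one_smul, formOfPoly_single, hi]
      change _ • f ⊗ₜ wedge F (x ∘ s) = _
      rw [wedge_perm, ← TensorProduct.tmul_smul, smul_smul, ← Units.val_mul, Int.units_mul_self,
        Units.val_one, one_smul]
    · simp
  rw [ofSymb_apply]
  simp only [h]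
  rw [Finset.sum_comm]
  simp only [Finset.sum_ite_eq', Finset.mem_univ, if_true, Finset.sum_const,
    Finset.card_univ, Fintype.card_perm, Fintype.card_fin]
  rw [← Nat.cast_smul_eq_nsmul F, smul_smul,
    inv_mul_cancel₀ (Nat.cast_ne_zero.2 (Nat.factorial_ne_zero k)), one_smul]

theorem ofSymb_symbForm {ω : DeRham F I V} (hω : ω ∈ deRhamDeg F I V k) :
    ofSymb k (fun i => symbForm k (fun j => gen F (i j)) ω) = ω := by
  let T : DeRham F I V →ₗ[F] DeRham F I V :=
    ofSymb k ∘ₗ LinearMap.pi fun i => symbForm k (fun j => gen F (i j))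
  change T ω = LinearMap.id (R := F) ω
  suffices h : deRhamDeg F I V k ≤ LinearMap.eqLocus T LinearMap.id from h hω
  refine deRhamDeg_le fun f ω hω => ?_
  rw [← ExteriorAlgebra.ιMulti_span_fixedDegree] at hω
  -- Both sides are alternating multilinear in the factors of the wedge, so basis vectors suffice.
  have h : (T ∘ₗ TensorProduct.mk F V (ExtAlg F I) f).compAlternatingMap
      (ExteriorAlgebra.ιMulti F k) =
      (TensorProduct.mk F V (ExtAlg F I) f).compAlternatingMap (ExteriorAlgebra.ιMulti F k) := by
    refine Module.Basis.ext_alternating Finsupp.basisSingleOne fun x _ => ?_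
    simp only [Finsupp.coe_basisSingleOne]
    exact ofSymb_symbForm_wedge k f x
  refine Submodule.span_induction ?_ ?_ ?_ ?_ hω
  · rintro _ ⟨m, rfl⟩
    exact DFunLike.congr_fun h m
  · rw [TensorProduct.tmul_zero]; exact Submodule.zero_mem _
  · intro x y _ _ hx hy
    rw [TensorProduct.tmul_add]; exact Submodule.add_mem _ hx hy
  · intro r x _ hx
    rw [TensorProduct.tmul_smul]; exact Submodule.smul_mem _ r hx

/-- Injectivity of the symbol, because `ofSymb` recovers a form of degree $k$ from its values at
generators. -/
theorem eq_of_symbForm_gen_eq {ω ω' : DeRham F I V} (hω : ω ∈ deRhamDeg F I V k)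
    (hω' : ω' ∈ deRhamDeg F I V k)
    (h : ∀ i : Fin k → I, symbForm k (fun j => gen F (i j)) ω =
      symbForm k (fun j => gen F (i j)) ω') : ω = ω' := by
  rw [← ofSymb_symbForm k hω, ← ofSymb_symbForm k hω']
  simp only [h]

end OfSymb

/-! ### The operators `a_{λ_s}` -/

section ActVar

variable (F : Type u) {A : Type v} {M : Type w} [Field F] [AddCommGroup A] [Module F A]
  [LieConformalAlgebra F A] [AddCommGroup M] [Module F M] [LieConformalModule F A M] {σ : Type*}

local notation "∂M" => LieConformalModule.deriv (F := F) (A := A) (M := M)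

theorem actVar_single (s : σ) (a : A) (α : σ →₀ ℕ) (x : M) :
    actVar F s a (Finsupp.single α x) = Finsupp.mapDomain (fun j : ℕ => α + Finsupp.single s j)
      (LieConformalModule.act (F := F) a x) := by
  rw [actVar, Finsupp.lsum_single]
  rfl

theorem actVar_mulVar (s t : σ) (a : A) (p : LamPoly σ M) :
    actVar F s a (mulVar F t p) = mulVar F t (actVar F s a p) := by
  induction p using Finsupp.induction_linear with
  | zero => simp
  | add p q hp hq => simp only [map_add, hp, hq]
  | single α x =>
    rw [mulVar_single, actVar_single, actVar_single, mulVar, Finsupp.lmapDomain_apply,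
      ← Finsupp.mapDomain_comp]
    congr 1
    funext j
    simp only [Function.comp_apply, add_right_comm]

theorem actVar_mapCoeff (s : σ) (a : A) (p : LamPoly σ M) :
    actVar F s a (mapCoeff F ∂M p) =
      mapCoeff F ∂M (actVar F s a p) + mulVar F s (actVar F s a p) := by
  induction p using Finsupp.induction_linear with
  | zero => simp
  | add p q hp hq => simp only [map_add, hp, hq]; abel
  | single α x =>
    rw [mapCoeff_single, actVar_single, actVar_single, LieConformalModule.act_deriv_right,
      Finsupp.mapDomain_add]
    congr 1
    · generalize LieConformalModule.act (F := F) a x = q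
      induction q using Finsupp.induction_linear with
      | zero => simp
      | add p q hp hq => simp only [map_add, Finsupp.mapDomain_add, hp, hq]
      | single n x =>
        simp only [Finsupp.mapRange.linearMap_apply, Finsupp.mapRange_single,
          Finsupp.mapDomain_single, mapCoeff_single]
    · rw [lam, mulVar, Finsupp.lmapDomain_apply, Finsupp.lmapDomain_apply,
        ← Finsupp.mapDomain_comp, ← Finsupp.mapDomain_comp]
      congr 1
      funext j
      simp only [Function.comp_apply, Finsupp.single_add, add_assoc]

/-- The renaming leaves the slot $\lambda_i$ free, and
$a_{\lambda_i}\partial=(\partial+\lambda_i)a_{\lambda_i}$ supplies exactly the missing summand.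
Hence each term of the differential is well defined modulo these images. -/
theorem actVar_rename_totalLam {n : ℕ} (i : Fin (n + 1)) (a : A) (q : LamPoly (Fin n) M) :
    actVar F i a (rename F i.succAbove (totalLam F ∂M q)) =
      totalLam F ∂M (actVar F i a (rename F i.succAbove q)) := by
  rw [totalLam_apply, totalLam_apply, Fin.sum_univ_succAbove _ i]
  simp only [map_add, map_sum, rename_mulVar, rename_mapCoeff, actVar_mulVar, actVar_mapCoeff]
  abel

end ActVar

/-! ### Poly `λ`-brackets of differential forms -/

section SymbBracket

variable {F : Type u} {I : Type v} {V : Type w} [Field F] [CommRing V] [Algebra F V]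
  [DiffFunctionAlgebra F I V]

local notation "derV" => LieConformalModule.deriv (F := F) (A := FreeDiffModule F I) (M := V)

/-- The derivation of the $R$-module $\mathcal V$ is by definition that of the differential algebra;
from here on it appears in the module form. -/
theorem symbForm_totalDer_module (k : ℕ) (a : Fin k → FreeDiffModule F I) (ω : DeRham F I V) :
    symbForm k a (totalDer F I V ω) = totalLam F derV (symbForm k a ω) :=
  symbForm_totalDer k a ω

/-- The value of a form at elements of `R`, with `λ_n` replaced by `λ_n^†`. -/
noncomputable def symbMultilinear (n : ℕ) (ω : DeRham F I V) :
    MultilinearMap F (fun _ : Fin (n + 1) => FreeDiffModule F I) (LamPoly (Fin n) V) where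
  toFun a := dagger F n derV (symbForm (n + 1) a ω)
  map_update_add' {inst} a j b b' := by
    obtain rfl : inst = instDecidableEqFin _ := Subsingleton.elim _ _
    rw [symbForm_update_add, map_add]
  map_update_smul' {inst} a j r b := by
    obtain rfl : inst = instDecidableEqFin _ := Subsingleton.elim _ _
    rw [symbForm_update_smul, map_smul]

theorem symbMultilinear_apply (n : ℕ) (ω : DeRham F I V) (a : Fin (n + 1) → FreeDiffModule F I) :
    symbMultilinear n ω a = dagger F n derV (symbForm (n + 1) a ω) := rfl

/-- Sesquilinearity in the last argument holds because
$-\lambda_n^\dagger=\lambda_0+\dots+\lambda_{n-1}+\partial$. Skew-symmetry is inherited from that of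
the symbol, since replacing a symbol by its `dagger` changes it only within the image of
$\partial+\sum_s\lambda_s$. -/
theorem symbMultilinear_mem (n : ℕ) (ω : DeRham F I V) :
    symbMultilinear n ω ∈ polyBracketSubmodule F (FreeDiffModule F I) V n := by
  refine ⟨fun a i => ?_, fun a => ?_, fun a s => ?_⟩
  · rw [symbMultilinear_apply, symbMultilinear_apply, deriv_free, symbForm_update_X_smul, map_neg,
      dagger_mulVar_castSucc]
  · rw [symbMultilinear_apply, symbMultilinear_apply, deriv_free, symbForm_update_X_smul, map_neg,
      dagger_mulVar_last, lamDagger_apply, neg_neg, totalLam_apply]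
  · rw [symbMultilinear_apply, symbMultilinear_apply]
    obtain ⟨q, hq⟩ := exists_rename_dagger_add_totalLam F n derV (symbForm (n + 1) (a ∘ s) ω)
    -- Extend the renaming to all $n+1$ variables: the permuted symbol gives $\mathrm{sign}(s)$
    -- times the original one, and the error term stays in the image that `dagger` kills.
    have h : rename F (fun j : Fin n => s j.castSucc)
          (dagger F n derV (symbForm (n + 1) (a ∘ s) ω)) =
        (Equiv.Perm.sign s : ℤ) • symbForm (n + 1) a ω - totalLam F derV (rename F s q) := by
      rw [← symbForm_perm, ← rename_totalLam, ← map_sub]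
      conv_rhs => rw [hq, add_sub_cancel_right, rename_rename]
      rfl
    rw [h, map_sub, dagger_totalLam, sub_zero, map_zsmul, smul_smul, ← Units.val_mul,
      Int.units_mul_self, Units.val_one, one_smul]

variable (F I V) in
/-- `symbMultilinear` as a linear map to the space of poly `λ`-brackets. -/
noncomputable def symbMultilinearHom (n : ℕ) :
    DeRham F I V →ₗ[F] polyBracketSubmodule F (FreeDiffModule F I) V n where
  toFun ω := ⟨symbMultilinear n ω, symbMultilinear_mem n ω⟩
  map_add' ω ω' := by
    refine Subtype.ext (MultilinearMap.ext fun a => ?_)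
    change symbMultilinear n (ω + ω') a = symbMultilinear n ω a + symbMultilinear n ω' a
    rw [symbMultilinear_apply, map_add, map_add]
    rfl
  map_smul' r ω := by
    refine Subtype.ext (MultilinearMap.ext fun a => ?_)
    change symbMultilinear n (r • ω) a = r • symbMultilinear n ω a
    rw [symbMultilinear_apply, map_smul, map_smul]
    rfl

variable (F I V) in
/-- The class in `V/∂V` of the value of a form of degree `0`. -/
noncomputable def symbClass : DeRham F I V →ₗ[F] ULift.{max v u, w} (V ⧸ LinearMap.range derV) :=
  (ULift.moduleEquiv (R := F) (M := V ⧸ LinearMap.range derV)).symm.toLinearMap ∘ₗ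
    (LinearMap.range derV).mkQ ∘ₗ Finsupp.lapply 0 ∘ₗ symbForm 0 ![]

/-- The poly `λ`-bracket that corresponds to a form. -/
noncomputable def symbBracket : ∀ k, deRhamDeg F I V k →ₗ[F] PolyBracket F (FreeDiffModule F I) V k
  | 0 => symbClass F I V ∘ₗ (deRhamDeg F I V 0).subtype
  | n + 1 => symbMultilinearHom F I V n ∘ₗ (deRhamDeg F I V (n + 1)).subtype

theorem symbBracket_zero (ω : deRhamDeg F I V 0) : symbBracket 0 ω =
    integral F (FreeDiffModule F I) (symbForm 0 ![] (ω : DeRham F I V) 0) := rfl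

theorem symbBracket_val {n : ℕ} (ω : deRhamDeg F I V (n + 1))
    (a : Fin (n + 1) → FreeDiffModule F I) : (symbBracket (n + 1) ω).val a =
      dagger F n derV (symbForm (n + 1) a (ω : DeRham F I V)) := rfl

/-- Sesquilinearity in every slot, the last included, makes a bracket determined by its values at
the generators of $R$ over $\mathbb F[\partial]$. -/
theorem polyBracket_ext {n : ℕ} {c c' : PolyBracket F (FreeDiffModule F I) V (n + 1)}
    (h : ∀ i : Fin (n + 1) → I, c.val (fun j => gen F (i j)) = c'.val (fun j => gen F (i j))) :
    c = c' := by
  classical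
  let b : polyBracketSubmodule F (FreeDiffModule F I) V n :=
    (show polyBracketSubmodule F (FreeDiffModule F I) V n from c) -
    (show polyBracketSubmodule F (FreeDiffModule F I) V n from c')
  suffices hb : b = 0 from sub_eq_zero.1 hb
  rcases hbc : b with ⟨b, hb, hb', hb''⟩
  have hgen : ∀ i : Fin (n + 1) → I, b (fun j => gen F (i j)) = 0 := fun i =>
    (congrArg (fun b : polyBracketSubmodule F (FreeDiffModule F I) V n =>
      b.1 (fun j => gen F (i j))) hbc).symm.trans (sub_eq_zero.2 (h i))
  have hderiv : ∀ (a : Fin (n + 1) → FreeDiffModule F I) (j : Fin (n + 1)),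
      b a = 0 → b (Function.update a j ((Polynomial.X : F[X]) • a j)) = 0 := by
    intro a j ha
    refine Fin.lastCases ?_ (fun j => ?_) j
    · exact (hb' a).trans (by simp [ha])
    · exact (hb a j).trans (by simp [ha])
  -- Induction on a set $s$ of slots outside of which the arguments are generators. One slot at a
  -- time is built up from generators; in the base case it leaves $s$.
  have key : ∀ (s : Finset (Fin (n + 1))) (a : Fin (n + 1) → FreeDiffModule F I),
      (∀ j ∉ s, ∃ i, a j = gen F i) → b a = 0 := by
    intro s
    induction s using Finset.induction_on with
    | empty =>
      intro a ha
      choose i hi using fun j => ha j (Finset.notMem_empty j)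
      rw [show a = fun j => gen F (i j) from funext hi, hgen]
    | insert j s _ ih =>
      intro a ha
      rw [← Function.update_eq_self j a]
      generalize a j = r
      induction r using free_induction with
      | zero => exact b.map_update_zero a j
      | add r r' hr hr' => rw [b.map_update_add, hr, hr', add_zero]
      | smul t r hr => rw [b.map_update_smul, hr, smul_zero]
      | deriv r hr => simpa using hderiv _ j hr
      | base i =>
        refine ih _ fun t ht => ?_
        by_cases htj : t = j
        · subst htj
          exact ⟨i, Function.update_self _ _ _⟩
        · obtain ⟨i', hi'⟩ := ha t (by simp [htj, ht])
          exact ⟨i', by rw [Function.update_of_ne htj, hi']⟩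
  exact Subtype.ext (MultilinearMap.ext fun a => key Finset.univ a (by simp))

theorem symbForm_zero_one (a : Fin 0 → FreeDiffModule F I) (f : V) :
    symbForm 0 a (f ⊗ₜ[F] (1 : ExtAlg F I)) = Finsupp.single 0 f := by
  rw [symbForm_tmul, symbExt_zero_one, ← MvPolynomial.C_1, MvPolynomial.C_apply,
    polyTensor_monomial, one_smul]

theorem tmul_one_mem (f : V) : f ⊗ₜ[F] (1 : ExtAlg F I) ∈ deRhamDeg F I V 0 :=
  tmul_mem_deRhamDeg F I V f (by
    rw [ExteriorAlgebra.exteriorPower, pow_zero]; exact Submodule.one_le.1 le_rfl)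

theorem symbBracket_zero_tmul_one (f : V) :
    symbBracket (F := F) (I := I) 0 ⟨f ⊗ₜ 1, tmul_one_mem f⟩ =
      integral F (FreeDiffModule F I) f := by
  rw [symbBracket_zero, symbForm_zero_one, Finsupp.single_eq_same]

theorem totalLam_zero_vars (p : LamPoly (Fin 0) V) : totalLam F derV p 0 = derV (p 0) := by
  rw [totalLam_apply]
  simp [mapCoeff_apply]

/-- In positive degree `dagger` kills $\partial+\sum_s\lambda_s$. In degree $0$ there are no
variables, and the class in $\mathcal V/\partial\mathcal V$ kills $\partial$. -/
theorem symbBracket_totalDer (k : ℕ) (ω : deRhamDeg F I V k) :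
    symbBracket k (totalDerDeg F I V k ω) = 0 := by
  cases k with
  | zero =>
    refine congrArg ULift.up ((Submodule.Quotient.mk_eq_zero _).2 ?_)
    refine ⟨symbForm 0 ![] (ω : DeRham F I V) 0, ?_⟩
    rw [← totalLam_zero_vars, ← symbForm_totalDer_module]
    rfl
  | succ n =>
    refine polyBracket_ext fun i => ?_
    refine (symbBracket_val _ _).trans ?_
    change dagger F n derV (symbForm _ _ (totalDer F I V ω)) = 0
    rw [symbForm_totalDer_module, dagger_totalLam]

end SymbBracket

/-! ### Bijectivity of the map from the variational complex to poly $\lambda$-brackets -/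

section Bijective

variable {F : Type u} {I : Type v} {V : Type w} [Field F] [CommRing V] [Algebra F V]
  [DiffFunctionAlgebra F I V] [Fintype I] [CharZero F]

local notation "derV" => LieConformalModule.deriv (F := F) (A := FreeDiffModule F I) (M := V)

/-- A bracket, seen as a polynomial in $n+1$ variables without $\lambda_n$, is skew-symmetric only
after the substitution. Averaging over all permutations makes it skew-symmetric on the nose, hence a
symbol, and the substitution does not notice the averaging. -/
theorem symbBracket_surjective (k : ℕ) :
    Function.Surjective (symbBracket k : deRhamDeg F I V k →ₗ[F] _) := by
  cases k with
  | zero =>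
    rintro ⟨c⟩
    obtain ⟨f, rfl⟩ := Submodule.mkQ_surjective _ c
    exact ⟨_, symbBracket_zero_tmul_one f⟩
  | succ n =>
    intro c
    have hc : ∀ (a : Fin (n + 1) → FreeDiffModule F I) (s : Equiv.Perm (Fin (n + 1))),
        c.val a = (Equiv.Perm.sign s : ℤ) •
          dagger F n derV (rename F (fun j : Fin n => s j.castSucc) (c.val (a ∘ s))) :=
      (show polyBracketSubmodule F (FreeDiffModule F I) V n from c).2.2.2
    let g : (Fin (n + 1) → I) → LamPoly (Fin (n + 1)) V := fun i =>
      (((n + 1).factorial : F)⁻¹) • ∑ s : Equiv.Perm (Fin (n + 1)), (Equiv.Perm.sign s : ℤ) •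
        rename F (fun j : Fin n => s j.castSucc) (c.val fun j => gen F (i (s j)))
    have hg : ∀ (s : Equiv.Perm (Fin (n + 1))) (i : Fin (n + 1) → I),
        rename F s (g (i ∘ s)) = (Equiv.Perm.sign s : ℤ) • g i := by
      intro s i
      simp only [g, map_smul, map_sum, map_zsmul, rename_rename]
      rw [smul_comm, Finset.smul_sum (r := (Equiv.Perm.sign s : ℤ))]
      congr 1
      -- Renaming by $s$ after $t$ is the term of $st$, up to $\mathrm{sign}(s)$.
      refine Fintype.sum_equiv (Equiv.mulLeft s) _ _ fun t => ?_
      rw [smul_smul, Equiv.coe_mulLeft, Equiv.Perm.sign_mul, Units.val_mul, ← mul_assoc,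
        ← Units.val_mul, Int.units_mul_self, Units.val_one, one_mul]
      rfl
    refine ⟨⟨ofSymb (n + 1) g, ofSymb_mem _ _⟩, polyBracket_ext fun i => ?_⟩
    rw [symbBracket_val, symbForm_ofSymb _ _ hg]
    simp only [g, map_smul, map_sum, map_zsmul]
    -- By skew-symmetry of $c$, every summand of the average has the value of $c$ as its `dagger`.
    have : ∀ s : Equiv.Perm (Fin (n + 1)), (Equiv.Perm.sign s : ℤ) •
        dagger F n derV (rename F (fun j : Fin n => s j.castSucc)
          (c.val fun j => gen F (i (s j)))) = c.val fun j => gen F (i j) :=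
      fun s => (hc (fun j => gen F (i j)) s).symm
    simp only [this, Finset.sum_const, Finset.card_univ, Fintype.card_perm, Fintype.card_fin]
    rw [← Nat.cast_smul_eq_nsmul F, smul_smul,
      inv_mul_cancel₀ (Nat.cast_ne_zero.2 (Nat.factorial_ne_zero _)), one_smul]

/-- If the substitution annihilates the symbols of $\omega$ at generators, they have the form
$(\partial+\sum_s\lambda_s)g_i$. The family $g$ is again the symbol of a form, and $\omega$ is the
total derivative of that form. -/
theorem ker_symbBracket (k : ℕ) :
    LinearMap.ker (symbBracket k) = LinearMap.range (totalDerDeg F I V k) := by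
  refine le_antisymm (fun ω hω => ?_) ?_
  swap
  · rintro _ ⟨ω, rfl⟩
    exact symbBracket_totalDer k ω
  rw [LinearMap.mem_ker] at hω
  cases k with
  | zero =>
    have h : Submodule.Quotient.mk (symbForm 0 ![] (ω : DeRham F I V) 0) = 0 :=
      congrArg ULift.down hω
    obtain ⟨f, hf⟩ := (Submodule.Quotient.mk_eq_zero _).1 h
    refine ⟨⟨f ⊗ₜ 1, tmul_one_mem f⟩, Subtype.ext ?_⟩
    -- In degree $0$ a form is its coefficient, and $f$ is a primitive of that coefficient.
    refine eq_of_symbForm_gen_eq 0 (totalDer_mem (tmul_one_mem f)) ω.2 fun i => ?_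
    change symbForm 0 _ (totalDer F I V (f ⊗ₜ 1)) = _
    rw [symbForm_totalDer_module, symbForm_zero_one]
    refine Finsupp.ext fun α => ?_
    rw [Subsingleton.elim α 0, totalLam_zero_vars, Finsupp.single_eq_same, hf]
    congr 3
    exact Subsingleton.elim _ _
  | succ n =>
    have h : ∀ i : Fin (n + 1) → I, ∃ q,
        symbForm (n + 1) (fun j => gen F (i j)) (ω : DeRham F I V) = totalLam F derV q := by
      intro i
      obtain ⟨q, hq⟩ := exists_rename_dagger_add_totalLam F n derV
        (symbForm (n + 1) (fun j => gen F (i j)) (ω : DeRham F I V))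
      have h0 : dagger F n derV
          (symbForm (n + 1) (fun j => gen F (i j)) (ω : DeRham F I V)) = 0 :=
        congrArg (fun c : PolyBracket F (FreeDiffModule F I) V (n + 1) =>
          c.val fun j => gen F (i j)) hω
      rw [h0, map_zero, zero_add] at hq
      exact ⟨q, hq⟩
    choose g hg using h
    have hskew : ∀ (s : Equiv.Perm (Fin (n + 1))) (i : Fin (n + 1) → I),
        rename F s (g (i ∘ s)) = (Equiv.Perm.sign s : ℤ) • g i := by
      intro s i
      -- The skew-symmetry of $g$ can be tested after applying $\partial+\sum_s\lambda_s$, where it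
      -- is that of the symbol of $\omega$.
      refine totalLam_injective F derV ?_
      rw [← rename_totalLam, map_zsmul, ← hg, ← hg]
      exact symbForm_perm (n + 1) (fun j => gen F (i j)) s (ω : DeRham F I V)
    refine ⟨⟨ofSymb (n + 1) g, ofSymb_mem _ _⟩, Subtype.ext ?_⟩
    refine eq_of_symbForm_gen_eq _ (totalDer_mem (ofSymb_mem _ _)) ω.2 fun i => ?_
    change symbForm (n + 1) _ (totalDer F I V (ofSymb (n + 1) g)) = _
    rw [symbForm_totalDer_module, symbForm_ofSymb _ _ hskew, hg]

variable (F I V) in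
/-- The isomorphism between the space of poly `λ`-brackets and the variational complex. -/
noncomputable def bracketEquivForm (k : ℕ) :
    PolyBracket F (FreeDiffModule F I) V k ≃ₗ[F] VarForm F I V k :=
  ((Submodule.quotEquivOfEq _ _ (ker_symbBracket k).symm).trans
    ((symbBracket (F := F) (I := I) (V := V) k).quotKerEquivOfSurjective
      (symbBracket_surjective k))).symm

theorem bracketEquivForm_symm_mk (k : ℕ) (ω : deRhamDeg F I V k) :
    (bracketEquivForm F I V k).symm (Submodule.Quotient.mk ω) = symbBracket k ω := rfl

theorem bracketEquivForm_symbBracket (k : ℕ) (ω : deRhamDeg F I V k) :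
    bracketEquivForm F I V k (symbBracket k ω) = Submodule.Quotient.mk ω := by
  rw [← bracketEquivForm_symm_mk, LinearEquiv.apply_symm_apply]

end Bijective

/-! ### Differentials and contractions of poly `λ`-brackets of forms -/

section Compatibility

variable {F : Type u} {I : Type v} {V : Type w} [Field F] [CommRing V] [Algebra F V]
  [DiffFunctionAlgebra F I V]

local notation "derV" => LieConformalModule.deriv (F := F) (A := FreeDiffModule F I) (M := V)

/-- The symbol of $\delta f$ at $a$ is $a_{\lambda_0}f$; with a single variable, $\lambda_0^\dagger$
is $-\partial$. -/
theorem symbBracket_deltaDeg_zero (f : V) (a : Fin 1 → FreeDiffModule F I) :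
    (symbBracket 1 (deltaDeg F I V 0 ⟨f ⊗ₜ 1, tmul_one_mem f⟩)).val a =
      Finsupp.single 0 ((LieConformalModule.act (F := F) (a 0) f).sum fun j x =>
        ((-derV : Module.End F V) ^ j) x) := by
  rw [symbBracket_val]
  change dagger F 0 derV (symbForm (0 + 1) a (delta F I V (f ⊗ₜ 1))) = _
  rw [symbForm_delta, Fin.sum_univ_one, symbForm_zero_one, rename_single, Finsupp.mapDomain_zero,
    actVar_single, Fin.val_zero, pow_zero, one_smul]
  generalize LieConformalModule.act (F := F) (a 0) f = q
  induction q using Finsupp.induction_linear with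
  | zero => simp
  | add p q hp hq =>
    rw [Finsupp.mapDomain_add, map_add, hp, hq, ← Finsupp.single_add,
      Finsupp.sum_add_index' (by simp) (by simp)]
  | single n x =>
    rw [Finsupp.mapDomain_single, dagger_single, Finsupp.sum_single_index (by simp),
      show (0 + Finsupp.single 0 n : Fin 1 →₀ ℕ) (Fin.last 0) = n by simp]
    have h : ∀ y : V, lamDagger F 0 derV (Finsupp.single 0 y) =
        Finsupp.single 0 ((-derV : Module.End F V) y) := by
      intro y
      rw [lamDagger_apply, totalLam_apply, mapCoeff_single]
      simp
    rw [show Finsupp.equivFunOnFinite.symm _ = (0 : Fin 0 →₀ ℕ) from Subsingleton.elim _ _]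
    induction n generalizing x with
    | zero => simp
    | succ n ih => rw [pow_succ, Module.End.mul_apply, h, ih, pow_succ, Module.End.mul_apply]

theorem polyDiff_free {n : ℕ} (c : PolyBracket F (FreeDiffModule F I) V (n + 1))
    (a : Fin (n + 2) → FreeDiffModule F I) : polyDiff F c a =
      ∑ i : Fin (n + 2), (-1 : ℤ) ^ (i : ℕ) • dagger F (n + 1) derV
        (actVar F i (a i) (rename F (fun t : Fin n => i.succAbove t.castSucc)
          (c.val (a ∘ i.succAbove)))) := by
  rw [polyDiff]
  simp only [bracket_free, Finsupp.sum_zero_index, smul_zero, ite_self, Finset.sum_const_zero,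
    add_zero, map_sum, map_zsmul]

/-- The two sides differ in that `polyDiff` starts from the substituted symbol. The discrepancy lies
in the image of $\partial+\sum_s\lambda_s$, is carried by $a_{\lambda_i}$ into the corresponding
image in one more variable, and dies under the outer substitution. -/
theorem symbBracket_deltaDeg_succ {n : ℕ} (ω : deRhamDeg F I V (n + 1))
    (a : Fin (n + 2) → FreeDiffModule F I) :
    (symbBracket (n + 2) (deltaDeg F I V (n + 1) ω)).val a =
      polyDiff F (symbBracket (n + 1) ω) a := by
  rw [symbBracket_val, polyDiff_free]
  change dagger F (n + 1) derV (symbForm (n + 1 + 1) a (delta F I V ω)) = _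
  rw [symbForm_delta, map_sum]
  refine Finset.sum_congr rfl fun i _ => ?_
  rw [map_zsmul, symbBracket_val]
  obtain ⟨q, hq⟩ := exists_rename_dagger_add_totalLam F n derV
    (symbForm (n + 1) (a ∘ i.succAbove) (ω : DeRham F I V))
  conv_lhs => rw [hq, map_add, map_add, map_add, actVar_rename_totalLam, dagger_totalLam, add_zero,
    rename_rename]
  rfl

/-- The symbol and its `dagger` differ by $(\partial+\lambda_0)q$. Contracting this with $f$ leaves
no variables and gives $\partial$ of the contraction of $q$, which vanishes under $\int$. -/
theorem symbBracket_iotaDeg_zero {P : VectorField F I V} {a : FreeDiffModule F I} {f : V}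
    (hP : ∀ x : I × ℕ, P x.1 x.2 = Polynomial.aeval derV (symb a (Finsupp.single x 1)) f)
    (ω : deRhamDeg F I V 1) : symbBracket 0 (iotaDeg P 0 ω) =
      integral F (FreeDiffModule F I) (f * (symbBracket 1 ω).val (fun _ => a) 0) := by
  rw [symbBracket_zero, symbBracket_val]
  change integral F _ (symbForm 0 ![] (iota P ω) 0) = _
  rw [symbForm_iota 0 hP, show Fin.cons (α := fun _ => FreeDiffModule F I) a ![] = fun _ => a by
    funext t; exact Fin.cases rfl (fun t => t.elim0) t]
  obtain ⟨q, hq⟩ := exists_rename_dagger_add_totalLam F 0 derV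
    (symbForm 1 (fun _ => a) (ω : DeRham F I V))
  refine congrArg ULift.up ((Submodule.Quotient.eq _).2 ⟨contractFirst (A := FreeDiffModule F I) F f q 0, ?_⟩)
  rw [← totalLam_zero_vars, ← contractFirst_totalLam]
  generalize hp : dagger F 0 derV (symbForm 1 (fun _ => a) (ω : DeRham F I V)) = p at hq ⊢
  have h : contractFirst (A := FreeDiffModule F I) F f (rename F Fin.castSucc p) =
      mapCoeff F (LinearMap.mulRight F f) p := by
    rw [← contractFirst_rename_succ (A := FreeDiffModule F I) F,
      show (Fin.castSucc : Fin 0 → Fin 1) = Fin.succ from funext fun t => t.elim0]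
  rw [hq, map_add, h, Finsupp.add_apply, mapCoeff_apply, LinearMap.mulRight_apply, mul_comm f]
  abel

/-- The error term of the inner substitution stays in the image after contraction and is killed by
the outer one. With at least two arguments the contracted variable $\lambda_0$ is not the eliminated
one, so the two operations do not interfere. -/
theorem symbBracket_iotaDeg_succ {n : ℕ} {P : VectorField F I V} {a : FreeDiffModule F I} {f : V}
    (hP : ∀ x : I × ℕ, P x.1 x.2 = Polynomial.aeval derV (symb a (Finsupp.single x 1)) f)
    (ω : deRhamDeg F I V (n + 2)) (b : Fin (n + 1) → FreeDiffModule F I) :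
    (symbBracket (n + 1) (iotaDeg P (n + 1) ω)).val b = contractFirst (A := FreeDiffModule F I) F f
      ((symbBracket (n + 2) ω).val (Fin.cons (α := fun _ => FreeDiffModule F I) a b)) := by
  rw [symbBracket_val, symbBracket_val]
  change dagger F n derV (symbForm (n + 1) b (iota P ω)) = _
  rw [symbForm_iota (n + 1) hP]
  obtain ⟨q, hq⟩ := exists_rename_dagger_add_totalLam F (n + 1) derV
    (symbForm (n + 2) (Fin.cons (α := fun _ => FreeDiffModule F I) a b) (ω : DeRham F I V))
  conv_lhs => rw [hq, map_add, contractFirst_totalLam, map_add, dagger_totalLam, add_zero,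
    contractFirst_rename F f _ Fin.castSucc (Fin.castSucc_injective _) rfl (fun _ => rfl),
    dagger_rename_castSucc]

end Compatibility

/-! ### Cartan calculus on the basic de Rham complex -/

section Cartan

variable {F : Type u} {I : Type v} {V : Type w} [Field F] [CommRing V] [Algebra F V]
  [DiffFunctionAlgebra F I V]

local notation "∂V" => DiffFunctionAlgebra.der (F := F) (I := I) (V := V)
local notation "∂u" => DiffFunctionAlgebra.pd (F := F) (I := I) (V := V)

/-- The form `1 ⊗ m` of degree `1`. -/
noncomputable def constForm (V : Type w) [CommRing V] [Algebra F V] (m : I × ℕ →₀ F) :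
    DeRham F I V := 1 ⊗ₜ ExteriorAlgebra.ι F m

/-- The value of a vector field on a constant coefficient form of degree `1`. -/
noncomputable def VectorField.eval (P : VectorField F I V) : (I × ℕ →₀ F) →ₗ[F] V :=
  Finsupp.linearCombination F fun x => P x.1 x.2

/-- A property of forms that holds for the constant `1` and is inherited by sums and by the products
`f • ω` and `m ∧ ω` holds for all forms. -/
theorem deRham_induction_mul {Q : DeRham F I V → Prop} (ω : DeRham F I V) (zero : Q 0)
    (add : ∀ x y, Q x → Q y → Q (x + y)) (one : Q (1 ⊗ₜ 1))
    (smul : ∀ (f : V) ω, Q ω → Q (f • ω)) (mul : ∀ m ω, Q ω → Q (constForm V m * ω)) : Q ω := by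
  have h : ∀ ω : ExtAlg F I, Q (1 ⊗ₜ ω) := by
    intro ω
    induction ω using CliffordAlgebra.left_induction with
    | algebraMap r =>
      have h1 : (1 ⊗ₜ algebraMap F (ExtAlg F I) r : DeRham F I V) =
          (r • (1 : V)) • (1 ⊗ₜ[F] (1 : ExtAlg F I)) := by
        rw [Algebra.algebraMap_eq_smul_one, TensorProduct.tmul_smul, TensorProduct.smul_tmul',
          TensorProduct.smul_tmul', smul_eq_mul, mul_one]
      exact h1 ▸ smul _ _ one
    | add x y hx hy => rw [TensorProduct.tmul_add]; exact add _ _ hx hy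
    | ι_mul ω m ih =>
      have h1 : (1 ⊗ₜ (ExteriorAlgebra.ι F m * ω) : DeRham F I V) = constForm V m * (1 ⊗ₜ ω) := by
        rw [constForm, Algebra.TensorProduct.tmul_mul_tmul, one_mul]
      exact h1 ▸ mul m _ ih
  induction ω using TensorProduct.induction_on with
  | zero => exact zero
  | add x y hx hy => exact add _ _ hx hy
  | tmul f ω =>
    have h1 : (f ⊗ₜ ω : DeRham F I V) = f • (1 ⊗ₜ ω) := by
      rw [TensorProduct.smul_tmul', smul_eq_mul, mul_one]
    exact h1 ▸ smul f _ (h ω)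

theorem iota_smul (P : VectorField F I V) (f : V) (ω : DeRham F I V) :
    iota P (f • ω) = f • iota P ω := by
  induction ω using TensorProduct.induction_on with
  | zero => simp
  | add x y hx hy => simp only [smul_add, map_add, hx, hy]
  | tmul g ω => rw [TensorProduct.smul_tmul', iota_tmul, iota_tmul, smul_assoc]

theorem iota_one (P : VectorField F I V) : iota P (1 ⊗ₜ 1) = 0 := by
  rw [iota_tmul, contractExt_one, smul_zero]

theorem iota_constForm_mul (P : VectorField F I V) (m : I × ℕ →₀ F) (ω : DeRham F I V) :
    iota P (constForm V m * ω) = P.eval m • ω - constForm V m * iota P ω := by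
  induction ω using TensorProduct.induction_on with
  | zero => simp
  | add x y hx hy => simp only [mul_add, map_add, smul_add, hx, hy]; abel
  | tmul g ω =>
    rw [constForm, Algebra.TensorProduct.tmul_mul_tmul, one_mul, iota_tmul, iota_tmul,
      contractExt_mul, smul_sub, mul_smul_comm, TensorProduct.smul_tmul',
      TensorProduct.smul_tmul', smul_eq_mul, smul_eq_mul, mul_comm g]
    rfl

theorem iota_add (P Q : VectorField F I V) (ω : DeRham F I V) :
    iota (P + Q) ω = iota P ω + iota Q ω := by
  have h : ∀ m, (P + Q).eval m = P.eval m + Q.eval m := by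
    intro m
    simp only [VectorField.eval, Finsupp.linearCombination_apply, ← Finsupp.sum_add, ← smul_add]
    rfl
  induction ω using deRham_induction_mul with
  | zero => simp
  | add x y hx hy => simp only [map_add, hx, hy]; abel
  | one => simp only [iota_one, add_zero]
  | smul f ω ih => simp only [iota_smul, ih, smul_add]
  | mul m ω ih => simp only [iota_constForm_mul, ih, h, mul_add, add_smul]; abel

theorem iota_smul_left (r : F) (P : VectorField F I V) (ω : DeRham F I V) :
    iota (r • P) ω = r • iota P ω := by
  have h : ∀ m, (r • P).eval m = r • P.eval m := by
    intro m
    simp only [VectorField.eval, Finsupp.linearCombination_apply, Finsupp.smul_sum]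
    refine Finsupp.sum_congr fun x _ => ?_
    rw [smul_comm]
    rfl
  induction ω using deRham_induction_mul with
  | zero => simp
  | add x y hx hy => simp only [map_add, hx, hy, smul_add]
  | one => simp only [iota_one, smul_zero]
  | smul f ω ih => rw [iota_smul, iota_smul, ih, smul_comm]
  | mul m ω ih =>
    rw [iota_constForm_mul, iota_constForm_mul, ih, h, mul_smul_comm, smul_sub, smul_assoc]

/-- The anticommutator of two odd derivations is an even derivation. It vanishes on functions and on
generators, because a contraction sends generators to functions and functions to $0$. -/
theorem iota_iota (P Q : VectorField F I V) (ω : DeRham F I V) :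
    iota P (iota Q ω) + iota Q (iota P ω) = 0 := by
  induction ω using deRham_induction_mul with
  | zero => simp
  | add x y hx hy =>
    simp only [map_add]
    rw [add_add_add_comm, hx, hy, add_zero]
  | one => simp only [iota_one, map_zero, add_zero]
  | smul f ω ih => simp only [iota_smul, ← smul_add, ih, smul_zero]
  | mul m ω ih =>
    simp only [iota_constForm_mul, map_sub, iota_smul]
    have : constForm V m * iota P (iota Q ω) + constForm V m * iota Q (iota P ω) = 0 := by
      rw [← mul_add, ih, mul_zero]
    rw [← this]
    abel

theorem deltaFun_eq_sum (f : V) :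
    deltaFun F I V f = (grad F I V f).sum fun x g => g • constForm V (Finsupp.single x 1) := by
  refine Finsupp.sum_congr fun x _ => ?_
  rw [constForm, TensorProduct.smul_tmul', smul_eq_mul, mul_one]
  rfl

theorem delta_tmul_eq_mul (f : V) (ω : ExtAlg F I) :
    delta F I V (f ⊗ₜ ω) = deltaFun F I V f * (1 ⊗ₜ ω) := rfl

theorem deltaFun_mul (f g : V) :
    deltaFun F I V (f * g) = f • deltaFun F I V g + g • deltaFun F I V f := by
  simp only [deltaFun_eq_sum, grad_mul, Finsupp.smul_sum]
  rw [Finsupp.sum_add_index' (by simp) (by simp [add_smul]), Finsupp.mapRange.linearMap_apply,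
    Finsupp.mapRange.linearMap_apply, Finsupp.sum_mapRange_index (by simp),
    Finsupp.sum_mapRange_index (by simp)]
  simp only [LinearMap.mulLeft_apply, smul_smul]

theorem deltaFun_one : deltaFun F I V 1 = 0 := by
  have h : grad F I V 1 = 0 := Finsupp.ext fun x => Derivation.map_one_eq_zero _
  rw [deltaFun_eq_sum, h, Finsupp.sum_zero_index]

theorem delta_smul (f : V) (ω : DeRham F I V) :
    delta F I V (f • ω) = deltaFun F I V f * ω + f • delta F I V ω := by
  induction ω using TensorProduct.induction_on with
  | zero => simp
  | add x y hx hy => simp only [smul_add, map_add, mul_add, hx, hy]; abel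
  | tmul g ω =>
    have h1 : (g ⊗ₜ ω : DeRham F I V) = g • (1 ⊗ₜ ω) := by
      rw [TensorProduct.smul_tmul', smul_eq_mul, mul_one]
    rw [TensorProduct.smul_tmul', smul_eq_mul, delta_tmul_eq_mul, delta_tmul_eq_mul,
      deltaFun_mul, add_mul, smul_mul_assoc, smul_mul_assoc, h1, mul_smul_comm, add_comm]

theorem delta_one : delta F I V (1 ⊗ₜ 1) = 0 := by
  rw [delta_tmul_eq_mul, deltaFun_one, zero_mul]

theorem constForm_mul_constForm (m m' : I × ℕ →₀ F) :
    constForm V m * constForm V m' = -(constForm V m' * constForm V m) := by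
  rw [constForm, constForm, Algebra.TensorProduct.tmul_mul_tmul,
    Algebra.TensorProduct.tmul_mul_tmul, ← TensorProduct.tmul_neg,
    eq_neg_of_add_eq_zero_left (ExteriorAlgebra.ι_add_mul_swap m m')]

theorem deltaFun_mul_constForm (f : V) (m : I × ℕ →₀ F) :
    deltaFun F I V f * constForm V m = -(constForm V m * deltaFun F I V f) := by
  rw [deltaFun_eq_sum, Finsupp.sum_mul, Finsupp.mul_sum, Finsupp.sum, Finsupp.sum,
    ← Finset.sum_neg_distrib]
  refine Finset.sum_congr rfl fun x _ => ?_
  rw [smul_mul_assoc, mul_smul_comm, constForm_mul_constForm, smul_neg]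

theorem delta_constForm_mul (m : I × ℕ →₀ F) (ω : DeRham F I V) :
    delta F I V (constForm V m * ω) = -(constForm V m * delta F I V ω) := by
  induction ω using TensorProduct.induction_on with
  | zero => simp
  | add x y hx hy => simp only [mul_add, map_add, hx, hy, neg_add]
  | tmul g ω =>
    have h : (1 ⊗ₜ (ExteriorAlgebra.ι F m * ω) : DeRham F I V) = constForm V m * (1 ⊗ₜ ω) := by
      rw [constForm, Algebra.TensorProduct.tmul_mul_tmul, one_mul]
    rw [constForm, Algebra.TensorProduct.tmul_mul_tmul, one_mul, delta_tmul_eq_mul,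
      delta_tmul_eq_mul, h, ← mul_assoc, deltaFun_mul_constForm, neg_mul, mul_assoc]
    rfl

/-- Leibniz for the odd derivation $\delta$, together with $\delta(\delta f)=0$: the second partial
derivatives are symmetric and the generators anticommute. -/
theorem delta_deltaFun_mul (f : V) (ω : DeRham F I V) :
    delta F I V (deltaFun F I V f * ω) = -(deltaFun F I V f * delta F I V ω) := by
  have h : ∀ f : V, delta F I V (deltaFun F I V f * ω) =
      (grad F I V f).sum (fun x g => deltaFun F I V g * constForm V (Finsupp.single x 1) * ω) -
        deltaFun F I V f * delta F I V ω := by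
    intro f
    rw [deltaFun_eq_sum, Finsupp.sum_mul, Finsupp.sum_mul, map_finsuppSum, Finsupp.sum,
      Finsupp.sum, Finsupp.sum, ← Finset.sum_sub_distrib]
    refine Finset.sum_congr rfl fun x _ => ?_
    rw [smul_mul_assoc, delta_smul, delta_constForm_mul, smul_neg, mul_assoc, smul_mul_assoc,
      sub_eq_add_neg]
  suffices h0 : (grad F I V f).sum (fun x g =>
      deltaFun F I V g * constForm V (Finsupp.single x 1) * ω) = 0 by
    rw [h, h0, zero_sub]
  set S := (grad F I V f).support with hS
  -- Since partial derivatives commute, $\partial_y\partial_x f\ne0$ forces $\partial_y f\ne0$. All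
  -- second derivatives are thus indexed by the one finite square $S\times S$.
  have hsub : ∀ x : I × ℕ, (grad F I V (∂u x.1 x.2 f)).support ⊆ S := by
    intro x y hy
    rw [hS, Finsupp.mem_support_iff, grad_apply] at *
    intro h0
    exact hy (by rw [DiffFunctionAlgebra.pd_comm, h0, map_zero])
  have h1 : ∀ x : I × ℕ, deltaFun F I V (∂u x.1 x.2 f) =
      ∑ y ∈ S, ∂u y.1 y.2 (∂u x.1 x.2 f) • constForm V (Finsupp.single y 1) := fun x => by
    rw [deltaFun_eq_sum, Finsupp.sum_of_support_subset _ (hsub x) _ (by simp)]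
    rfl
  rw [← Finsupp.sum_mul, Finsupp.sum, ← hS]
  suffices h2 : ∑ x ∈ S, deltaFun F I V (∂u x.1 x.2 f) * constForm V (Finsupp.single x 1) = 0 by
    change (∑ x ∈ S, deltaFun F I V (∂u x.1 x.2 f) * constForm V (Finsupp.single x 1)) * ω = 0
    rw [h2, zero_mul]
  simp only [h1, Finset.sum_mul, smul_mul_assoc]
  rw [← Finset.sum_product']
  -- The terms at $(x,y)$ and $(y,x)$ cancel; the diagonal terms vanish because generators square to
  -- $0$.
  refine Finset.sum_involution (fun x _ => (x.2, x.1)) (fun x _ => ?_) (fun x _ hx h => hx ?_)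
    (fun x hx => ?_) (fun x _ => rfl)
  · rw [DiffFunctionAlgebra.pd_comm, ← smul_add, constForm_mul_constForm, neg_add_cancel, smul_zero]
  · have h1 : x.2 = x.1 := congrArg Prod.fst h
    rw [h1, constForm, Algebra.TensorProduct.tmul_mul_tmul, ExteriorAlgebra.ι_sq_zero,
      TensorProduct.tmul_zero, smul_zero]
  · rw [Finset.mem_product] at hx ⊢
    exact hx.symm

theorem delta_delta (ω : DeRham F I V) : delta F I V (delta F I V ω) = 0 := by
  induction ω using TensorProduct.induction_on with
  | zero => simp
  | add x y hx hy => rw [map_add, map_add, hx, hy, add_zero]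
  | tmul f ω =>
    rw [delta_tmul_eq_mul, delta_deltaFun_mul, delta_tmul_eq_mul, deltaFun_one, zero_mul, mul_zero,
      neg_zero]

theorem iota_deltaFun_mul (P : VectorField F I V) (f : V) (ω : DeRham F I V) :
    iota P (deltaFun F I V f * ω) = P.toDer f • ω - deltaFun F I V f * iota P ω := by
  rw [deltaFun_eq_sum, Finsupp.sum_mul, Finsupp.sum_mul, map_finsuppSum, VectorField.toDer_apply]
  simp only [Finsupp.sum]
  rw [Finset.sum_smul, ← Finset.sum_sub_distrib]
  refine Finset.sum_congr rfl fun x _ => ?_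
  rw [smul_mul_assoc, iota_smul, iota_constForm_mul, VectorField.eval,
    Finsupp.linearCombination_single, one_smul, smul_sub, smul_smul, mul_comm, smul_mul_assoc]

/-- The Lie derivative on the basic de Rham complex. -/
noncomputable def lieForm (P : VectorField F I V) : DeRham F I V →ₗ[F] DeRham F I V :=
  delta F I V ∘ₗ iota P + iota P ∘ₗ delta F I V

theorem lieForm_apply (P : VectorField F I V) (ω : DeRham F I V) :
    lieForm P ω = delta F I V (iota P ω) + iota P (delta F I V ω) := rfl

theorem lieForm_smul (P : VectorField F I V) (f : V) (ω : DeRham F I V) :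
    lieForm P (f • ω) = P.toDer f • ω + f • lieForm P ω := by
  simp only [lieForm_apply, iota_smul, delta_smul, map_add, iota_deltaFun_mul, smul_add]
  abel

theorem lieForm_constForm_mul (P : VectorField F I V) (m : I × ℕ →₀ F) (ω : DeRham F I V) :
    lieForm P (constForm V m * ω) =
      deltaFun F I V (P.eval m) * ω + constForm V m * lieForm P ω := by
  simp only [lieForm_apply, iota_constForm_mul, delta_smul, delta_constForm_mul, map_sub, map_neg,
    mul_add]
  abel

theorem lieForm_one (P : VectorField F I V) : lieForm P (1 ⊗ₜ 1) = 0 := by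
  rw [lieForm_apply, iota_one, delta_one, map_zero, map_zero, add_zero]

theorem eval_lie (P Q : VectorField F I V) (m : I × ℕ →₀ F) :
    VectorField.eval ⁅P, Q⁆ m = P.toDer (Q.eval m) - Q.toDer (P.eval m) := by
  induction m using Finsupp.induction_linear with
  | zero => simp
  | add p q hp hq => simp only [map_add, hp, hq]; abel
  | single x r =>
    simp only [VectorField.eval, Finsupp.linearCombination_single, Derivation.map_smul,
      VectorField.lie_apply, smul_sub]

/-- Both sides are odd derivations that vanish on functions, so they need only agree on generators.
There the identity is $P(Q_{i,n})-Q(P_{i,n})$, the definition of the bracket. -/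
theorem lieForm_iota (P Q : VectorField F I V) (ω : DeRham F I V) :
    lieForm P (iota Q ω) - iota Q (lieForm P ω) = iota ⁅P, Q⁆ ω := by
  induction ω using deRham_induction_mul with
  | zero => simp
  | add x y hx hy => simp only [map_add, ← hx, ← hy]; abel
  | one => simp only [iota_one, lieForm_one, map_zero, sub_zero]
  | smul f ω ih =>
    simp only [iota_smul, lieForm_smul, ← ih, map_add, smul_sub]
    abel
  | mul m ω ih =>
    simp only [iota_constForm_mul, lieForm_constForm_mul, map_sub, map_add, lieForm_smul,
      iota_deltaFun_mul, eval_lie, ← ih, mul_sub, sub_smul]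
    abel

theorem delta_lieForm (P : VectorField F I V) (ω : DeRham F I V) :
    delta F I V (lieForm P ω) = lieForm P (delta F I V ω) := by
  simp only [lieForm_apply, map_add, delta_delta, map_zero, add_zero, zero_add]

/-- Formal from $L_Q=[\delta,\iota_Q]$: the operator $L_P$ commutes with $\delta$ and its commutator
with $\iota_Q$ is $\iota_{[P,Q]}$. -/
theorem lieForm_lieForm (P Q : VectorField F I V) (ω : DeRham F I V) :
    lieForm P (lieForm Q ω) - lieForm Q (lieForm P ω) = lieForm ⁅P, Q⁆ ω := by
  rw [lieForm_apply Q, lieForm_apply Q, lieForm_apply ⁅P, Q⁆, ← lieForm_iota, ← lieForm_iota,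
    map_add, map_sub, delta_lieForm, delta_lieForm]
  abel

theorem grad_der (f : V) : grad F I V (∂V f) =
    Finsupp.mapRange.linearMap (∂V : V →ₗ[F] V) (grad F I V f) +
      Finsupp.mapDomain (fun x : I × ℕ => (x.1, x.2 + 1)) (grad F I V f) := by
  ext ⟨i, n⟩
  have hinj : Function.Injective (fun x : I × ℕ => (x.1, x.2 + 1)) := by
    rintro ⟨i, n⟩ ⟨j, m⟩ h
    simpa using h
  cases n with
  | zero =>
    rw [Finsupp.add_apply, Finsupp.mapDomain_of_notMem_range, add_zero]
    · exact DiffFunctionAlgebra.pd_der_zero i f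
    · rintro ⟨x, hx⟩
      simp at hx
  | succ n =>
    rw [Finsupp.add_apply]
    have := Finsupp.mapDomain_apply hinj (grad F I V f) (i, n)
    exact (DiffFunctionAlgebra.pd_der_succ i n f).trans (congrArg _ this.symm)

/-- The axiom $[\partial/\partial u_i^{(n)},\partial]=\partial/\partial u_i^{(n-1)}$ is exactly what
is needed: in `grad_der` it produces the shifted gradient, which matches the shift of the
generators. -/
theorem totalDer_delta (ω : DeRham F I V) :
    totalDer F I V (delta F I V ω) = delta F I V (totalDer F I V ω) := by
  induction ω using TensorProduct.induction_on with
  | zero => simp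
  | add x y hx hy => simp only [map_add, hx, hy]
  | tmul f ω =>
    rw [totalDer_tmul, map_add, delta_tmul, delta_tmul, delta_tmul, grad_der,
      Finsupp.sum_add_index' (by simp) (by simp [TensorProduct.add_tmul]),
      Finsupp.mapRange.linearMap_apply, Finsupp.sum_mapRange_index (by simp),
      Finsupp.sum_mapDomain_index (by simp) (by simp [TensorProduct.add_tmul]), map_finsuppSum,
      ← Finsupp.sum_add, ← Finsupp.sum_add]
    refine Finsupp.sum_congr fun x _ => ?_
    rw [totalDer_tmul, shiftDer_mul, Finsupp.lmapDomain_apply, Finsupp.mapDomain_single,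
      TensorProduct.tmul_add, add_assoc]
    rfl

/-- Degree $0$ consists of functions. This removes the term $\delta\iota_X$ from Cartan's formula in
the lowest degree. -/
theorem iota_of_mem_zero (P : VectorField F I V) {ω : DeRham F I V}
    (h : ω ∈ deRhamDeg F I V 0) : iota P ω = 0 := by
  refine LinearMap.mem_ker.1 (deRhamDeg_le (S := LinearMap.ker (iota P)) ?_ h)
  intro f ω hω
  rw [ExteriorAlgebra.exteriorPower, pow_zero] at hω
  obtain ⟨r, rfl⟩ := Submodule.mem_one.1 hω
  rw [LinearMap.mem_ker, Algebra.algebraMap_eq_smul_one, TensorProduct.tmul_smul, map_smul,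
    iota_tmul, contractExt_one, smul_zero, smul_zero]

theorem lieForm_mem (P : VectorField F I V) {k : ℕ} {ω : DeRham F I V}
    (h : ω ∈ deRhamDeg F I V k) : lieForm P ω ∈ deRhamDeg F I V k := by
  rw [lieForm_apply]
  refine Submodule.add_mem _ ?_ (iota_mem P (delta_mem h))
  cases k with
  | zero => rw [iota_of_mem_zero P h, map_zero]; exact Submodule.zero_mem _
  | succ k => exact delta_mem (iota_mem P h)

theorem totalDer_lieForm {P : VectorField F I V} (hP : P ∈ evolutionary F I V)
    (ω : DeRham F I V) : totalDer F I V (lieForm P ω) = lieForm P (totalDer F I V ω) := by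
  rw [mem_evolutionary_iff_iota] at hP
  rw [lieForm_apply, lieForm_apply, map_add, totalDer_delta, ← hP, ← hP, totalDer_delta]

end Cartan

/-! ### The $\mathfrak g^\partial$-complex structure on the quotient by total derivatives -/

section VariationalComplex

variable (F : Type u) (I : Type v) (V : Type w) [Field F] [CommRing V] [Algebra F V]
  [DiffFunctionAlgebra F I V]

/-- The Lie derivative on `Ω̃^k`. -/
noncomputable def lieFormDeg (P : VectorField F I V) (k : ℕ) :
    deRhamDeg F I V k →ₗ[F] deRhamDeg F I V k :=
  (lieForm P).restrict fun _ h => lieForm_mem P h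

/-- A linear map `Ω̃^k → Ω̃^l` that commutes with `∂` induces a linear map `Ω^k → Ω^l`. -/
noncomputable def VarForm.map {k l : ℕ} (T : deRhamDeg F I V k →ₗ[F] deRhamDeg F I V l)
    (hT : ∀ ω, T (totalDerDeg F I V k ω) = totalDerDeg F I V l (T ω)) :
    VarForm F I V k →ₗ[F] VarForm F I V l :=
  Submodule.mapQ _ _ T (by
    rintro _ ⟨ω, rfl⟩
    exact ⟨T ω, (hT ω).symm⟩)

/-- The variational complex. -/
noncomputable def variationalComplex : GComplex F (evolutionary F I V) (VarForm F I V) where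
  d k := VarForm.map F I V (deltaDeg F I V k) fun ω => Subtype.ext (totalDer_delta _).symm
  contr k :=
    { toFun := fun X => VarForm.map F I V (iotaDeg (X : VectorField F I V) k) fun ω =>
        Subtype.ext ((mem_evolutionary_iff_iota _).1 X.2 _)
      map_add' := fun X Y => Submodule.linearMap_qext _ <| LinearMap.ext fun ω =>
        congrArg Submodule.Quotient.mk (Subtype.ext (iota_add _ _ _))
      map_smul' := fun r X => Submodule.linearMap_qext _ <| LinearMap.ext fun ω =>
        congrArg Submodule.Quotient.mk (Subtype.ext (iota_smul_left _ _ _)) }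
  lieD k :=
    { toFun := fun X => VarForm.map F I V (lieFormDeg F I V (X : VectorField F I V) k) fun ω =>
        Subtype.ext (totalDer_lieForm X.2 _).symm
      map_add' := fun X Y => Submodule.linearMap_qext _ <| LinearMap.ext fun ω =>
        congrArg Submodule.Quotient.mk (Subtype.ext (by
          change lieForm ((X : VectorField F I V) + (Y : VectorField F I V)) (ω : DeRham F I V) =
            lieForm (X : VectorField F I V) (ω : DeRham F I V) +
              lieForm (Y : VectorField F I V) (ω : DeRham F I V)
          simp only [lieForm_apply, iota_add, map_add]
          abel))
      map_smul' := fun r X => Submodule.linearMap_qext _ <| LinearMap.ext fun ω =>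
        congrArg Submodule.Quotient.mk (Subtype.ext (by
          change lieForm (r • (X : VectorField F I V)) (ω : DeRham F I V) =
            r • lieForm (X : VectorField F I V) (ω : DeRham F I V)
          simp only [lieForm_apply, iota_smul_left, map_smul, smul_add])) }
  d_d k := by
    rintro ⟨ω⟩
    exact congrArg Submodule.Quotient.mk (Subtype.ext (delta_delta _))
  lieD_zero X := by
    rintro ⟨ω⟩
    refine congrArg Submodule.Quotient.mk (Subtype.ext ?_)
    change lieForm (X : VectorField F I V) (ω : DeRham F I V) = iota _ (delta F I V ω)
    rw [lieForm_apply, iota_of_mem_zero _ ω.2, map_zero, zero_add]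
  lieD_succ k X := by
    rintro ⟨ω⟩
    exact congrArg Submodule.Quotient.mk (Subtype.ext (lieForm_apply _ _))
  d_lieD k X := by
    rintro ⟨ω⟩
    exact congrArg Submodule.Quotient.mk (Subtype.ext (delta_lieForm _ _))
  contr_contr k X Y := by
    rintro ⟨ω⟩
    exact congrArg Submodule.Quotient.mk (Subtype.ext (iota_iota _ _ _))
  lieD_contr k X Y := by
    rintro ⟨ω⟩
    exact congrArg Submodule.Quotient.mk (Subtype.ext (lieForm_iota _ _ _))
  lieD_lieD k X Y := by
    rintro ⟨ω⟩
    exact congrArg Submodule.Quotient.mk (Subtype.ext (lieForm_lieForm _ _ _))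

theorem isVariationalComplex : IsVariationalComplex (variationalComplex F I V) :=
  ⟨fun _ _ => rfl, fun _ _ _ => rfl⟩

end VariationalComplex

/-! ### The Lie algebra of evolutionary vector fields -/

section ChainField

variable {F : Type u} {I : Type v} {V : Type w} [Field F] [CommRing V] [Algebra F V]
  [DiffFunctionAlgebra F I V]

local notation "∂V" => DiffFunctionAlgebra.der (F := F) (I := I) (V := V)
local notation "derV" => LieConformalModule.deriv (F := F) (A := FreeDiffModule F I) (M := V)

theorem aeval_derV_comm (p : F[X]) (f : V) :
    Polynomial.aeval derV p (derV f) = derV (Polynomial.aeval derV p f) :=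
  (aeval_intertwine F (T := derV) (fun _ => rfl) p f).symm

/-- The evolutionary vector field that corresponds to `a ⊗ f`. -/
noncomputable def tensorField (a : FreeDiffModule F I) (f : V) : evolutionary F I V :=
  ⟨fun i n => Polynomial.aeval derV (symb a (Finsupp.single (i, n) 1)) f, fun i n => by
    have h := symb_shift a (Finsupp.single (i, n) 1)
    rw [Finsupp.lmapDomain_apply, Finsupp.mapDomain_single] at h
    change Polynomial.aeval derV (symb a (Finsupp.single (i, n + 1) 1)) f = _
    rw [h, map_mul, Polynomial.aeval_X]
    rfl⟩

theorem tensorField_apply (a : FreeDiffModule F I) (f : V) (i : I) (n : ℕ) :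
    (tensorField a f : VectorField F I V) i n =
      Polynomial.aeval derV (symb a (Finsupp.single (i, n) 1)) f := rfl

theorem evolutionary_ext {X Y : evolutionary F I V}
    (h : ∀ i n, (X : VectorField F I V) i n = (Y : VectorField F I V) i n) : X = Y :=
  Subtype.ext (funext fun i => funext fun n => h i n)

theorem evolutionary_coe_add (X Y : evolutionary F I V) (i : I) (n : ℕ) :
    ((X + Y : evolutionary F I V) : VectorField F I V) i n =
      (X : VectorField F I V) i n + (Y : VectorField F I V) i n := rfl

theorem evolutionary_coe_smul (r : F) (X : evolutionary F I V) (i : I) (n : ℕ) :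
    ((r • X : evolutionary F I V) : VectorField F I V) i n = r • (X : VectorField F I V) i n := rfl

variable (F I V) in
/-- The linear map `R ⊗ V → 𝔤^∂`. -/
noncomputable def tensorFieldHom : (FreeDiffModule F I ⊗[F] V) →ₗ[F] evolutionary F I V :=
  TensorProduct.lift <| LinearMap.mk₂ F tensorField
    (fun a b f => evolutionary_ext fun i n => by
      simp only [evolutionary_coe_add, tensorField_apply, symb_add, map_add, LinearMap.add_apply])
    (fun r a f => evolutionary_ext fun i n => by
      simp only [evolutionary_coe_smul, tensorField_apply, symb_smul, map_smul,
        LinearMap.smul_apply])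
    (fun a f g => evolutionary_ext fun i n => by
      simp only [evolutionary_coe_add, tensorField_apply, map_add])
    (fun r a f => evolutionary_ext fun i n => by
      simp only [evolutionary_coe_smul, tensorField_apply, map_smul])

theorem tensorFieldHom_tmul (a : FreeDiffModule F I) (f : V) :
    tensorFieldHom F I V (a ⊗ₜ f) = tensorField a f := rfl

/-- The pairing gains the factor $-\lambda$, and $\lambda$ acts as $\partial$ on $f$. This is why
$\partial(R\otimes\mathcal V)$ goes to zero. -/
theorem tensorField_X_smul (a : FreeDiffModule F I) (f : V) :
    tensorField ((Polynomial.X : F[X]) • a) f = -tensorField a (derV f) := by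
  refine evolutionary_ext fun i n => ?_
  change _ = -(tensorField a (derV f) : VectorField F I V) i n
  rw [tensorField_apply, tensorField_apply, symb_X_smul, aeval_derV_comm, map_mul, map_neg,
    Polynomial.aeval_X]
  rfl

theorem tensorFieldHom_tensorDeriv (x : FreeDiffModule F I ⊗[F] V) :
    tensorFieldHom F I V (tensorDeriv F (FreeDiffModule F I) V x) = 0 := by
  induction x with
  | zero => simp
  | add x y hx hy => rw [map_add, map_add, hx, hy, add_zero]
  | tmul a f =>
    rw [tensorDeriv_tmul, map_add, tensorFieldHom_tmul, tensorFieldHom_tmul, deriv_free,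
      tensorField_X_smul, neg_add_cancel]

theorem tensorField_gen (i : I) (f : V) [DecidableEq I] :
    tensorField (gen F i) f = evolutionaryField F I (Pi.single i f) := by
  refine evolutionary_ext fun j n => ?_
  rw [tensorField_apply, symb_gen]
  change _ = ((∂V : V →ₗ[F] V) ^ n) ((Pi.single i f : I → V) j)
  by_cases h : i = j
  · subst h
    rw [if_pos rfl, one_smul, map_pow, Polynomial.aeval_X, Pi.single_eq_same]
    rfl
  · rw [if_neg h, Pi.single_eq_of_ne (Ne.symm h), map_zero, map_zero, LinearMap.zero_apply]

/-- Both sides are $\sum_x\langle a,\delta u_x\rangle(\partial)f\cdot\partial g/\partial u_x$. The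
abstract action of chains on $\mathcal V$ is thus the action of the corresponding vector fields. -/
theorem toDer_tensorField (a : FreeDiffModule F I) (f g : V) :
    VectorField.toDer (tensorField a f : VectorField F I V) g =
      arrow F (FreeDiffModule F I) V f (freeAct F I V a g) := by
  classical
  induction a using free_induction generalizing f with
  | zero => simp [VectorField.toDer_apply, tensorField_apply, symb_zero]
  | add a b ha hb =>
    simp only [map_add, LinearMap.add_apply, ← ha, ← hb, VectorField.toDer_apply, ← Finsupp.sum_add,
      tensorField_apply, symb_add, add_mul]
  | smul r a ha =>
    simp only [map_smul, LinearMap.smul_apply, ← ha, VectorField.toDer_apply, Finsupp.smul_sum,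
      tensorField_apply, symb_smul, smul_mul_assoc]
  | deriv a ha =>
    rw [tensorField_X_smul, freeAct_X_smul, map_neg, arrow_lam, ← ha]
    change VectorField.toDer (-(tensorField a (derV f) : VectorField F I V)) g = _
    rw [← neg_one_smul F, VectorField.toDer_smul, neg_one_smul]
  | base i =>
    rw [freeAct_gen, genAct_eq_sum, map_finsuppSum, VectorField.toDer_apply]
    refine Finsupp.sum_congr fun x _ => ?_
    rw [tensorField_apply, symb_gen]
    split_ifs
    · rw [one_smul, map_pow, Polynomial.aeval_X, arrow_apply, Finsupp.sum_single_index (by simp),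
        mul_comm]
    · simp

theorem toDer_tensorFieldHom (x : FreeDiffModule F I ⊗[F] V) (g : V) :
    VectorField.toDer (tensorFieldHom F I V x : VectorField F I V) g =
      chainAct F (FreeDiffModule F I) V x g := by
  induction x with
  | zero =>
    rw [map_zero, map_zero]
    change VectorField.toDer (0 : VectorField F I V) g = 0
    rw [← zero_smul F (0 : VectorField F I V), VectorField.toDer_smul, zero_smul]
  | add x y hx hy =>
    rw [map_add, map_add, LinearMap.add_apply, ← hx, ← hy]
    exact VectorField.toDer_add _ _ _
  | tmul a f => exact toDer_tensorField a f g

theorem tensorFieldHom_lTensor {T : V →ₗ[F] V} (hT : ∀ f, T (derV f) = derV (T f))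
    (x : FreeDiffModule F I ⊗[F] V) (i : I) (n : ℕ) :
    (tensorFieldHom F I V (T.lTensor _ x) : VectorField F I V) i n =
      T ((tensorFieldHom F I V x : VectorField F I V) i n) := by
  induction x with
  | zero => simp only [map_zero]; exact (map_zero T).symm
  | add x y hx hy => simp only [map_add, evolutionary_coe_add, hx, hy]
  | tmul a f =>
    rw [LinearMap.lTensor_tmul, tensorFieldHom_tmul, tensorFieldHom_tmul, tensorField_apply,
      tensorField_apply, aeval_intertwine F hT]

/-- As $R$ has zero $\lambda$-bracket, the bracket of chains lets each act on the $\mathcal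
V$-factor of the other. Such an action commutes with $\partial$, so it passes through the
coefficients and gives $X(Q_{i,n})-Y(P_{i,n})$. -/
theorem tensorFieldHom_preBracket (x y : FreeDiffModule F I ⊗[F] V) :
    tensorFieldHom F I V (preBracket F (FreeDiffModule F I) V x y) =
      ⁅tensorFieldHom F I V x, tensorFieldHom F I V y⁆ := by
  refine evolutionary_ext fun i n => ?_
  rw [preBracket_eq F (fun _ _ => rfl), LieSubalgebra.coe_bracket, VectorField.lie_apply,
    toDer_tensorFieldHom, toDer_tensorFieldHom, map_sub,
    ← tensorFieldHom_lTensor (fun f => chainAct_comm F x f),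
    ← tensorFieldHom_lTensor (fun f => chainAct_comm F y f)]
  rfl

theorem proj_deriv_tmul (a : FreeDiffModule F I) (f : V) :
    OneChain.proj F (FreeDiffModule F I) V (((Polynomial.X : F[X]) • a) ⊗ₜ f) =
      -OneChain.proj F (FreeDiffModule F I) V (a ⊗ₜ derV f) := by
  refine eq_neg_of_add_eq_zero_left ?_
  rw [← map_add]
  exact (Submodule.Quotient.mk_eq_zero _).2 ⟨a ⊗ₜ f, rfl⟩

variable (F I V) in
/-- The linear map `C_1 → 𝔤^∂`. -/
noncomputable def chainField : OneChain F (FreeDiffModule F I) V →ₗ[F] evolutionary F I V :=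
  Submodule.liftQ _ (tensorFieldHom F I V) (by
    rintro _ ⟨x, rfl⟩
    exact tensorFieldHom_tensorDeriv x)

theorem chainField_proj (x : FreeDiffModule F I ⊗[F] V) :
    chainField F I V (OneChain.proj F (FreeDiffModule F I) V x) = tensorFieldHom F I V x := rfl

variable [Fintype I]

/-- In $C_1$ every $\partial$ can be moved from $R$ to $\mathcal V$ with a sign, so
$p(\partial)u_i\otimes f$ is the class of $u_i\otimes p(-\partial)f$. This makes $X\mapsto\sum_i
u_i\otimes P_{i,0}$ a left inverse. -/
theorem sum_proj_tensorField (a : FreeDiffModule F I) (f : V) :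
    ∑ i, OneChain.proj F (FreeDiffModule F I) V
        (gen F i ⊗ₜ (tensorField a f : VectorField F I V) i 0) =
      OneChain.proj F (FreeDiffModule F I) V (a ⊗ₜ f) := by
  classical
  simp only [tensorField_apply]
  induction a using free_induction generalizing f with
  | zero => simp [symb_zero]
  | add a b ha hb =>
    simp only [symb_add, map_add, LinearMap.add_apply, TensorProduct.tmul_add,
      Finset.sum_add_distrib, ha, hb, TensorProduct.add_tmul]
  | smul r a ha =>
    simp only [symb_smul, map_smul, LinearMap.smul_apply, TensorProduct.tmul_smul,
      ← Finset.smul_sum, ha, ← TensorProduct.smul_tmul']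
  | deriv a ha =>
    rw [proj_deriv_tmul, ← ha]
    simp only [symb_X_smul, aeval_derV_comm, map_mul, map_neg, Polynomial.aeval_X, neg_mul,
      LinearMap.neg_apply, Module.End.mul_apply]
    rw [← Finset.sum_neg_distrib]
    exact Finset.sum_congr rfl fun i _ =>
      map_neg (OneChain.proj F (FreeDiffModule F I) V ∘ₗ TensorProduct.mk F _ V (gen F i)) _
  | base i =>
    rw [Finset.sum_eq_single i]
    · simp [symb_gen]
    · intro j _ hj
      simp [symb_gen, Ne.symm hj]
    · simp

variable (F I V) in
/-- The isomorphism of the Lie algebra of `1`-chains and the Lie algebra of evolutionary vector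
fields. -/
noncomputable def chainFieldEquiv : OneChain F (FreeDiffModule F I) V ≃ₗ⁅F⁆ evolutionary F I V where
  __ := chainField F I V
  map_lie' := by
    rintro ⟨x⟩ ⟨y⟩
    exact tensorFieldHom_preBracket x y
  invFun X := ∑ i, OneChain.proj F (FreeDiffModule F I) V (gen F i ⊗ₜ (X : VectorField F I V) i 0)
  left_inv := by
    rintro ⟨x⟩
    change ∑ i, OneChain.proj F (FreeDiffModule F I) V
      (gen F i ⊗ₜ (tensorFieldHom F I V x : VectorField F I V) i 0) =
        OneChain.proj F (FreeDiffModule F I) V x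
    induction x with
    | zero =>
      rw [map_zero, map_zero]
      refine Finset.sum_eq_zero fun i _ => ?_
      change OneChain.proj F (FreeDiffModule F I) V (gen F i ⊗ₜ (0 : V)) = 0
      rw [TensorProduct.tmul_zero, map_zero]
    | add x y hx hy =>
      simp only [map_add, evolutionary_coe_add, TensorProduct.tmul_add, Finset.sum_add_distrib,
        hx, hy]
    | tmul a f => exact sum_proj_tensorField a f
  right_inv X := by
    classical
    change chainField F I V (∑ i, _) = X
    rw [map_sum]
    simp only [chainField_proj, tensorFieldHom_tmul]
    refine evolutionary_ext fun j n => ?_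
    have h : ∀ (s : Finset I) (Y : I → evolutionary F I V),
        ((∑ i ∈ s, Y i : evolutionary F I V) : VectorField F I V) j n =
          ∑ i ∈ s, (Y i : VectorField F I V) j n := by
      intro s Y
      induction s using Finset.induction_on with
      | empty => rfl
      | insert i s hi ih => rw [Finset.sum_insert hi, Finset.sum_insert hi, ← ih]; rfl
    rw [h, Finset.sum_eq_single j]
    -- The field rebuilt from $P_{j,0}$ has coefficients $\partial^nP_{j,0}$, and an evolutionary
    -- field satisfies $P_{j,n+1}=\partial P_{j,n}$.
    · rw [tensorField_apply, symb_gen, if_pos rfl, one_smul, map_pow, Polynomial.aeval_X]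
      clear h
      induction n with
      | zero => rfl
      | succ n ih =>
        rw [pow_succ', Module.End.mul_apply, ih]
        exact (X.2 j n).symm
    · intro i _ hi
      rw [tensorField_apply, symb_gen, if_neg hi, map_zero, LinearMap.zero_apply]
    · simp

end ChainField

/-! ### Transport of complexes -/

section Transport

variable {F : Type*} {𝔤 𝔥 : Type*} {B C : ℕ → Type*} [Field F]
  [LieRing 𝔤] [LieAlgebra F 𝔤] [LieRing 𝔥] [LieAlgebra F 𝔥]
  [∀ k, AddCommGroup (B k)] [∀ k, Module F (B k)] [∀ k, AddCommGroup (C k)] [∀ k, Module F (C k)]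

/-- The `𝔤`-complex structure induced by an `𝔥`-complex structure along isomorphisms. -/
noncomputable def GComplex.transport (T : GComplex F 𝔥 C) (φ : 𝔤 ≃ₗ⁅F⁆ 𝔥)
    (e : ∀ k, B k ≃ₗ[F] C k) : GComplex F 𝔤 B where
  d k := (e (k + 1)).symm.toLinearMap ∘ₗ T.d k ∘ₗ (e k).toLinearMap
  contr k := LinearMap.mk₂ F (fun X b => (e k).symm (T.contr k (φ X) (e (k + 1) b)))
    (by simp) (by simp) (by simp) (by simp)
  lieD k := LinearMap.mk₂ F (fun X b => (e k).symm (T.lieD k (φ X) (e k b)))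
    (by simp) (by simp) (by simp) (by simp)
  d_d k b := by simp [T.d_d]
  lieD_zero X b := by simp [T.lieD_zero]
  lieD_succ k X b := by simp [T.lieD_succ]
  d_lieD k X b := by simp [T.d_lieD]
  contr_contr k X Y b := by simp [← map_add, T.contr_contr]
  lieD_contr k X Y b := by simp [← map_sub, T.lieD_contr, LieEquiv.map_lie]
  lieD_lieD k X Y b := by simp [← map_sub, T.lieD_lieD, LieEquiv.map_lie]

/-- The isomorphism of the transported complex with the original one. -/
noncomputable def GComplex.transportIso (T : GComplex F 𝔥 C) (φ : 𝔤 ≃ₗ⁅F⁆ 𝔥)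
    (e : ∀ k, B k ≃ₗ[F] C k) : GComplex.Iso (T.transport φ e) T where
  lieEquiv := φ
  equiv := e
  map_d k b := by simp [GComplex.transport]
  map_contr k X b := by simp [GComplex.transport]
  map_lieD k X b := by simp [GComplex.transport]

end Transport

/-! ### The isomorphism of the complex of poly `λ`-brackets and the variational complex -/

section Main

variable (F : Type u) (I : Type v) (V : Type w) [Field F] [CommRing V] [Algebra F V]
  [DiffFunctionAlgebra F I V] [Fintype I] [CharZero F]

/-- The complex of poly `λ`-brackets. -/
noncomputable def polyBracketComplex : GComplex F (OneChain F (FreeDiffModule F I) V)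
    (PolyBracket F (FreeDiffModule F I) V) :=
  -- Defining the structure by transport makes $d^2=0$ and the other relations hold at once; that it
  -- is the prescribed structure is the content of `isPolyBracketComplex`.
  (variationalComplex F I V).transport (chainFieldEquiv F I V) (bracketEquivForm F I V)

theorem polyBracketComplex_d (k : ℕ) (ω : deRhamDeg F I V k) :
    (polyBracketComplex F I V).d k (symbBracket k ω) =
      symbBracket (k + 1) (deltaDeg F I V k ω) := by
  change (bracketEquivForm F I V (k + 1)).symm ((variationalComplex F I V).d k
    (bracketEquivForm F I V k (symbBracket k ω))) = _
  rw [bracketEquivForm_symbBracket]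
  rfl

theorem polyBracketComplex_contr (k : ℕ) (a : FreeDiffModule F I) (f : V)
    (ω : deRhamDeg F I V (k + 1)) :
    (polyBracketComplex F I V).contr k (OneChain.proj F (FreeDiffModule F I) V (a ⊗ₜ f))
        (symbBracket (k + 1) ω) =
      symbBracket k (iotaDeg (tensorField a f : VectorField F I V) k ω) := by
  change (bracketEquivForm F I V k).symm ((variationalComplex F I V).contr k (tensorField a f)
    (bracketEquivForm F I V (k + 1) (symbBracket (k + 1) ω))) = _
  rw [bracketEquivForm_symbBracket]
  rfl

/-- Every poly $\lambda$-bracket comes from a form, so the formulas need only be checked on brackets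
of forms, where they are the compatibilities with $\delta$ and with contractions. -/
theorem isPolyBracketComplex : IsPolyBracketComplex F I V (polyBracketComplex F I V) := by
  refine ⟨⟨fun m a => ?_, fun n c a => ?_⟩, fun a m c => ?_, fun n a m c b => ?_⟩
  · rw [← symbBracket_zero_tmul_one, polyBracketComplex_d, symbBracket_deltaDeg_zero]
  · obtain ⟨ω, rfl⟩ := symbBracket_surjective _ c
    rw [polyBracketComplex_d, symbBracket_deltaDeg_succ]
  · obtain ⟨ω, rfl⟩ := symbBracket_surjective _ c
    rw [polyBracketComplex_contr, symbBracket_iotaDeg_zero fun x => tensorField_apply a m x.1 x.2]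
  · obtain ⟨ω, rfl⟩ := symbBracket_surjective _ c
    rw [polyBracketComplex_contr, symbBracket_iotaDeg_succ fun x => tensorField_apply a m x.1 x.2]

end Main

end VarCalc

open VarCalc
theorem theorem0p1 (F : Type*) [Field F] [CharZero F] (ℓ : ℕ) (V : Type*) [CommRing V]
    [Algebra F V] [DiffFunctionAlgebra F (Fin ℓ) V] :
    ∃ (S : GComplex F (OneChain F (FreeDiffModule F (Fin ℓ)) V)
          (PolyBracket F (FreeDiffModule F (Fin ℓ)) V))
      (T : GComplex F (evolutionary F (Fin ℓ) V) (VarForm F (Fin ℓ) V)),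
      IsPolyBracketComplex F (Fin ℓ) V S ∧ IsVariationalComplex T ∧
      ∃ φ : GComplex.Iso S T, ∀ (i : Fin ℓ) (f : V),
        φ.lieEquiv (OneChain.proj F (FreeDiffModule F (Fin ℓ)) V (gen F i ⊗ₜ[F] f)) =
          evolutionaryField F (Fin ℓ) (Pi.single i f) :=
  ⟨polyBracketComplex F (Fin ℓ) V, variationalComplex F (Fin ℓ) V,
    isPolyBracketComplex F (Fin ℓ) V, isVariationalComplex F (Fin ℓ) V,
    (variationalComplex F (Fin ℓ) V).transportIso _ _, fun i f => tensorField_gen i f⟩
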